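/- Let $\Sigma$ be an alphabet, finite or infinite. \textbf{Ipomsets.} A \emph{lo-set} is a finite strictly totally ordered set with labels in $\Sigma$. A \emph{labelled iposet} $(P,<,\dashrightarrow,S,T,\lambda)$ is a finite set $P$ with two strict partial orders, precedence $<$ and event order $\dashrightarrow$, such that any two distinct elements are comparable by $<$ or by $\dashrightarrow$, a labelling $\lambda:P\to\Sigma$, and interfaces $S,T\subseteq P$ whose elements are $<$-minimal and $<$-maximal, respectively; hence $(S,\dashrightarrow)$ and $(T,\dashrightarrow)$ are lo-sets. A \emph{subsumption} $f:P\to Q$ is a label-preserving bijection with $f(S_P)=S_Q$ and $f(T_P)=T_Q$ such that $f(x)<_Q f(y)$ implies $x<_P y$, and such that $x\dashrightarrow_P y$ with $x,y$ $<_P$-incomparable implies $f(x)\dashrightarrow_Q f(y)$. We write $P\sqsubseteq Q$ if there is a subsumption $P\to Q$. An \emph{isomorphism} is a subsumption that is an isomorphism for $<$; an \emph{ipomset} is an isomorphism class of labelled iposets. An ipomset is \emph{interval} if there are $b,e:P\to\mathbb{R}$ with $b\le e$ and $x<y\iff e(x)<b(y)$. For lo-sets $S,T\subseteq U$, ${}_SU_T$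 denotes the ipomset $U$ with empty precedence, the event order of $U$ and interfaces $S,T$. The \emph{parallel composition} $P\parallel Q$ is the disjoint union, with ${<}={<_P}\cup{<_Q}$, with the unions of the source and of the target interfaces, and with $x\dashrightarrow y$ iff $x\dashrightarrow_P y$, $x\dashrightarrow_Q y$, or $x\in P$ and $y\in Q$. The \emph{gluing} $P*Q$ is defined if $T_P\simeq S_Q$ as lo-sets; it is the disjoint union of $P$ and $Q$ with $T_P$ and $S_Q$ identified along the unique isomorphism, with source interface $S_P$, target interface $T_Q$, event order the transitive closure of ${\dashrightarrow_P}\cup{\dashrightarrow_Q}$, and $x<y$ iff $x<_P y$, $x<_Q y$, or $x\in P\setminus T_P$ and $y\in Q\setminus S_Q$. \textbf{Rational languages.} For a set $A$ of ipomsets let $A{\downarrow}$ be the set of interval ipomsets $P$ with $P\sqsubseteq Q$ for some $Q\in A$. A \emph{language} is a set $L$ of interval ipomsets with $L{\downarrow}=L$. Put $L*M=\{P*Q\mid P\in L,\,Q\in M,\,T_P\simeq S_Q\}{\downarrow}$, $L\parallel M=\{P\parallel Q\mid P\in L,\,Q\in M\}{\downarrow}$, and $L^+=\bigcup_{n\ge1}L^n$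 with $L^1=L$ and $L^{n+1}=L*L^n$. The \emph{rational} languages form the smallest class that contains $\emptyset$, $\{\epsilon\}$ (with $\epsilon$ the empty ipomset) and, for each $a\in\Sigma$, the four languages consisting of a single one-element ipomset with label $a$, whose point lies in neither interface, only in the source, only in the target, or in both, and that is closed under $\cup$, $*$, $\parallel$ and ${}^+$. \textbf{Regular languages.} The \emph{labelled precube category} $\square$ has words over $\Sigma$ (isomorphism classes of lo-sets) as objects; a morphism $d_{A,B}:U\to V$ is an order and label preserving injection with image $V\setminus(A\cup B)$, together with the disjoint sets $A,B\subseteq V$; for $d_{A,B}$ with injection $f$ and $d_{C,D}:V\to W$ with injection $g$, the composite $d_{C,D}\circ d_{A,B}$ is $g\circ f$ with the sets $g(A)\cup C$ and $g(B)\cup D$. A \emph{higher-dimensional automaton} (HDA) is a presheaf $X:\square^{\mathrm{op}}\to\mathrm{Set}$ with finitely many cells (elements of the sets $X[U]$) in total, together with sets of start cells and of accept cells. Write $\delta^0_A=X[d_{A,\emptyset}]$ and $\delta^1_B=X[d_{\emptyset,B}]$. A \emph{path} is a finite sequence of cells in which consecutive cells are related by an up-step from $\delta^0_A(x)$ to $x$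 or by a down-step from $x$ to $\delta^1_B(x)$. For $x\in X[U]$, the ipomset of the up-step is ${}_{U\setminus A}U_U$, that of the down-step is ${}_UU_{U\setminus B}$, and that of the path of length $0$ at $x$ is ${}_UU_U$; the ipomset of a path of positive length is the gluing of the ipomsets of its steps. A language is \emph{regular} if it is the set of ipomsets of all paths from a start cell to an accept cell of some HDA. \textbf{Corollary.} Every rational language is regular. -/

import Mathlib

open CategoryTheory Opposite

universe u

/-! ### Lo-sets -/

/-- A lo-set: a finite set, totally ordered by a strict order, with labels in `α`. -/
structure LoSet (α : Type u) where
  carrier : Type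
  finite : Finite carrier
  ord : carrier → carrier → Prop
  label : carrier → α
  irrefl : ∀ x, ¬ ord x x
  trans : ∀ x y z, ord x y → ord y z → ord x z
  total : ∀ x y, x = y ∨ ord x y ∨ ord y x

/-- Isomorphisms of lo-sets: order and label preserving bijections. -/
structure LoIso {α : Type u} (U V : LoSet α) where
  toEquiv : U.carrier ≃ V.carrier
  map_ord : ∀ x y, U.ord x y ↔ V.ord (toEquiv x) (toEquiv y)
  map_label : ∀ x, V.label (toEquiv x) = U.label x

namespace LoIso

variable {α : Type u} {U V W : LoSet α}

def symm (f : LoIso U V) : LoIso V U where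
  toEquiv := f.toEquiv.symm
  map_ord x y := by rw [f.map_ord]; simp
  map_label x := by rw [← f.map_label]; simp

def trans (f : LoIso U V) (g : LoIso V W) : LoIso U W where
  toEquiv := f.toEquiv.trans g.toEquiv
  map_ord x y := by rw [f.map_ord, g.map_ord]; rfl
  map_label x := by rw [← f.map_label, ← g.map_label]; rfl

end LoIso

/-! ### Labelled iposets and ipomsets -/

/-- Labelled iposets: finite sets with a precedence order `prec`, an event order `evord`,
a source interface, a target interface and a labelling. -/
structure Iposet (α : Type u) where
  carrier : Type
  finite : Finite carrier
  prec : carrier → carrier → Prop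
  evord : carrier → carrier → Prop
  src : Set carrier
  tgt : Set carrier
  label : carrier → α
  prec_irrefl : ∀ x, ¬ prec x x
  prec_trans : ∀ x y z, prec x y → prec y z → prec x z
  evord_irrefl : ∀ x, ¬ evord x x
  evord_trans : ∀ x y z, evord x y → evord y z → evord x z
  comparable : ∀ x y, x = y ∨ prec x y ∨ prec y x ∨ evord x y ∨ evord y x
  src_min : ∀ x ∈ src, ∀ y, ¬ prec y x
  tgt_max : ∀ x ∈ tgt, ∀ y, ¬ prec x y

namespace Iposet

variable {α : Type u}

/-- The source interface, as a lo-set with respect to the event order. -/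
abbrev srcLo (P : Iposet α) : LoSet α where
  carrier := P.src
  finite := by have := P.finite; infer_instance
  ord x y := P.evord x y
  label x := P.label x
  irrefl x := P.evord_irrefl x
  trans x y z := P.evord_trans x y z
  total x y := by
    rcases P.comparable x y with h | h | h | h | h
    · exact Or.inl (Subtype.ext h)
    · exact absurd h (P.src_min _ y.2 _)
    · exact absurd h (P.src_min _ x.2 _)
    · exact Or.inr (Or.inl h)
    · exact Or.inr (Or.inr h)

/-- The target interface, as a lo-set with respect to the event order. -/
abbrev tgtLo (P : Iposet α) : LoSet α where
  carrier := P.tgt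
  finite := by have := P.finite; infer_instance
  ord x y := P.evord x y
  label x := P.label x
  irrefl x := P.evord_irrefl x
  trans x y z := P.evord_trans x y z
  total x y := by
    rcases P.comparable x y with h | h | h | h | h
    · exact Or.inl (Subtype.ext h)
    · exact absurd h (P.tgt_max _ x.2 _)
    · exact absurd h (P.tgt_max _ y.2 _)
    · exact Or.inr (Or.inl h)
    · exact Or.inr (Or.inr h)

/-- `f : P → Q` is a subsumption: a label and interface preserving bijection that reflects
precedence and preserves the event order on `prec`-incomparable pairs. -/
structure IsSubsumption (P Q : Iposet α) (f : P.carrier → Q.carrier) : Prop where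
  bijective : Function.Bijective f
  label : ∀ x, Q.label (f x) = P.label x
  src : f '' P.src = Q.src
  tgt : f '' P.tgt = Q.tgt
  prec : ∀ x y, Q.prec (f x) (f y) → P.prec x y
  evord : ∀ x y, P.evord x y → ¬ P.prec x y → ¬ P.prec y x → Q.evord (f x) (f y)

/-- `P ⊑ Q`: there is a subsumption `P → Q`. -/
def Subsumed (P Q : Iposet α) : Prop := ∃ f, IsSubsumption P Q f

/-- `P ≅ Q`: there is a subsumption `P → Q` that is an isomorphism for the precedence order. -/
def Isomorphic (P Q : Iposet α) : Prop :=
  ∃ f, IsSubsumption P Q f ∧ ∀ x y, P.prec x y → Q.prec (f x) (f y)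

theorem IsSubsumption.id (P : Iposet α) : IsSubsumption P P _root_.id where
  bijective := Function.bijective_id
  label _ := rfl
  src := Set.image_id _
  tgt := Set.image_id _
  prec _ _ h := h
  evord _ _ h _ _ := h

theorem IsSubsumption.comp {P Q R : Iposet α} {f : P.carrier → Q.carrier}
    {g : Q.carrier → R.carrier} (hg : IsSubsumption Q R g) (hf : IsSubsumption P Q f) :
    IsSubsumption P R (g ∘ f) where
  bijective := hg.bijective.comp hf.bijective
  label x := (hg.label _).trans (hf.label x)
  src := by rw [Set.image_comp, hf.src, hg.src]
  tgt := by rw [Set.image_comp, hf.tgt, hg.tgt]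
  prec x y h := hf.prec _ _ (hg.prec _ _ h)
  evord x y h h₁ h₂ := hg.evord _ _ (hf.evord _ _ h h₁ h₂)
    (fun h => h₁ (hf.prec _ _ h)) (fun h => h₂ (hf.prec _ _ h))

theorem Subsumed.trans {P Q R : Iposet α} (h : Subsumed P Q) (h' : Subsumed Q R) :
    Subsumed P R := by
  obtain ⟨f, hf⟩ := h
  obtain ⟨g, hg⟩ := h'
  exact ⟨g ∘ f, hg.comp hf⟩

theorem Isomorphic.subsumed {P Q : Iposet α} (h : Isomorphic P Q) : Subsumed P Q := by
  obtain ⟨f, hf, -⟩ := h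
  exact ⟨f, hf⟩

theorem Isomorphic.symm {P Q : Iposet α} (h : Isomorphic P Q) : Isomorphic Q P := by
  obtain ⟨f, hf, hp⟩ := h
  obtain ⟨g, hgf, hfg⟩ := Function.bijective_iff_has_inverse.mp hf.bijective
  refine ⟨g, ⟨?_, ?_, ?_, ?_, ?_, ?_⟩, ?_⟩
  · exact Function.bijective_iff_has_inverse.mpr ⟨f, hfg, hgf⟩
  · intro x; rw [← hf.label, hfg]
  · rw [← hf.src, ← Set.image_comp, hgf.comp_eq_id, Set.image_id]
  · rw [← hf.tgt, ← Set.image_comp, hgf.comp_eq_id, Set.image_id]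
  · intro x y h; have := hp _ _ h; rwa [hfg, hfg] at this
  · intro x y h h₁ h₂
    have k₁ : ¬ P.prec (g x) (g y) := fun k => h₁ (by simpa only [hfg x, hfg y] using hp _ _ k)
    have k₂ : ¬ P.prec (g y) (g x) := fun k => h₂ (by simpa only [hfg x, hfg y] using hp _ _ k)
    rcases P.comparable (g x) (g y) with k | k | k | k | k
    · rw [hfg.injective k] at h; exact absurd h (Q.evord_irrefl _)
    · exact absurd k k₁
    · exact absurd k k₂
    · exact k
    · have := hf.evord _ _ k k₂ k₁
      rw [hfg, hfg] at this
      exact absurd (Q.evord_trans _ _ _ h this) (Q.evord_irrefl _)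
  · intro x y h; apply hf.prec; rwa [hfg, hfg]

theorem Isomorphic.trans {P Q R : Iposet α} (h : Isomorphic P Q) (h' : Isomorphic Q R) :
    Isomorphic P R := by
  obtain ⟨f, hf, hp⟩ := h
  obtain ⟨g, hg, hq⟩ := h'
  exact ⟨g ∘ f, hg.comp hf, fun x y h => hq _ _ (hp _ _ h)⟩

instance isoSetoid (α : Type u) : Setoid (Iposet α) where
  r := Isomorphic
  iseqv := ⟨fun P => ⟨id, IsSubsumption.id P, fun _ _ h => h⟩, Isomorphic.symm, Isomorphic.trans⟩

/-- `P` is an interval iposet: it has an interval representation over the reals. -/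
def IsInterval (P : Iposet α) : Prop :=
  ∃ b e : P.carrier → ℝ, (∀ x, b x ≤ e x) ∧ ∀ x y, P.prec x y ↔ e x < b y

theorem IsInterval.of_isomorphic {P Q : Iposet α} (h : Isomorphic P Q) (hQ : Q.IsInterval) :
    P.IsInterval := by
  obtain ⟨f, hf, hp⟩ := h
  obtain ⟨b, e, hbe, h⟩ := hQ
  exact ⟨b ∘ f, e ∘ f, fun x => hbe _, fun x y =>
    ⟨fun k => (h _ _).1 (hp _ _ k), fun k => hf.prec _ _ ((h _ _).2 k)⟩⟩

/-- The discrete iposet on the word `w` (empty precedence, event order given by the positions in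
the word) with interfaces `S` and `T`. -/
def discrete (w : List α) (S T : Set (Fin w.length)) : Iposet α where
  carrier := Fin w.length
  finite := inferInstance
  prec _ _ := False
  evord x y := x < y
  src := S
  tgt := T
  label := w.get
  prec_irrefl _ h := h
  prec_trans _ _ _ h _ := h
  evord_irrefl := lt_irrefl
  evord_trans _ _ _ := lt_trans
  comparable x y := by rcases lt_trichotomy x y with h | h | h <;> simp [h]
  src_min _ _ _ h := h
  tgt_max _ _ _ h := h

/-- Parallel composition. -/
def par (P Q : Iposet α) : Iposet α where
  carrier := P.carrier ⊕ Q.carrier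
  finite := by have := P.finite; have := Q.finite; infer_instance
  prec := Sum.LiftRel P.prec Q.prec
  evord := Sum.Lex P.evord Q.evord
  src := Sum.inl '' P.src ∪ Sum.inr '' Q.src
  tgt := Sum.inl '' P.tgt ∪ Sum.inr '' Q.tgt
  label := Sum.elim P.label Q.label
  prec_irrefl x := by
    rcases x with x | x
    · simpa using P.prec_irrefl x
    · simpa using Q.prec_irrefl x
  prec_trans x y z := by
    rcases x with x | x <;> rcases y with y | y <;> rcases z with z | z <;> simp
    · exact P.prec_trans x y z
    · exact Q.prec_trans x y z
  evord_irrefl x := by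
    rcases x with x | x
    · simpa using P.evord_irrefl x
    · simpa using Q.evord_irrefl x
  evord_trans x y z := by
    rcases x with x | x <;> rcases y with y | y <;> rcases z with z | z <;> simp
    · exact P.evord_trans x y z
    · exact Q.evord_trans x y z
  comparable x y := by
    rcases x with x | x <;> rcases y with y | y <;> simp
    · exact P.comparable x y
    · exact Q.comparable x y
  src_min x hx y := by
    rcases x with x | x <;> rcases y with y | y <;> simp at hx ⊢
    · exact P.src_min x hx y
    · exact Q.src_min x hx y
  tgt_max x hx y := by
    rcases x with x | x <;> rcases y with y | y <;> simp at hx ⊢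
    · exact P.tgt_max x hx y
    · exact Q.tgt_max x hx y

/-! ### Gluing composition

Let `f : T_P ≃ S_Q` be an isomorphism of lo-sets. The carrier of the gluing, the quotient of the
disjoint union of `P` and `Q` by `x ≡ f x`, is realised as `P ⊕ (Q ∖ S_Q)`. The structural
inclusions are `Sum.inl` and `glueInr f`. -/

section Glue

variable {P Q : Iposet α}

open Classical in
/-- The structural inclusion of `Q` in the gluing of `P` and `Q`. -/
noncomputable def glueInr (f : LoIso P.tgtLo Q.srcLo) (q : Q.carrier) :
    P.carrier ⊕ {q : Q.carrier // q ∉ Q.src} :=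
  if h : q ∈ Q.src then Sum.inl (f.toEquiv.symm ⟨q, h⟩ : P.tgt).1 else Sum.inr ⟨q, h⟩

/-- The precedence order of the gluing. -/
def gluePrec (f : LoIso P.tgtLo Q.srcLo) (x y : P.carrier ⊕ {q : Q.carrier // q ∉ Q.src}) : Prop :=
  (∃ p p', x = Sum.inl p ∧ y = Sum.inl p' ∧ P.prec p p') ∨
  (∃ q q', x = glueInr f q ∧ y = glueInr f q' ∧ Q.prec q q') ∨
  (∃ p q, x = Sum.inl p ∧ y = glueInr f q ∧ p ∉ P.tgt ∧ q ∉ Q.src)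

/-- The union of the two event orders on the gluing. -/
def glueEvStep (f : LoIso P.tgtLo Q.srcLo) (x y : P.carrier ⊕ {q : Q.carrier // q ∉ Q.src}) :
    Prop :=
  (∃ p p', x = Sum.inl p ∧ y = Sum.inl p' ∧ P.evord p p') ∨
  (∃ q q', x = glueInr f q ∧ y = glueInr f q' ∧ Q.evord q q')

variable (f : LoIso P.tgtLo Q.srcLo)

theorem glueInr_of_notMem {q : Q.carrier} (h : q ∉ Q.src) : glueInr f q = Sum.inr ⟨q, h⟩ := by
  simp [glueInr, h]

theorem inl_eq_glueInr_iff {p : P.carrier} {q : Q.carrier} :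
    Sum.inl p = glueInr f q ↔ ∃ h : p ∈ P.tgt, (f.toEquiv ⟨p, h⟩ : Q.src).1 = q := by
  constructor
  · intro h
    by_cases hq : q ∈ Q.src
    · simp only [glueInr, hq, dif_pos, Sum.inl.injEq] at h
      subst h
      exact ⟨Subtype.property _, by simp⟩
    · simp [glueInr, hq] at h
  · rintro ⟨h, rfl⟩
    have hq := (f.toEquiv ⟨p, h⟩ : Q.src).2
    simp [glueInr, hq]

theorem glueInr_injective : Function.Injective (glueInr f) := by
  intro q q' h
  by_cases hq : q ∈ Q.src
  · by_cases hq' : q' ∈ Q.src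
    · simp only [glueInr, hq, hq', dif_pos, Sum.inl.injEq] at h
      have := f.toEquiv.symm.injective (Subtype.ext h)
      exact congrArg Subtype.val this
    · simp [glueInr, hq, hq'] at h
  · by_cases hq' : q' ∈ Q.src
    · simp [glueInr, hq, hq'] at h
    · simpa [glueInr, hq, hq'] using h

theorem gluePrec_irrefl (x) : ¬ gluePrec f x x := by
  rintro (⟨p, p', rfl, h, h'⟩ | ⟨q, q', rfl, h, h'⟩ | ⟨p, q, rfl, h, h₁, h₂⟩)
  · cases h; exact P.prec_irrefl _ h'
  · rw [glueInr_injective f h] at h'; exact Q.prec_irrefl _ h'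
  · exact h₁ ((inl_eq_glueInr_iff f).1 h).1

theorem gluePrec_trans (x y z) (h : gluePrec f x y) (h' : gluePrec f y z) : gluePrec f x z := by
  have hS : ∀ q q', Q.prec q q' → q' ∉ Q.src := fun q q' h h' => Q.src_min _ h' _ h
  have hT : ∀ p p', P.prec p p' → p ∉ P.tgt := fun p p' h h' => P.tgt_max _ h' _ h
  have hne : ∀ p q, q ∉ Q.src → Sum.inl p ≠ glueInr f q := by
    intro p q hq h
    rw [glueInr_of_notMem f hq] at h
    cases h
  rcases h with ⟨p, p', rfl, rfl, h⟩ | ⟨q, q', rfl, rfl, h⟩ | ⟨p, q, rfl, rfl, h₁, h₂⟩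
  · rcases h' with ⟨r, r', e, rfl, k⟩ | ⟨r, r', e, rfl, k⟩ | ⟨r, r', e, rfl, k₁, k₂⟩
    · cases e; exact Or.inl ⟨p, r', rfl, rfl, P.prec_trans _ _ _ h k⟩
    · exact Or.inr (Or.inr ⟨p, r', rfl, rfl, hT _ _ h, hS _ _ k⟩)
    · exact Or.inr (Or.inr ⟨p, r', rfl, rfl, hT _ _ h, k₂⟩)
  · rcases h' with ⟨r, r', e, rfl, k⟩ | ⟨r, r', e, rfl, k⟩ | ⟨r, r', e, rfl, k₁, k₂⟩
    · exact absurd e.symm (hne _ _ (hS _ _ h))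
    · rw [glueInr_injective f e] at h
      exact Or.inr (Or.inl ⟨q, r', rfl, rfl, Q.prec_trans _ _ _ h k⟩)
    · exact absurd e.symm (hne _ _ (hS _ _ h))
  · rcases h' with ⟨r, r', e, rfl, k⟩ | ⟨r, r', e, rfl, k⟩ | ⟨r, r', e, rfl, k₁, k₂⟩
    · exact absurd e.symm (hne _ _ h₂)
    · exact Or.inr (Or.inr ⟨p, r', rfl, rfl, h₁, hS _ _ k⟩)
    · exact absurd e.symm (hne _ _ h₂)

theorem glueEv_irrefl (x) : ¬ Relation.TransGen (glueEvStep f) x x := by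
  have hf : ∀ (t t' : P.carrier) (h : t ∈ P.tgt) (h' : t' ∈ P.tgt), P.evord t t' ↔
      Q.evord (f.toEquiv ⟨t, h⟩ : Q.src).1 (f.toEquiv ⟨t', h'⟩ : Q.src).1 :=
    fun t t' h h' => f.map_ord ⟨t, h⟩ ⟨t', h'⟩
  have key : ∀ y, Relation.TransGen (glueEvStep f) x y →
      (∃ p p', x = Sum.inl p ∧ y = Sum.inl p' ∧ P.evord p p') ∨
      (∃ q q', x = glueInr f q ∧ y = glueInr f q' ∧ Q.evord q q') ∨
      (∃ p, ∃ t, ∃ h : t ∈ P.tgt, ∃ q, x = Sum.inl p ∧ y = glueInr f q ∧ P.evord p t ∧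
        Q.evord (f.toEquiv ⟨t, h⟩ : Q.src).1 q) ∨
      (∃ q, ∃ t, ∃ h : t ∈ P.tgt, ∃ p, x = glueInr f q ∧ y = Sum.inl p ∧
        Q.evord q (f.toEquiv ⟨t, h⟩ : Q.src).1 ∧ P.evord t p) := by
    intro y h
    induction h with
    | single h =>
      rcases h with h | h
      · exact Or.inl h
      · exact Or.inr (Or.inl h)
    | tail _ h ih =>
      rcases ih with ⟨p, p', rfl, rfl, i⟩ | ⟨q, q', rfl, rfl, i⟩ | ⟨p, t, ht, q, rfl, rfl, i, j⟩ |
        ⟨q, t, ht, p, rfl, rfl, i, j⟩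
      · rcases h with ⟨r, r', e, rfl, k⟩ | ⟨r, r', e, rfl, k⟩
        · cases e; exact Or.inl ⟨p, r', rfl, rfl, P.evord_trans _ _ _ i k⟩
        · obtain ⟨hp, rfl⟩ := (inl_eq_glueInr_iff f).1 e
          exact Or.inr (Or.inr (Or.inl ⟨p, p', hp, r', rfl, rfl, i, k⟩))
      · rcases h with ⟨r, r', e, rfl, k⟩ | ⟨r, r', e, rfl, k⟩
        · obtain ⟨hp, rfl⟩ := (inl_eq_glueInr_iff f).1 e.symm
          exact Or.inr (Or.inr (Or.inr ⟨q, r, hp, r', rfl, rfl, i, k⟩))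
        · rw [← glueInr_injective f e] at k
          exact Or.inr (Or.inl ⟨q, r', rfl, rfl, Q.evord_trans _ _ _ i k⟩)
      · rcases h with ⟨r, r', e, rfl, k⟩ | ⟨r, r', e, rfl, k⟩
        · obtain ⟨hp, rfl⟩ := (inl_eq_glueInr_iff f).1 e.symm
          have := (hf _ _ ht hp).2 j
          exact Or.inl ⟨p, r', rfl, rfl,
            P.evord_trans _ _ _ (P.evord_trans _ _ _ i this) k⟩
        · rw [← glueInr_injective f e] at k
          exact Or.inr (Or.inr (Or.inl
            ⟨p, t, ht, r', rfl, rfl, i, Q.evord_trans _ _ _ j k⟩))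
      · rcases h with ⟨r, r', e, rfl, k⟩ | ⟨r, r', e, rfl, k⟩
        · cases e
          exact Or.inr (Or.inr (Or.inr
            ⟨q, t, ht, r', rfl, rfl, i, P.evord_trans _ _ _ j k⟩))
        · obtain ⟨hp, rfl⟩ := (inl_eq_glueInr_iff f).1 e
          have := (hf _ _ ht hp).1 j
          exact Or.inr (Or.inl ⟨q, r', rfl, rfl,
            Q.evord_trans _ _ _ (Q.evord_trans _ _ _ i this) k⟩)
  intro h
  rcases key x h with ⟨p, p', rfl, e, i⟩ | ⟨q, q', rfl, e, i⟩ | ⟨p, t, ht, q, rfl, e, i, j⟩ |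
    ⟨q, t, ht, p, rfl, e, i, j⟩
  · cases e; exact P.evord_irrefl _ i
  · rw [glueInr_injective f e] at i; exact Q.evord_irrefl _ i
  · obtain ⟨hp, rfl⟩ := (inl_eq_glueInr_iff f).1 e
    exact Q.evord_irrefl _ (Q.evord_trans _ _ _ ((hf _ _ hp ht).1 i) j)
  · obtain ⟨hp, rfl⟩ := (inl_eq_glueInr_iff f).1 e.symm
    exact Q.evord_irrefl _ (Q.evord_trans _ _ _ i ((hf _ _ ht hp).1 j))

theorem glue_comparable (x y) : x = y ∨ gluePrec f x y ∨ gluePrec f y x ∨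
    Relation.TransGen (glueEvStep f) x y ∨ Relation.TransGen (glueEvStep f) y x := by
  have hP : ∀ p p' : P.carrier, (Sum.inl p : P.carrier ⊕ {q : Q.carrier // q ∉ Q.src}) = Sum.inl p' ∨
      gluePrec f (Sum.inl p) (Sum.inl p') ∨ gluePrec f (Sum.inl p') (Sum.inl p) ∨
      Relation.TransGen (glueEvStep f) (Sum.inl p) (Sum.inl p') ∨
      Relation.TransGen (glueEvStep f) (Sum.inl p') (Sum.inl p) := by
    intro p p'
    rcases P.comparable p p' with h | h | h | h | h
    · exact Or.inl (by rw [h])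
    · exact Or.inr (Or.inl (Or.inl ⟨p, p', rfl, rfl, h⟩))
    · exact Or.inr (Or.inr (Or.inl (Or.inl ⟨p', p, rfl, rfl, h⟩)))
    · exact Or.inr (Or.inr (Or.inr (Or.inl (.single (Or.inl ⟨p, p', rfl, rfl, h⟩)))))
    · exact Or.inr (Or.inr (Or.inr (Or.inr (.single (Or.inl ⟨p', p, rfl, rfl, h⟩)))))
  have hQ : ∀ q q' : Q.carrier, glueInr f q = glueInr f q' ∨
      gluePrec f (glueInr f q) (glueInr f q') ∨ gluePrec f (glueInr f q') (glueInr f q) ∨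
      Relation.TransGen (glueEvStep f) (glueInr f q) (glueInr f q') ∨
      Relation.TransGen (glueEvStep f) (glueInr f q') (glueInr f q) := by
    intro q q'
    rcases Q.comparable q q' with h | h | h | h | h
    · exact Or.inl (by rw [h])
    · exact Or.inr (Or.inl (Or.inr (Or.inl ⟨q, q', rfl, rfl, h⟩)))
    · exact Or.inr (Or.inr (Or.inl (Or.inr (Or.inl ⟨q', q, rfl, rfl, h⟩))))
    · exact Or.inr (Or.inr (Or.inr (Or.inl (.single (Or.inr ⟨q, q', rfl, rfl, h⟩)))))
    · exact Or.inr (Or.inr (Or.inr (Or.inr (.single (Or.inr ⟨q', q, rfl, rfl, h⟩)))))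
  rcases x with p | ⟨q, hq⟩ <;> rcases y with p' | ⟨q', hq'⟩
  · exact hP p p'
  · rw [← glueInr_of_notMem f hq']
    by_cases hp : p ∈ P.tgt
    · rw [(inl_eq_glueInr_iff f).2 ⟨hp, rfl⟩]; exact hQ _ _
    · exact Or.inr (Or.inl (Or.inr (Or.inr ⟨p, q', rfl, rfl, hp, hq'⟩)))
  · rw [← glueInr_of_notMem f hq]
    by_cases hp : p' ∈ P.tgt
    · rw [(inl_eq_glueInr_iff f).2 ⟨hp, rfl⟩]; exact hQ _ _
    · exact Or.inr (Or.inr (Or.inl (Or.inr (Or.inr ⟨p', q, rfl, rfl, hp, hq⟩))))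
  · rw [← glueInr_of_notMem f hq, ← glueInr_of_notMem f hq']; exact hQ _ _

/-- The gluing composition `P * Q` along the isomorphism `f : T_P ≃ S_Q`. -/
noncomputable def glue (P Q : Iposet α) (f : LoIso P.tgtLo Q.srcLo) : Iposet α where
  carrier := P.carrier ⊕ {q : Q.carrier // q ∉ Q.src}
  finite := by have := P.finite; have := Q.finite; infer_instance
  prec := gluePrec f
  evord := Relation.TransGen (glueEvStep f)
  src := Sum.inl '' P.src
  tgt := glueInr f '' Q.tgt
  label := Sum.elim P.label (fun q => Q.label q)
  prec_irrefl := gluePrec_irrefl f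
  prec_trans := gluePrec_trans f
  evord_irrefl := glueEv_irrefl f
  evord_trans _ _ _ := Relation.TransGen.trans
  comparable := glue_comparable f
  src_min := by
    rintro _ ⟨s, hs, rfl⟩ y (⟨p, p', rfl, e, h⟩ | ⟨q, q', rfl, e, h⟩ | ⟨p, q, rfl, e, -, h⟩)
    · cases e; exact P.src_min _ hs _ h
    · obtain ⟨_, rfl⟩ := (inl_eq_glueInr_iff f).1 e
      exact Q.src_min _ (Subtype.property _) _ h
    · obtain ⟨_, rfl⟩ := (inl_eq_glueInr_iff f).1 e
      exact h (Subtype.property _)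
  tgt_max := by
    rintro _ ⟨t, ht, rfl⟩ y (⟨p, p', e, rfl, h⟩ | ⟨q, q', e, rfl, h⟩ | ⟨p, q, e, rfl, h, -⟩)
    · obtain ⟨k, -⟩ := (inl_eq_glueInr_iff f).1 e.symm
      exact P.tgt_max _ k _ h
    · rw [← glueInr_injective f e] at h; exact Q.tgt_max _ ht _ h
    · exact h ((inl_eq_glueInr_iff f).1 e.symm).1

theorem glue_label_glueInr (q : Q.carrier) : (glue P Q f).label (glueInr f q) = Q.label q := by
  by_cases hq : q ∈ Q.src
  · have := f.symm.map_label ⟨q, hq⟩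
    simpa [glue, glueInr, hq, LoIso.symm] using this
  · simp [glue, glueInr, hq]

/-- An order and label preserving bijection between lo-sets is an isomorphism. -/
noncomputable def _root_.LoIso.ofBijective {U V : LoSet α} (g : U.carrier → V.carrier)
    (hg : Function.Bijective g) (hord : ∀ x y, U.ord x y → V.ord (g x) (g y))
    (hlab : ∀ x, V.label (g x) = U.label x) : LoIso U V where
  toEquiv := Equiv.ofBijective g hg
  map_ord x y := by
    refine ⟨hord x y, fun h => ?_⟩
    rcases U.total x y with k | k | k
    · subst k; exact absurd h (V.irrefl _)
    · exact k
    · exact absurd (V.trans _ _ _ h (hord _ _ k)) (V.irrefl _)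
  map_label := hlab

/-- The source interface of `P * Q` is that of `P`. -/
noncomputable def glueSrc : LoIso P.srcLo (glue P Q f).srcLo :=
  LoIso.ofBijective (fun s => ⟨Sum.inl s.1, s.1, s.2, rfl⟩)
    ⟨fun s s' h => Subtype.ext (Sum.inl_injective (congrArg Subtype.val h)),
      by rintro ⟨_, s, hs, rfl⟩; exact ⟨⟨s, hs⟩, rfl⟩⟩
    (fun s s' h => .single (Or.inl ⟨s.1, s'.1, rfl, rfl, h⟩))
    (fun _ => rfl)

/-- The target interface of `P * Q` is that of `Q`. -/
noncomputable def glueTgt : LoIso Q.tgtLo (glue P Q f).tgtLo :=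
  LoIso.ofBijective (fun t => ⟨glueInr f t.1, t.1, t.2, rfl⟩)
    ⟨fun t t' h => Subtype.ext (glueInr_injective f (congrArg Subtype.val h)),
      by rintro ⟨_, t, ht, rfl⟩; exact ⟨⟨t, ht⟩, rfl⟩⟩
    (fun t t' h => .single (Or.inr ⟨t.1, t'.1, rfl, rfl, h⟩))
    (fun t => glue_label_glueInr f t.1)

end Glue

end Iposet

/-- An ipomset is an isomorphism class of labelled iposets. -/
def Ipomset (α : Type u) := Quotient (Iposet.isoSetoid α)

namespace Ipomset

variable {α : Type u}

/-- The isomorphism class of a labelled iposet. -/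
def mk (P : Iposet α) : Ipomset α := Quotient.mk _ P

/-- The subsumption relation `P ⊑ Q` on ipomsets. -/
def Subsumed : Ipomset α → Ipomset α → Prop :=
  Quotient.lift₂ Iposet.Subsumed fun _ _ _ _ h h' => propext
    ⟨fun k => (h.symm.subsumed.trans k).trans h'.subsumed,
      fun k => (h.subsumed.trans k).trans h'.symm.subsumed⟩

/-- Interval ipomsets. -/
def IsInterval : Ipomset α → Prop :=
  Quotient.lift Iposet.IsInterval fun _ _ h => propext
    ⟨fun k => k.of_isomorphic h.symm, fun k => k.of_isomorphic h⟩

/-- The down-closure of a set of ipomsets in the set of interval ipomsets. -/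
def down (A : Set (Ipomset α)) : Set (Ipomset α) :=
  {P | P.IsInterval ∧ ∃ Q ∈ A, P.Subsumed Q}

/-- Interval ipomset languages: down-closed sets of interval ipomsets. -/
structure IsLanguage (L : Set (Ipomset α)) : Prop where
  interval : ∀ P ∈ L, P.IsInterval
  down_closed : ∀ P Q : Ipomset α, P.IsInterval → P.Subsumed Q → Q ∈ L → P ∈ L

/-- Gluing composition of languages. -/
def langGlue (L M : Set (Ipomset α)) : Set (Ipomset α) :=
  down {R | ∃ (P Q : Iposet α) (f : LoIso P.tgtLo Q.srcLo),
    mk P ∈ L ∧ mk Q ∈ M ∧ R = mk (P.glue Q f)}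

/-- Parallel composition of languages. -/
def langPar (L M : Set (Ipomset α)) : Set (Ipomset α) :=
  down {R | ∃ P Q : Iposet α, mk P ∈ L ∧ mk Q ∈ M ∧ R = mk (P.par Q)}

/-- `langPow L n` is the power of `L` with exponent `n + 1`. -/
def langPow (L : Set (Ipomset α)) : ℕ → Set (Ipomset α)
  | 0 => L
  | n + 1 => langGlue L (langPow L n)

/-- Kleene plus: the union of all powers of `L` with positive exponent. -/
def langPlus (L : Set (Ipomset α)) : Set (Ipomset α) := ⋃ n, langPow L n

/-- The rational languages: the smallest class that contains the empty language, the language of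
the empty ipomset and the singleton languages `{[a]}`, `{[• a]}`, `{[a •]}`, `{[• a •]}`, and is
closed under union, gluing composition, parallel composition and Kleene plus. -/
inductive IsRational : Set (Ipomset α) → Prop
  | empty : IsRational ∅
  | epsilon : IsRational {mk (Iposet.discrete [] ∅ ∅)}
  | letter (a : α) : IsRational {mk (Iposet.discrete [a] ∅ ∅)}
  | letterSrc (a : α) : IsRational {mk (Iposet.discrete [a] Set.univ ∅)}
  | letterTgt (a : α) : IsRational {mk (Iposet.discrete [a] ∅ Set.univ)}
  | letterSrcTgt (a : α) : IsRational {mk (Iposet.discrete [a] Set.univ Set.univ)}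
  | union {L M : Set (Ipomset α)} : IsRational L → IsRational M → IsRational (L ∪ M)
  | glue {L M : Set (Ipomset α)} : IsRational L → IsRational M → IsRational (langGlue L M)
  | par {L M : Set (Ipomset α)} : IsRational L → IsRational M → IsRational (langPar L M)
  | plus {L : Set (Ipomset α)} : IsRational L → IsRational (langPlus L)

end Ipomset

/-! ### The labelled precube category -/

/-- Objects of the labelled precube category: words over `α`, that is, isomorphism classes of
lo-sets. The word `w` stands for the lo-set of its positions. -/
structure Precube (α : Type u) where
  word : List α

namespace Precube

variable {α : Type u}

/-- The lo-set of positions of a word. -/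
abbrev lo (U : Precube α) : LoSet α where
  carrier := Fin U.word.length
  finite := inferInstance
  ord x y := x < y
  label := U.word.get
  irrefl := lt_irrefl
  trans _ _ _ := lt_trans
  total x y := by rcases lt_trichotomy x y with h | h | h <;> simp [h]

/-- Coface maps `d_{A,B} : U ⟶ V`: an order and label preserving map `U → V` whose image is
`V ∖ (A ∪ B)`, with disjoint sets `A` of unstarted and `B` of terminated events. -/
@[ext]
structure Coface (U V : Precube α) where
  emb : Fin U.word.length → Fin V.word.length
  A : Set (Fin V.word.length)
  B : Set (Fin V.word.length)
  strictMono : StrictMono emb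
  label : ∀ i, V.word.get (emb i) = U.word.get i
  disjoint : Disjoint A B
  range : Set.range emb = (A ∪ B)ᶜ

/-- The identity coface map. -/
def Coface.id (U : Precube α) : Coface U U where
  emb := _root_.id
  A := ∅
  B := ∅
  strictMono := strictMono_id
  label _ := rfl
  disjoint := by simp
  range := by simp

theorem Coface.notMem {U V : Precube α} (d : Coface U V) (i) : d.emb i ∉ d.A ∧ d.emb i ∉ d.B := by
  have : d.emb i ∈ (d.A ∪ d.B)ᶜ := d.range ▸ Set.mem_range_self i
  simpa using this

/-- Composition of coface maps. -/
def Coface.comp {U V W : Precube α} (d : Coface U V) (e : Coface V W) : Coface U W where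
  emb := e.emb ∘ d.emb
  A := e.emb '' d.A ∪ e.A
  B := e.emb '' d.B ∪ e.B
  strictMono := e.strictMono.comp d.strictMono
  label i := by rw [← d.label, ← e.label]; rfl
  disjoint := by
    have hd := Set.disjoint_left.1 d.disjoint
    have he := Set.disjoint_left.1 e.disjoint
    rw [Set.disjoint_left]
    rintro _ (⟨i, hi, rfl⟩ | hx) (⟨j, hj, h⟩ | hx')
    · rw [e.strictMono.injective h] at hj; exact hd hi hj
    · exact (e.notMem i).2 hx'
    · subst h; exact (e.notMem j).1 hx
    · exact he hx hx'
  range := by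
    rw [Set.range_comp, d.range, Set.image_compl_eq_range_sdiff_image e.strictMono.injective,
      e.range]
    ext x
    simp only [Set.mem_sdiff, Set.mem_compl_iff, Set.mem_union, Set.image_union]
    tauto

instance : Category (Precube α) where
  Hom := Coface
  id := Coface.id
  comp := Coface.comp
  id_comp d := by ext <;> simp [Coface.comp, Coface.id]
  comp_id d := by ext <;> simp [Coface.comp, Coface.id]
  assoc d e f := by ext <;> simp [Coface.comp, Set.image_union, Set.image_image, or_assoc]

end Precube

/-! ### Ipomsets of steps -/

/-- Labelled iposets with source interface `U` and target interface `V` (up to unique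
isomorphism of lo-sets). -/
structure IposetHom {α : Type u} (U V : LoSet α) where
  iposet : Iposet α
  srcIso : LoIso U iposet.srcLo
  tgtIso : LoIso V iposet.tgtLo

namespace IposetHom

variable {α : Type u}

/-- Gluing composition, which is always defined on matching interfaces. -/
noncomputable def comp {U V W : LoSet α} (P : IposetHom U V) (Q : IposetHom V W) :
    IposetHom U W where
  iposet := P.iposet.glue Q.iposet (P.tgtIso.symm.trans Q.srcIso)
  srcIso := P.srcIso.trans (Iposet.glueSrc _)
  tgtIso := Q.tgtIso.trans (Iposet.glueTgt _)

/-- A coface map is an isomorphism onto its image, seen as a source interface. -/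
noncomputable def rangeSrc {U V : Precube α} (d : U ⟶ V) (S T : Set (Fin V.word.length))
    (hS : Set.range d.emb = S) : LoIso U.lo (Iposet.discrete V.word S T).srcLo :=
  LoIso.ofBijective (V := (Iposet.discrete V.word S T).srcLo)
    (fun i => ⟨d.emb i, hS ▸ Set.mem_range_self i⟩)
    ⟨fun _ _ h => d.strictMono.injective (congrArg Subtype.val h), by
      subst hS; rintro ⟨_, i, rfl⟩; exact ⟨i, rfl⟩⟩
    (fun _ _ h => d.strictMono h) d.label

/-- A coface map is an isomorphism onto its image, seen as a target interface. -/
noncomputable def rangeTgt {U V : Precube α} (d : U ⟶ V) (S T : Set (Fin V.word.length))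
    (hT : Set.range d.emb = T) : LoIso U.lo (Iposet.discrete V.word S T).tgtLo :=
  LoIso.ofBijective (V := (Iposet.discrete V.word S T).tgtLo)
    (fun i => ⟨d.emb i, hT ▸ Set.mem_range_self i⟩)
    ⟨fun _ _ h => d.strictMono.injective (congrArg Subtype.val h), by
      subst hT; rintro ⟨_, i, rfl⟩; exact ⟨i, rfl⟩⟩
    (fun _ _ h => d.strictMono h) d.label

theorem range_id (U : Precube α) : Set.range (Precube.Coface.emb (𝟙 U)) = Set.univ :=
  Set.range_id

/-- The identity ipomset on `U`: all events are in both interfaces. -/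
noncomputable def identity (U : Precube α) : IposetHom U.lo U.lo where
  iposet := Iposet.discrete U.word Set.univ Set.univ
  srcIso := rangeSrc (𝟙 U) _ _ (range_id U)
  tgtIso := rangeTgt (𝟙 U) _ _ (range_id U)

/-- The ipomset of an up-step along `d_A^0 : U ⟶ V`: the events of `V`, with source interface
`V ∖ A` and target interface `V`. -/
noncomputable def upStep {U V : Precube α} (d : U ⟶ V) (hd : d.B = ∅) : IposetHom U.lo V.lo where
  iposet := Iposet.discrete V.word (d.A)ᶜ Set.univ
  srcIso := rangeSrc d _ _ (by rw [d.range, hd, Set.union_empty])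
  tgtIso := rangeTgt (𝟙 V) _ _ (range_id V)

/-- The ipomset of a down-step along `d_B^1 : V ⟶ U`: the events of `U`, with source interface
`U` and target interface `U ∖ B`. -/
noncomputable def downStep {U V : Precube α} (d : V ⟶ U) (hd : d.A = ∅) : IposetHom U.lo V.lo where
  iposet := Iposet.discrete U.word Set.univ (d.B)ᶜ
  srcIso := rangeSrc (𝟙 U) _ _ (range_id U)
  tgtIso := rangeTgt d _ _ (by rw [d.range, hd, Set.empty_union])

end IposetHom

/-! ### Higher-dimensional automata -/

/-- Higher-dimensional automata over `α`: finite precubical sets (presheaves on the labelled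
precube category with finitely many cells) with sets of start and accept cells. -/
structure HDA (α : Type u) where
  cells : (Precube α)ᵒᵖ ⥤ Type
  finite : Finite (Σ U : Precube α, cells.obj (op U))
  start : ∀ U : Precube α, Set (cells.obj (op U))
  accept : ∀ U : Precube α, Set (cells.obj (op U))

namespace HDA

variable {α : Type u}

/-- `Path X x y` is the type of paths in the precubical set `X` from the cell `x` to the cell `y`:
sequences of up-steps from `δ_A^0 y` to `y` and of down-steps from `x` to `δ_B^1 x`. -/
inductive Path (X : (Precube α)ᵒᵖ ⥤ Type) :
    {U V : Precube α} → X.obj (op U) → X.obj (op V) → Type u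
  | nil {U : Precube α} (x : X.obj (op U)) : Path X x x
  | up {U V W : Precube α} (d : U ⟶ V) (hd : d.B = ∅) (y : X.obj (op V)) {z : X.obj (op W)}
      (p : Path X y z) : Path X (X.map d.op y) z
  | down {U V W : Precube α} (d : V ⟶ U) (hd : d.A = ∅) (x : X.obj (op U)) {z : X.obj (op W)}
      (p : Path X (X.map d.op x) z) : Path X x z

/-- The ipomset of a path: the gluing composition of the ipomsets of its steps (and of the
identity ipomset on its last cell, which is neutral). -/
noncomputable def Path.ev {X : (Precube α)ᵒᵖ ⥤ Type} :
    {U V : Precube α} → {x : X.obj (op U)} → {y : X.obj (op V)} → Path X x y →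
      IposetHom U.lo V.lo
  | U, _, _, _, .nil _ => IposetHom.identity U
  | _, _, _, _, .up d hd _ p => (IposetHom.upStep d hd).comp p.ev
  | _, _, _, _, .down d hd _ p => (IposetHom.downStep d hd).comp p.ev

/-- The set of ipomsets recognised by an HDA: the ipomsets of its accepting paths. -/
def lang (X : HDA α) : Set (Ipomset α) :=
  {P | ∃ (U V : Precube α) (x : X.cells.obj (op U)) (y : X.cells.obj (op V)) (p : Path X.cells x y),
    x ∈ X.start U ∧ y ∈ X.accept V ∧ P = Ipomset.mk p.ev.iposet}

end HDA

/-- A language is regular if it is recognised by an HDA. -/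
def Ipomset.IsRegular {α : Type u} (L : Set (Ipomset α)) : Prop :=
  Ipomset.IsLanguage L ∧ ∃ X : HDA α, X.lang = L

/-!
Call a set of iposets recognizable if the labels and antichains of its members are bounded and
finitely many pairs of sets `(A, B)` with `A * B ⊆ L` account for all ways of writing a member of
`L` as a gluing. The singletons of the rational operations are recognizable, and recognizability
passes through the operations: a decomposition of a union, a gluing, a parallel composition or an
iterated gluing comes from decompositions of its factors, and a decomposition of an iposet lifts
along a subsumption.

Conversely, the pairs `(A, B)` serve as the memory of an automaton. A cell over a word `w` attaches
to each of its faces the set of those `B` for which the part of the iposet before this face lies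
in `A`; there are finitely many such cells as the words are bounded in labels and length. A path
accepts only iposets in the sets `B` attached to its first cell, since each of its steps passes to a
face. An interval iposet in `L` is read by adding its points in an order in which their sets of
predecessors increase, and the cells along this path record the decompositions of the iposet.
-/

/-! ### Maps between iposets -/

theorem eq_of_map_rel_of_range_eq {X Y : Type*} [Finite X] {r : X → X → Prop}
    {s : Y → Y → Prop} [IsStrictTotalOrder X r] [IsStrictOrder Y s] {f g : X → Y}
    (hf : ∀ x y, r x y → s (f x) (f y)) (hg : ∀ x y, r x y → s (g x) (g y))
    (hfg : Set.range f = Set.range g) : f = g := by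
  classical
  let := linearOrderOfSTO r
  let := partialOrderOfSO s
  exact (StrictMono.range_inj (fun x y => hf x y) (fun x y => hg x y)).1 hfg

theorem LoSet.isStrictTotalOrder_ord {α : Type u} (U : LoSet α) :
    IsStrictTotalOrder U.carrier U.ord where
  irrefl := U.irrefl
  trans := U.trans
  trichotomous x y hxy hyx := (U.total x y).resolve_right (not_or.2 ⟨hxy, hyx⟩)

namespace Iposet

variable {α : Type u}

instance isStrictOrder_evord (P : Iposet α) : IsStrictOrder P.carrier P.evord where
  irrefl := P.evord_irrefl
  trans := P.evord_trans

/-- An injective label preserving map that reflects precedence and preserves the event order on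
incomparable pairs; a subsumption without the conditions on surjectivity and interfaces. -/
structure IsRefining (P Q : Iposet α) (f : P.carrier → Q.carrier) : Prop where
  injective : Function.Injective f
  label : ∀ x, Q.label (f x) = P.label x
  prec : ∀ x y, Q.prec (f x) (f y) → P.prec x y
  evord : ∀ x y, P.evord x y → ¬ P.prec x y → ¬ P.prec y x → Q.evord (f x) (f y)

/-- A refining map that also preserves precedence: an isomorphism onto its image, up to the event
order of comparable pairs. -/
structure IsEmbedding (P Q : Iposet α) (f : P.carrier → Q.carrier) : Prop
    extends IsRefining P Q f where
  map_prec : ∀ x y, P.prec x y → Q.prec (f x) (f y)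

variable {P Q R : Iposet α}

theorem IsSubsumption.isRefining {f : P.carrier → Q.carrier} (h : IsSubsumption P Q f) :
    IsRefining P Q f :=
  ⟨h.bijective.injective, h.label, h.prec, h.evord⟩

theorem IsRefining.isSubsumption {f : P.carrier → Q.carrier} (h : IsRefining P Q f)
    (hsurj : Function.Surjective f) (hs : f '' P.src = Q.src) (ht : f '' P.tgt = Q.tgt) :
    IsSubsumption P Q f :=
  ⟨⟨h.injective, hsurj⟩, h.label, hs, ht, h.prec, h.evord⟩

theorem IsRefining.comp {f : P.carrier → Q.carrier} {g : Q.carrier → R.carrier}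
    (hg : IsRefining Q R g) (hf : IsRefining P Q f) : IsRefining P R (g ∘ f) where
  injective := hg.injective.comp hf.injective
  label x := (hg.label _).trans (hf.label x)
  prec _ _ h := hf.prec _ _ (hg.prec _ _ h)
  evord _ _ h hxy hyx := hg.evord _ _ (hf.evord _ _ h hxy hyx)
    (fun k => hxy (hf.prec _ _ k)) (fun k => hyx (hf.prec _ _ k))

namespace IsEmbedding

theorem comp {f : P.carrier → Q.carrier} {g : Q.carrier → R.carrier}
    (hg : IsEmbedding Q R g) (hf : IsEmbedding P Q f) : IsEmbedding P R (g ∘ f) :=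
  ⟨hg.toIsRefining.comp hf.toIsRefining, fun _ _ h => hg.map_prec _ _ (hf.map_prec _ _ h)⟩

theorem prec_iff {f : P.carrier → Q.carrier} (h : IsEmbedding P Q f) (x y) :
    Q.prec (f x) (f y) ↔ P.prec x y :=
  ⟨h.prec x y, h.map_prec x y⟩

theorem evord_of_evord_map {f : P.carrier → Q.carrier} (h : IsEmbedding P Q f) {x y}
    (hevord : Q.evord (f x) (f y)) (hxy : ¬ P.prec x y) (hyx : ¬ P.prec y x) : P.evord x y := by
  rcases P.comparable x y with rfl | k | k | k | k
  · exact absurd hevord (Q.evord_irrefl _)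
  · exact absurd k hxy
  · exact absurd k hyx
  · exact k
  · exact absurd (Q.evord_trans _ _ _ hevord (h.evord _ _ k hyx hxy)) (Q.evord_irrefl _)

theorem isomorphic {f : P.carrier → Q.carrier} (h : IsEmbedding P Q f)
    (hsurj : Function.Surjective f) (hs : f '' P.src = Q.src) (ht : f '' P.tgt = Q.tgt) :
    Isomorphic P Q :=
  ⟨f, h.toIsRefining.isSubsumption hsurj hs ht, h.map_prec⟩

end IsEmbedding

theorem IsRefining.of_comp {f : P.carrier → R.carrier} (hf : IsRefining P R f)
    {g : Q.carrier → R.carrier} (hg : IsEmbedding Q R g) {h : P.carrier → Q.carrier}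
    (hgh : ∀ x, g (h x) = f x) : IsRefining P Q h := by
  have hprec : ∀ x y, Q.prec (h x) (h y) → P.prec x y := fun x y k =>
    hf.prec _ _ (by rw [← hgh, ← hgh]; exact hg.map_prec _ _ k)
  refine ⟨fun x y k => hf.injective ?_, fun x => ?_, hprec, fun x y k hxy hyx => ?_⟩
  · rw [← hgh, ← hgh, k]
  · rw [← hg.label, hgh, hf.label]
  · refine hg.evord_of_evord_map ?_ (fun k => hxy (hprec _ _ k)) fun k => hyx (hprec _ _ k)
    rw [hgh, hgh]
    exact hf.evord _ _ k hxy hyx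

theorem IsEmbedding.of_comp {f : P.carrier → R.carrier} (hf : IsEmbedding P R f)
    {g : Q.carrier → R.carrier} (hg : IsEmbedding Q R g) {h : P.carrier → Q.carrier}
    (hgh : ∀ x, g (h x) = f x) : IsEmbedding P Q h :=
  ⟨hf.toIsRefining.of_comp hg hgh, fun x y hxy =>
    hg.prec _ _ (by rw [hgh, hgh]; exact hf.map_prec _ _ hxy)⟩

/-- The reversal of an iposet: precedence is reversed and the interfaces are exchanged, whereas the
event order is kept. It is used to transfer statements about prefixes to suffixes. -/
def rev (P : Iposet α) : Iposet α where
  carrier := P.carrier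
  finite := P.finite
  prec x y := P.prec y x
  evord := P.evord
  src := P.tgt
  tgt := P.src
  label := P.label
  prec_irrefl := P.prec_irrefl
  prec_trans x y z hxy hyz := P.prec_trans z y x hyz hxy
  evord_irrefl := P.evord_irrefl
  evord_trans := P.evord_trans
  comparable x y := by rcases P.comparable x y with h | h | h | h | h <;> simp [h]
  src_min := P.tgt_max
  tgt_max := P.src_min

theorem IsRefining.rev {f : P.carrier → Q.carrier} (h : IsRefining P Q f) :
    IsRefining P.rev Q.rev f :=
  ⟨h.injective, h.label, fun x y => h.prec y x, fun x y k hxy hyx => h.evord x y k hyx hxy⟩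

theorem IsEmbedding.rev {f : P.carrier → Q.carrier} (h : IsEmbedding P Q f) :
    IsEmbedding P.rev Q.rev f :=
  ⟨h.toIsRefining.rev, fun x y => h.map_prec y x⟩

/-- The restriction of `P` to `C`, with source interface the minimal elements in `S` and target
interface the maximal elements in `T`. Cutting down `S` and `T` in this way makes the restriction
defined for arbitrary sets. -/
def sub (P : Iposet α) (C S T : Set P.carrier) : Iposet α where
  carrier := C
  finite := by have := P.finite; infer_instance
  prec x y := P.prec x y
  evord x y := P.evord x y
  src := {x | x.1 ∈ S ∧ ∀ y ∈ C, ¬ P.prec y x}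
  tgt := {x | x.1 ∈ T ∧ ∀ y ∈ C, ¬ P.prec x y}
  label x := P.label x
  prec_irrefl x := P.prec_irrefl x
  prec_trans x y z := P.prec_trans x y z
  evord_irrefl x := P.evord_irrefl x
  evord_trans x y z := P.evord_trans x y z
  comparable x y := by
    rcases P.comparable x y with h | h | h | h | h
    · exact Or.inl (Subtype.ext h)
    all_goals simp [h]
  src_min x hx y := hx.2 y y.2
  tgt_max x hx y := hx.2 y y.2

section Sub

variable {C S T : Set P.carrier}

/-- The inclusion of a restriction of `P` into `P`. -/
def subVal (x : (P.sub C S T).carrier) : P.carrier := Subtype.val x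

theorem subVal_mem (x : (P.sub C S T).carrier) : subVal x ∈ C :=
  Subtype.property x

theorem range_subVal : Set.range (subVal : (P.sub C S T).carrier → P.carrier) = C :=
  Subtype.range_val

theorem isEmbedding_subVal (P : Iposet α) (C S T : Set P.carrier) :
    IsEmbedding (P.sub C S T) P subVal where
  injective := Subtype.val_injective
  label _ := rfl
  prec _ _ h := h
  evord _ _ h _ _ := h
  map_prec _ _ h := h

theorem subVal_image_src (hS : S ⊆ C) (h : ∀ x ∈ S, ∀ y ∈ C, ¬ P.prec y x) :
    subVal '' (P.sub C S T).src = S :=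
  Set.Subset.antisymm (by rintro _ ⟨y, hy, rfl⟩; exact hy.1)
    fun x hx => ⟨⟨x, hS hx⟩, ⟨hx, h x hx⟩, rfl⟩

theorem subVal_image_tgt (hT : T ⊆ C) (h : ∀ x ∈ T, ∀ y ∈ C, ¬ P.prec x y) :
    subVal '' (P.sub C S T).tgt = T :=
  Set.Subset.antisymm (by rintro _ ⟨y, hy, rfl⟩; exact hy.1)
    fun x hx => ⟨⟨x, hT hx⟩, ⟨hx, h x hx⟩, rfl⟩

end Sub

/-! ### Gluing as a relation -/

/-- `P` is the gluing composition of `R` and `Z`, with structural inclusions `u` and `v`. Treating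
gluing as a relation avoids transporting iposets along isomorphisms. -/
structure Glued (R Z P : Iposet α) (u : R.carrier → P.carrier) (v : Z.carrier → P.carrier) :
    Prop where
  left : IsEmbedding R P u
  right : IsEmbedding Z P v
  src : u '' R.src = P.src
  tgt : v '' Z.tgt = P.tgt
  mid : u '' R.tgt = v '' Z.src
  mem_tgt : ∀ x y, u x = v y → x ∈ R.tgt
  cover : ∀ x, x ∈ Set.range u ∨ x ∈ Set.range v
  lt : ∀ x ∉ R.tgt, ∀ y ∉ Z.src, P.prec (u x) (v y)

namespace Glued

variable {Z : Iposet α} {u : R.carrier → P.carrier} {v : Z.carrier → P.carrier}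

theorem exists_right (h : Glued R Z P u v) {x} (hx : x ∈ R.tgt) : ∃ y ∈ Z.src, v y = u x :=
  h.mid.subset (Set.mem_image_of_mem u hx)

theorem exists_left (h : Glued R Z P u v) {y} (hy : y ∈ Z.src) : ∃ x ∈ R.tgt, u x = v y :=
  h.mid.superset (Set.mem_image_of_mem v hy)

theorem mem_src (h : Glued R Z P u v) (x y) (hxy : u x = v y) : y ∈ Z.src := by
  obtain ⟨y', hy', e⟩ := h.exists_right (h.mem_tgt x y hxy)
  rwa [← h.right.injective (e.trans hxy)]

theorem rev (h : Glued R Z P u v) : Glued Z.rev R.rev P.rev v u where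
  left := h.right.rev
  right := h.left.rev
  src := h.tgt
  tgt := h.src
  mid := h.mid.symm
  mem_tgt x y hxy := h.mem_src y x hxy.symm
  cover x := (h.cover x).symm
  lt x hx y hy := h.lt y hy x hx

theorem not_prec (h : Glued R Z P u v) (x y) : ¬ P.prec (v y) (u x) := by
  intro k
  by_cases hx : x ∈ R.tgt
  · obtain ⟨y', hy', e⟩ := h.exists_right hx
    rw [← e, h.right.prec_iff] at k
    exact Z.src_min _ hy' _ k
  by_cases hy : y ∈ Z.src
  · obtain ⟨x', hx', e⟩ := h.exists_left hy
    rw [← e, h.left.prec_iff] at k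
    exact R.tgt_max _ hx' _ k
  · exact P.prec_irrefl _ (P.prec_trans _ _ _ (h.lt x hx y hy) k)

theorem cases (h : Glued R Z P u v) (x) : (∃ a ∉ R.tgt, u a = x) ∨ (∃ b ∉ Z.src, v b = x) ∨
    ∃ a ∈ R.tgt, ∃ b ∈ Z.src, u a = x ∧ v b = x := by
  rcases h.cover x with ⟨a, rfl⟩ | ⟨b, rfl⟩
  · by_cases ha : a ∈ R.tgt
    · obtain ⟨b, hb, e⟩ := h.exists_right ha
      exact Or.inr (Or.inr ⟨a, ha, b, hb, rfl, e⟩)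
    · exact Or.inl ⟨a, ha, rfl⟩
  · by_cases hb : b ∈ Z.src
    · obtain ⟨a, ha, e⟩ := h.exists_left hb
      exact Or.inr (Or.inr ⟨a, ha, b, hb, e, rfl⟩)
    · exact Or.inr (Or.inl ⟨b, hb, rfl⟩)

theorem induction₂ (h : Glued R Z P u v) {motive : P.carrier → P.carrier → Prop}
    (left : ∀ a a', motive (u a) (u a')) (right : ∀ b b', motive (v b) (v b'))
    (left_right : ∀ a ∉ R.tgt, ∀ b ∉ Z.src, motive (u a) (v b))
    (right_left : ∀ a ∉ R.tgt, ∀ b ∉ Z.src, motive (v b) (u a)) (x y) : motive x y := by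
  rcases h.cases x with ⟨a, ha, rfl⟩ | ⟨b, hb, rfl⟩ | ⟨a, -, b, -, rfl, e⟩ <;>
    rcases h.cases y with ⟨a', ha', rfl⟩ | ⟨b', hb', rfl⟩ | ⟨a', -, b', -, rfl, e'⟩
  · exact left a a'
  · exact left_right a ha b' hb'
  · exact left a a'
  · exact right_left a' ha' b hb
  · exact right b b'
  · rw [← e']; exact right b b'
  · exact left a a'
  · rw [← e]; exact right b b'
  · exact left a a'

theorem exists_desc (h : Glued R Z P u v) {Y : Type*} {φ : R.carrier → Y} {ψ : Z.carrier → Y}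
    (hφψ : ∀ x y, u x = v y → φ x = ψ y) :
    ∃ f : P.carrier → Y, (∀ x, f (u x) = φ x) ∧ ∀ y, f (v y) = ψ y := by
  have hval : ∀ x, ∃ q, (∀ a, u a = x → φ a = q) ∧ ∀ b, v b = x → ψ b = q := by
    intro x
    rcases h.cover x with ⟨a, rfl⟩ | ⟨b, rfl⟩
    · exact ⟨φ a, fun a' e => by rw [h.left.injective e], fun b e => (hφψ a b e.symm).symm⟩
    · exact ⟨ψ b, fun a e => hφψ a b e, fun b' e => by rw [h.right.injective e]⟩
  choose f hu hv using hval
  exact ⟨f, fun x => (hu _ x rfl).symm, fun y => (hv _ y rfl).symm⟩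

/- Refining maps are strictly monotone for the event order on the interfaces, which are totally
ordered, so that they are determined on an interface by its image. -/
theorem map_eq_map (h : Glued R Z P u v) {φ : R.carrier → Q.carrier} {ψ : Z.carrier → Q.carrier}
    (hφ : IsRefining R Q φ) (hψ : IsRefining Z Q ψ) (hmid : φ '' R.tgt = ψ '' Z.src) {x y}
    (hxy : u x = v y) : φ x = ψ y := by
  have := R.tgtLo.finite
  have := R.tgtLo.isStrictTotalOrder_ord
  choose m hm hvm using fun x : R.tgt => h.exists_right x.2
  have hm_eq : ∀ x : R.tgt, ∀ y, u x = v y → m x = y := fun x y e =>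
    h.right.injective ((hvm x).trans e)
  have hrange : Set.range (fun x : R.tgt => φ x) = Set.range fun x => ψ (m x) := by
    rw [← Function.comp_def φ, Set.range_comp, Subtype.range_coe, hmid,
      ← Function.comp_def ψ, Set.range_comp]
    congr 1
    refine Set.Subset.antisymm (fun y hy => ?_) (Set.range_subset_iff.2 hm)
    obtain ⟨x, hx, e⟩ := h.exists_left hy
    exact ⟨⟨x, hx⟩, hm_eq _ _ e⟩
  have hagree : (fun x : R.tgt => φ x) = fun x => ψ (m x) := by
    refine eq_of_map_rel_of_range_eq (r := R.tgtLo.ord) (s := Q.evord)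
      (fun x y k => hφ.evord _ _ k (R.tgt_max _ x.2 _) (R.tgt_max _ y.2 _)) (fun x y k => ?_) hrange
    have hxy := Z.src_min _ (hm y) (m x)
    have hyx := Z.src_min _ (hm x) (m y)
    refine hψ.evord _ _ (h.right.evord_of_evord_map ?_ hxy hyx) hxy hyx
    rw [hvm, hvm]
    exact h.left.evord _ _ k (R.tgt_max _ x.2 _) (R.tgt_max _ y.2 _)
  rw [congrFun hagree ⟨x, h.mem_tgt x y hxy⟩, hm_eq ⟨x, _⟩ y hxy]

theorem exists_isRefining (h : Glued R Z P u v) {φ : R.carrier → Q.carrier}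
    {ψ : Z.carrier → Q.carrier} (hφ : IsRefining R Q φ) (hψ : IsRefining Z Q ψ)
    (hmid : φ '' R.tgt = ψ '' Z.src) (hmeet : ∀ x y, φ x = ψ y → x ∈ R.tgt)
    (hback : ∀ x ∉ R.tgt, ∀ y ∉ Z.src, ¬ Q.prec (ψ y) (φ x)) :
    ∃ f, IsRefining P Q f ∧ (∀ x, f (u x) = φ x) ∧ ∀ y, f (v y) = ψ y := by
  obtain ⟨f, hu, hv⟩ := h.exists_desc fun x y => h.map_eq_map hφ hψ hmid
  have hcross : ∀ a ∉ R.tgt, ∀ b, f (u a) ≠ f (v b) := fun a ha b e =>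
    ha (hmeet a b (by rwa [hu, hv] at e))
  refine ⟨f, ⟨h.induction₂ ?_ ?_ ?_ ?_, fun x => ?_, h.induction₂ ?_ ?_ ?_ ?_,
    h.induction₂ ?_ ?_ ?_ ?_⟩, hu, hv⟩
  · intro a a' e; rw [hu, hu] at e; rw [hφ.injective e]
  · intro b b' e; rw [hv, hv] at e; rw [hψ.injective e]
  · exact fun a ha b _ e => absurd e (hcross a ha b)
  · exact fun a ha b _ e => absurd e.symm (hcross a ha b)
  · rcases h.cover x with ⟨a, rfl⟩ | ⟨b, rfl⟩
    · rw [hu, hφ.label, h.left.label]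
    · rw [hv, hψ.label, h.right.label]
  · intro a a' k; rw [hu, hu] at k; exact h.left.map_prec _ _ (hφ.prec _ _ k)
  · intro b b' k; rw [hv, hv] at k; exact h.right.map_prec _ _ (hψ.prec _ _ k)
  · exact fun a ha b hb _ => h.lt a ha b hb
  · intro a ha b hb k; rw [hu, hv] at k; exact absurd k (hback a ha b hb)
  · intro a a' k haa' ha'a
    rw [h.left.prec_iff] at haa' ha'a
    rw [hu, hu]
    exact hφ.evord _ _ (h.left.evord_of_evord_map k haa' ha'a) haa' ha'a
  · intro b b' k hbb' hb'b
    rw [h.right.prec_iff] at hbb' hb'b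
    rw [hv, hv]
    exact hψ.evord _ _ (h.right.evord_of_evord_map k hbb' hb'b) hbb' hb'b
  · exact fun a ha b hb _ hab _ => absurd (h.lt a ha b hb) hab
  · exact fun a ha b hb _ _ hab => absurd (h.lt a ha b hb) hab

theorem exists_isEmbedding (h : Glued R Z P u v) {φ : R.carrier → Q.carrier}
    {ψ : Z.carrier → Q.carrier} (hφ : IsEmbedding R Q φ) (hψ : IsEmbedding Z Q ψ)
    (hmid : φ '' R.tgt = ψ '' Z.src) (hmeet : ∀ x y, φ x = ψ y → x ∈ R.tgt)
    (hlt : ∀ x ∉ R.tgt, ∀ y ∉ Z.src, Q.prec (φ x) (ψ y)) :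
    ∃ f, IsEmbedding P Q f ∧ (∀ x, f (u x) = φ x) ∧ ∀ y, f (v y) = ψ y := by
  obtain ⟨f, hf, hu, hv⟩ := h.exists_isRefining hφ.toIsRefining hψ.toIsRefining hmid hmeet
    (fun x hx y hy k => Q.prec_irrefl _ (Q.prec_trans _ _ _ (hlt x hx y hy) k))
  refine ⟨f, ⟨hf, h.induction₂ ?_ ?_ ?_ ?_⟩, hu, hv⟩
  · intro a a' k; rw [hu, hu]; exact hφ.map_prec _ _ (h.left.prec _ _ k)
  · intro b b' k; rw [hv, hv]; exact hψ.map_prec _ _ (h.right.prec _ _ k)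
  · intro a ha b hb _; rw [hu, hv]; exact hlt a ha b hb
  · exact fun a _ b _ k => absurd k (h.not_prec a b)

theorem subsumed_of_maps (h : Glued R Z P u v) {φ : R.carrier → Q.carrier}
    {ψ : Z.carrier → Q.carrier} (hφ : IsRefining R Q φ) (hψ : IsRefining Z Q ψ)
    (hmid : φ '' R.tgt = ψ '' Z.src) (hmeet : ∀ x y, φ x = ψ y → x ∈ R.tgt)
    (hback : ∀ x ∉ R.tgt, ∀ y ∉ Z.src, ¬ Q.prec (ψ y) (φ x))
    (hcover : ∀ x, x ∈ Set.range φ ∨ x ∈ Set.range ψ) (hsrc : φ '' R.src = Q.src)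
    (htgt : ψ '' Z.tgt = Q.tgt) : Subsumed P Q := by
  obtain ⟨f, hf, hu, hv⟩ := h.exists_isRefining hφ hψ hmid hmeet hback
  refine ⟨f, hf.isSubsumption (fun x => ?_) ?_ ?_⟩
  · rcases hcover x with ⟨y, rfl⟩ | ⟨y, rfl⟩
    exacts [⟨_, hu y⟩, ⟨_, hv y⟩]
  · simp only [← h.src, ← hsrc, Set.image_image, hu]
  · simp only [← h.tgt, ← htgt, Set.image_image, hv]

end Glued

variable {Z : Iposet α}

theorem glued_glue (f : LoIso P.tgtLo Q.srcLo) :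
    Glued P Q (glue P Q f) Sum.inl (glueInr f) where
  left := by
    refine ⟨⟨Sum.inl_injective, fun _ => rfl, ?_, ?_⟩, ?_⟩
    · rintro x y (⟨_, _, ⟨⟩, ⟨⟩, h⟩ | ⟨q, q', -, e', h⟩ | ⟨p, q, -, e', -, h⟩)
      · exact h
      · obtain ⟨_, rfl⟩ := (inl_eq_glueInr_iff f).1 e'
        exact absurd h (Q.src_min _ (Subtype.property _) _)
      · obtain ⟨_, rfl⟩ := (inl_eq_glueInr_iff f).1 e'
        exact absurd (Subtype.property _) h
    · exact fun x y h _ _ => .single (Or.inl ⟨x, y, rfl, rfl, h⟩)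
    · exact fun x y h => Or.inl ⟨x, y, rfl, rfl, h⟩
  right := by
    refine ⟨⟨glueInr_injective f, glue_label_glueInr f, ?_, ?_⟩, ?_⟩
    · rintro x y (⟨p, p', e, -, h⟩ | ⟨q, q', e, e', h⟩ | ⟨p, q, e, -, h, -⟩)
      · exact absurd h (P.tgt_max _ ((inl_eq_glueInr_iff f).1 e.symm).1 _)
      · rwa [glueInr_injective f e, glueInr_injective f e']
      · exact absurd ((inl_eq_glueInr_iff f).1 e.symm).1 h
    · exact fun x y h _ _ => .single (Or.inr ⟨x, y, rfl, rfl, h⟩)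
    · exact fun x y h => Or.inr (Or.inl ⟨x, y, rfl, rfl, h⟩)
  src := rfl
  tgt := rfl
  mid := by
    refine Set.Subset.antisymm ?_ ?_
    · rintro _ ⟨p, hp, rfl⟩
      exact ⟨_, (f.toEquiv ⟨p, hp⟩).2, ((inl_eq_glueInr_iff f).2 ⟨hp, rfl⟩).symm⟩
    · rintro _ ⟨q, hq, rfl⟩
      refine ⟨_, (f.toEquiv.symm ⟨q, hq⟩).2, (inl_eq_glueInr_iff f).2 ⟨Subtype.property _, ?_⟩⟩
      simp
  mem_tgt _ _ h := ((inl_eq_glueInr_iff f).1 h).1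
  cover x := by
    rcases x with p | ⟨q, hq⟩
    · exact Or.inl ⟨p, rfl⟩
    · exact Or.inr ⟨q, glueInr_of_notMem f hq⟩
  lt x hx y hy := Or.inr (Or.inr ⟨x, y, rfl, rfl, hx, hy⟩)

theorem exists_glued {U : LoSet α} (f : LoIso U P.tgtLo) (g : LoIso U Q.srcLo) :
    ∃ (G : Iposet α) (u : P.carrier → G.carrier) (v : Q.carrier → G.carrier),
      Glued P Q G u v ∧ ∀ x, u (f.toEquiv x).1 = v (g.toEquiv x).1 :=
  ⟨_, _, _, glued_glue (f.symm.trans g), fun _ =>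
    (inl_eq_glueInr_iff _).2 ⟨Subtype.property _, by simp [LoIso.trans, LoIso.symm]⟩⟩

theorem IsEmbedding.exists_loIso {φ : R.carrier → Q.carrier} {ψ : Z.carrier → Q.carrier}
    (hφ : IsEmbedding R Q φ) (hψ : IsEmbedding Z Q ψ) (hmid : φ '' R.tgt = ψ '' Z.src) :
    ∃ f : LoIso R.tgtLo Z.srcLo, ∀ x, ψ (f.toEquiv x).1 = φ x.1 := by
  choose m hm hψm using fun x : R.tgt => hmid.subset (Set.mem_image_of_mem φ x.2)
  refine ⟨LoIso.ofBijective (U := R.tgtLo) (V := Z.srcLo) (fun x => ⟨m x, hm x⟩)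
    ⟨fun x y hxy => ?_, fun y => ?_⟩ (fun x y hxy => ?_) fun x => ?_, hψm⟩
  · have hm_eq : m x = m y := congrArg Subtype.val hxy
    exact Subtype.ext (hφ.injective (by rw [← hψm, ← hψm, hm_eq]))
  · obtain ⟨x, hx, e⟩ := hmid.superset (Set.mem_image_of_mem ψ y.2)
    exact ⟨⟨x, hx⟩, Subtype.ext (hψ.injective ((hψm ⟨x, hx⟩).trans e))⟩
  · refine hψ.evord_of_evord_map ?_ (Z.src_min _ (hm y) (m x)) (Z.src_min _ (hm x) (m y))
    rw [hψm, hψm]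
    exact hφ.evord _ _ hxy (R.tgt_max _ x.2 _) (R.tgt_max _ y.2 _)
  · change Z.label (m x) = R.label x
    rw [← hψ.label, hψm, hφ.label]

theorem exists_glued_isEmbedding {φ : R.carrier → Q.carrier} {ψ : Z.carrier → Q.carrier}
    (hφ : IsEmbedding R Q φ) (hψ : IsEmbedding Z Q ψ) (hmid : φ '' R.tgt = ψ '' Z.src)
    (hmeet : ∀ x y, φ x = ψ y → x ∈ R.tgt) (hlt : ∀ x ∉ R.tgt, ∀ y ∉ Z.src, Q.prec (φ x) (ψ y)) :
    ∃ (G : Iposet α) (u : R.carrier → G.carrier) (v : Z.carrier → G.carrier)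
      (f : G.carrier → Q.carrier), Glued R Z G u v ∧ IsEmbedding G Q f ∧
      (∀ x, f (u x) = φ x) ∧ ∀ y, f (v y) = ψ y := by
  obtain ⟨i, -⟩ := hφ.exists_loIso hψ hmid
  obtain ⟨f, hf⟩ := (glued_glue i).exists_isEmbedding hφ hψ hmid hmeet hlt
  exact ⟨_, _, _, f, glued_glue i, hf⟩

namespace Glued

variable {u : R.carrier → P.carrier} {v : Z.carrier → P.carrier}

theorem prec_of_notMem_range (h : Glued R Z P u v) {x y} (hx : x ∉ Set.range v)
    (hy : y ∉ Set.range u) : P.prec x y := by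
  obtain ⟨a, ha, rfl⟩ | ⟨b, -, rfl⟩ | ⟨a, -, b, -, -, rfl⟩ := h.cases x
  · obtain ⟨a', -, rfl⟩ | ⟨b, hb, rfl⟩ | ⟨a', -, b, -, rfl, -⟩ := h.cases y
    · exact absurd ⟨a', rfl⟩ hy
    · exact h.lt a ha b hb
    · exact absurd ⟨a', rfl⟩ hy
  all_goals exact absurd ⟨b, rfl⟩ hx

theorem subsumed (h : Glued R Z P u v) {R' Z' P' : Iposet α} {u' : R'.carrier → P'.carrier}
    {v' : Z'.carrier → P'.carrier} (h' : Glued R' Z' P' u' v') (hR : Subsumed R R')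
    (hZ : Subsumed Z Z') : Subsumed P P' := by
  obtain ⟨φ, hφ⟩ := hR
  obtain ⟨ψ, hψ⟩ := hZ
  have mem_tgt_of_map : ∀ x, φ x ∈ R'.tgt → x ∈ R.tgt := fun x hx => by
    rwa [← hφ.tgt, hφ.bijective.injective.mem_set_image] at hx
  refine h.subsumed_of_maps (h'.left.toIsRefining.comp hφ.isRefining)
    (h'.right.toIsRefining.comp hψ.isRefining)
    (by rw [Set.image_comp, Set.image_comp, hφ.tgt, hψ.src, h'.mid])
    (fun x y e => mem_tgt_of_map x (h'.mem_tgt _ _ e)) (fun x _ y _ => h'.not_prec _ _)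
    (fun x => ?_) (by rw [Set.image_comp, hφ.src, h'.src])
    (by rw [Set.image_comp, hψ.tgt, h'.tgt])
  rw [hφ.bijective.surjective.range_comp, hψ.bijective.surjective.range_comp]
  exact h'.cover x

theorem isomorphic (h : Glued R Z P u v) {P' : Iposet α} {u' : R.carrier → P'.carrier}
    {v' : Z.carrier → P'.carrier} (h' : Glued R Z P' u' v') : Isomorphic P P' := by
  obtain ⟨f, hf, hu, hv⟩ := h.exists_isEmbedding h'.left h'.right h'.mid h'.mem_tgt h'.lt
  refine hf.isomorphic (fun x => ?_) ?_ ?_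
  · rcases h'.cover x with ⟨a, rfl⟩ | ⟨b, rfl⟩
    exacts [⟨_, hu a⟩, ⟨_, hv b⟩]
  · simp only [← h.src, ← h'.src, Set.image_image, hu]
  · simp only [← h.tgt, ← h'.tgt, Set.image_image, hv]

theorem assoc {R₁ R₂ : Iposet α} {u₁ : R₁.carrier → R.carrier} {u₂ : R₂.carrier → R.carrier}
    (h₁₂ : Glued R₁ R₂ R u₁ u₂) (h : Glued R Z P u v) :
    ∃ (Y : Iposet α) (w₁ : R₂.carrier → Y.carrier) (w₂ : Z.carrier → Y.carrier)
      (w : Y.carrier → P.carrier), Glued R₂ Z Y w₁ w₂ ∧ Glued R₁ Y P (u ∘ u₁) w ∧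
      (∀ x, w (w₁ x) = u (u₂ x)) ∧ ∀ y, w (w₂ y) = v y := by
  have hR₂ : ∀ r, u₂ r ∈ R.tgt ↔ r ∈ R₂.tgt := fun r => by
    rw [← h₁₂.tgt, h₁₂.right.injective.mem_set_image]
  have hR₁ : ∀ x, u₁ x ∈ R.tgt → x ∈ R₁.tgt := fun x hx => by
    obtain ⟨r, -, e⟩ := h₁₂.tgt.superset hx
    exact h₁₂.mem_tgt x r e.symm
  obtain ⟨Y, w₁, w₂, w, hY, hw, hw₁, hw₂⟩ :=
    exists_glued_isEmbedding (φ := u ∘ u₂) (h.left.comp h₁₂.right) h.right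
      (by rw [Set.image_comp, h₁₂.tgt, h.mid]) (fun x y e => (hR₂ x).1 (h.mem_tgt _ _ e))
      fun x hx y hy => h.lt _ (fun k => hx ((hR₂ x).1 k)) y hy
  refine ⟨Y, w₁, w₂, w, hY, ⟨h.left.comp h₁₂.left, hw, ?_, ?_, ?_, fun x y e => ?_, fun x => ?_,
    fun x hx y hy => ?_⟩, hw₁, hw₂⟩
  · rw [Set.image_comp, h₁₂.src, h.src]
  · simp only [← h.tgt, ← hY.tgt, Set.image_image, hw₂]
  · simp only [← hY.src, Set.image_comp, h₁₂.mid, Set.image_image, hw₁]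
  · rcases hY.cover y with ⟨r, rfl⟩ | ⟨z, rfl⟩
    · exact h₁₂.mem_tgt x r (h.left.injective (e.trans (hw₁ r)))
    · exact hR₁ x (h.mem_tgt _ _ (e.trans (hw₂ z)))
  · rcases h.cover x with ⟨r, rfl⟩ | ⟨z, rfl⟩
    · rcases h₁₂.cover r with ⟨r, rfl⟩ | ⟨r, rfl⟩
      exacts [Or.inl ⟨r, rfl⟩, Or.inr ⟨_, hw₁ r⟩]
    · exact Or.inr ⟨_, hw₂ z⟩
  · have lt_left : ∀ r, w₁ r ∉ Y.src → P.prec (u (u₁ x)) (w (w₁ r)) := fun r hr => by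
      rw [hw₁]
      exact h.left.map_prec _ _
        (h₁₂.lt x hx r fun k => hr (hY.src.subset (Set.mem_image_of_mem w₁ k)))
    rcases hY.cases y with ⟨r, -, rfl⟩ | ⟨z, hz, rfl⟩ | ⟨r, -, z, -, rfl, -⟩
    · exact lt_left r hy
    · rw [hw₂]
      exact h.lt _ (fun k => hx (hR₁ x k)) z hz
    · exact lt_left r hy

theorem assoc_symm {Z₁ Z₂ : Iposet α} {v₁ : Z₁.carrier → Z.carrier} {v₂ : Z₂.carrier → Z.carrier}
    (h₁₂ : Glued Z₁ Z₂ Z v₁ v₂) (h : Glued R Z P u v) :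
    ∃ (Y : Iposet α) (w₁ : R.carrier → Y.carrier) (w₂ : Z₁.carrier → Y.carrier)
      (w : Y.carrier → P.carrier), Glued R Z₁ Y w₁ w₂ ∧ Glued Y Z₂ P w (v ∘ v₂) ∧
      (∀ x, w (w₁ x) = u x) ∧ ∀ y, w (w₂ y) = v (v₁ y) := by
  obtain ⟨Y, w₁, w₂, w, hY, hP, hw₁, hw₂⟩ := h₁₂.rev.assoc h.rev
  exact ⟨Y.rev, w₂, w₁, w, hY.rev, hP.rev, hw₂, hw₁⟩

end Glued

/-! ### Interval orders -/

theorem IsInterval.prec_or_prec (hP : P.IsInterval) {w x y z} (hwx : P.prec w x)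
    (hyz : P.prec y z) : P.prec w z ∨ P.prec y x := by
  obtain ⟨b, e, -, hprec⟩ := hP
  rw [hprec] at hwx hyz ⊢
  rw [hprec]
  by_contra! hle
  linarith [hle.1, hle.2]

/-- The strict down-set of an event. In an interval order these sets form a chain, so that their
cardinalities are left endpoints of an interval representation. -/
def preds (P : Iposet α) (y : P.carrier) : Set P.carrier := {x | P.prec x y}

theorem ncard_preds_lt {x y} (hxy : P.prec x y) : (P.preds x).ncard < (P.preds y).ncard := by
  have := P.finite
  exact Set.ncard_lt_ncard ⟨fun _ hw => P.prec_trans _ _ _ hw hxy, fun k => P.prec_irrefl x (k hxy)⟩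

theorem preds_subset_preds (hP : ∀ w x y z, P.prec w x → P.prec y z → P.prec w z ∨ P.prec y x)
    {y z} (hyz : (P.preds y).ncard ≤ (P.preds z).ncard) : P.preds y ⊆ P.preds z := by
  have := P.finite
  by_contra hsub
  obtain ⟨w, hwy, hwz⟩ := Set.not_subset.1 hsub
  have hzy : P.preds z ⊆ P.preds y := fun x hx => (hP x z w y hx hwy).resolve_right hwz
  exact hsub (Set.eq_of_subset_of_ncard_le hzy hyz).superset

theorem exists_prec_iff_lt_ncard_preds
    (hP : ∀ w x y z, P.prec w x → P.prec y z → P.prec w z ∨ P.prec y x) (x) :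
    ∃ e : ℕ, (P.preds x).ncard ≤ e ∧ ∀ y, P.prec x y ↔ e < (P.preds y).ncard := by
  have := P.finite
  by_cases hx : ∃ y, P.prec x y
  · obtain ⟨y, hxy, hy⟩ := Set.exists_min_image {y | P.prec x y} (fun y => (P.preds y).ncard)
      (Set.toFinite _) hx
    have hlt := ncard_preds_lt hxy
    refine ⟨(P.preds y).ncard - 1, by omega, fun z => ⟨fun hz => ?_, fun hz => ?_⟩⟩
    · have := hy z hz
      omega
    · exact preds_subset_preds hP (show (P.preds y).ncard ≤ _ by omega) hxy
  · push Not at hx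
    exact ⟨Nat.card P.carrier, Set.ncard_le_card _, fun z =>
      ⟨fun hz => absurd hz (hx z), fun k => absurd k (not_lt.2 (Set.ncard_le_card _))⟩⟩

theorem isInterval_iff : P.IsInterval ↔
    ∀ w x y z, P.prec w x → P.prec y z → P.prec w z ∨ P.prec y x := by
  refine ⟨fun hP _ _ _ _ => hP.prec_or_prec, fun hP => ?_⟩
  choose e hle hlt using exists_prec_iff_lt_ncard_preds hP
  exact ⟨fun x => (P.preds x).ncard, fun x => e x, fun x => Nat.cast_le.2 (hle x),
    fun x y => by rw [hlt, Nat.cast_lt]⟩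

theorem IsEmbedding.isInterval {f : P.carrier → Q.carrier} (h : IsEmbedding P Q f)
    (hQ : Q.IsInterval) : P.IsInterval := by
  obtain ⟨b, e, hbe, hprec⟩ := hQ
  exact ⟨b ∘ f, e ∘ f, fun _ => hbe _, fun x y => by rw [← h.prec_iff, hprec]; rfl⟩

theorem isInterval_discrete (w : List α) (S T : Set (Fin w.length)) :
    (discrete w S T).IsInterval :=
  isInterval_iff.2 fun _ _ _ _ h _ => h.elim

theorem Glued.isInterval {u : R.carrier → P.carrier} {v : Z.carrier → P.carrier}
    (h : Glued R Z P u v) (hR : R.IsInterval) (hZ : Z.IsInterval) : P.IsInterval := by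
  have mem_range : ∀ {w x}, P.prec w (u x) → w ∈ Set.range u := fun {w x} hwx => by
    obtain ⟨b, rfl⟩ | hw := em (w ∈ Set.range v)
    · exact absurd hwx (h.not_prec _ _)
    · exact (h.cover w).resolve_right hw
  have notMem_range : ∀ {w x}, P.prec w (u x) → w ∉ Set.range v := by
    rintro _ x hwx ⟨b, rfl⟩
    exact h.not_prec _ _ hwx
  rw [isInterval_iff]
  intro w x y z hwx hyz
  by_cases hx : x ∈ Set.range u <;> by_cases hz : z ∈ Set.range u
  · obtain ⟨⟨x, rfl⟩, ⟨z, rfl⟩⟩ := And.intro hx hz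
    obtain ⟨⟨w, rfl⟩, ⟨y, rfl⟩⟩ := And.intro (mem_range hwx) (mem_range hyz)
    simp only [h.left.prec_iff] at hwx hyz ⊢
    exact hR.prec_or_prec hwx hyz
  · obtain ⟨x, rfl⟩ := hx
    exact Or.inl (h.prec_of_notMem_range (notMem_range hwx) hz)
  · obtain ⟨z, rfl⟩ := hz
    exact Or.inr (h.prec_of_notMem_range (notMem_range hyz) hx)
  · by_cases hw : w ∈ Set.range v
    · by_cases hy : y ∈ Set.range v
      · obtain ⟨⟨w, rfl⟩, ⟨y, rfl⟩⟩ := And.intro hw hy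
        obtain ⟨x, rfl⟩ := (h.cover x).resolve_left hx
        obtain ⟨z, rfl⟩ := (h.cover z).resolve_left hz
        simp only [h.right.prec_iff] at hwx hyz ⊢
        exact hZ.prec_or_prec hwx hyz
      · exact Or.inr (h.prec_of_notMem_range hy hx)
    · exact Or.inl (h.prec_of_notMem_range hw hz)

/-! ### Cuts -/

/-- A cut of `P`: the set `C` of events that have been started, and the set `T ⊆ C` of events
that are active. Cuts correspond to the decompositions of `P` as a gluing. -/
structure IsCut (P : Iposet α) (C T : Set P.carrier) : Prop where
  subset : T ⊆ C
  src : P.src ⊆ C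
  tgt : ∀ x ∈ P.tgt, x ∈ C → x ∈ T
  max : ∀ x ∈ T, ∀ y ∈ C, ¬ P.prec x y
  min : ∀ x ∈ T, ∀ y ∉ C, ¬ P.prec y x
  lt : ∀ x ∈ C, x ∉ T → ∀ y ∉ C, P.prec x y

/-- `j` identifies `Z` with the part of `P` that has not been terminated at the cut `(C, T)`. -/
structure IsSuffix (P : Iposet α) (C T : Set P.carrier) (Z : Iposet α) (j : Z.carrier → P.carrier) :
    Prop where
  isEmbedding : IsEmbedding Z P j
  range : Set.range j = T ∪ Cᶜ
  src : j '' Z.src = T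
  tgt : j '' Z.tgt = P.tgt

namespace IsCut

variable {C T : Set P.carrier}

theorem glued_of_isSuffix (h : IsCut P C T) {j : Z.carrier → P.carrier} (hj : IsSuffix P C T Z j) :
    Glued (P.sub C P.src T) Z P subVal j where
  left := isEmbedding_subVal _ _ _ _
  right := hj.isEmbedding
  src := subVal_image_src h.src fun x hx y _ => P.src_min x hx y
  tgt := hj.tgt
  mid := (subVal_image_tgt h.subset h.max).trans hj.src.symm
  mem_tgt x y hxy := by
    have hy : j y ∈ T ∪ Cᶜ := hj.range ▸ Set.mem_range_self y
    have hxT : subVal x ∈ T := hxy ▸ hy.resolve_right fun hyC => hyC (hxy ▸ subVal_mem x)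
    exact ⟨hxT, h.max _ hxT⟩
  cover x := by
    rw [range_subVal, hj.range]
    exact (em (x ∈ C)).imp_right Or.inr
  lt x hx y hy := by
    have hxT : subVal x ∉ T := fun hxT => hx ⟨hxT, h.max _ hxT⟩
    have hyT : j y ∉ T := by rwa [← hj.src, hj.isEmbedding.injective.mem_set_image]
    have hyC : j y ∈ T ∪ Cᶜ := hj.range ▸ Set.mem_range_self y
    exact h.lt _ (subVal_mem x) hxT _ (hyC.resolve_left hyT)

theorem isSuffix_sub (h : IsCut P C T) : IsSuffix P C T (P.sub (T ∪ Cᶜ) T P.tgt) subVal where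
  isEmbedding := isEmbedding_subVal _ _ _ _
  range := range_subVal
  src := subVal_image_src Set.subset_union_left fun x hx y hy =>
    hy.elim (fun hyT => h.max y hyT x (h.subset hx)) (h.min x hx y)
  tgt := subVal_image_tgt (fun x hx => (em (x ∈ C)).imp (h.tgt x hx) id) fun x hx y _ =>
    P.tgt_max x hx y

theorem glued (h : IsCut P C T) :
    Glued (P.sub C P.src T) (P.sub (T ∪ Cᶜ) T P.tgt) P subVal subVal :=
  h.glued_of_isSuffix h.isSuffix_sub

end IsCut

/- The started events are those whose predecessors all precede a common element of `X`; this is the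
earliest moment at which all of `X` has been started. -/
theorem exists_isCut (hP : P.IsInterval) (X : Set P.carrier) (hX : P.src ⊆ X ∨ X.Nonempty) :
    ∃ C T, IsCut P C T ∧ X ⊆ C ∧ ∀ x ∈ C, x ∉ T → ∃ y ∈ X, P.prec x y := by
  let C := {x | ∃ y ∈ X, ∀ w, P.prec w x → P.prec w y}
  refine ⟨C, {x ∈ C | ¬ ∃ y ∈ X, P.prec x y}, ⟨Set.sep_subset _ _, fun x hx => ?_, ?_, ?_, ?_, ?_⟩,
    fun x hx => ⟨x, hx, fun _ h => h⟩, fun x hx hxT => by_contra fun k => hxT ⟨hx, k⟩⟩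
  · rcases hX with h | ⟨y, hy⟩
    · exact ⟨x, h hx, fun _ h => h⟩
    · exact ⟨y, hy, fun w hw => absurd hw (P.src_min x hx w)⟩
  · exact fun x hx hxC => ⟨hxC, fun ⟨y, _, hxy⟩ => P.tgt_max x hx y hxy⟩
  · rintro x ⟨-, hx⟩ y ⟨z, hz, hyz⟩ hxy
    exact hx ⟨z, hz, hyz x hxy⟩
  · rintro x ⟨⟨z, hz, hxz⟩, -⟩ y hy hyx
    exact hy ⟨z, hz, fun w hw => P.prec_trans _ _ _ hw (hxz y hyx)⟩
  · rintro x hx hxT y hy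
    obtain ⟨z, hz, hxz⟩ : ∃ z ∈ X, P.prec x z := by_contra fun k => hxT ⟨hx, k⟩
    by_contra hxy
    exact hy ⟨z, hz, fun w hw => (hP.prec_or_prec hxz hw).resolve_left hxy⟩

end Iposet

/-! ### Words -/

theorem LoSet.exists_word {α : Type u} (U : LoSet α) :
    ∃ w : Precube α, Nonempty (LoIso w.lo U) := by
  classical
  have := U.finite
  have := Fintype.ofFinite U.carrier
  have := U.isStrictTotalOrder_ord
  let : LinearOrder U.carrier := linearOrderOfSTO U.ord
  let e := Fintype.orderIsoFinOfCardEq U.carrier rfl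
  let word := List.ofFn fun i => U.label (e i)
  let o : Fin word.length ≃o U.carrier := (Fin.castOrderIso List.length_ofFn).trans e
  refine ⟨⟨word⟩, ⟨LoIso.ofBijective (U := Precube.lo _) o o.bijective
    (fun x y hxy => o.strictMono hxy) fun x => ?_⟩⟩
  exact (List.get_ofFn _ x).symm

namespace Precube

variable {α : Type u}

/-- The words of length at most `n` over `A`, as objects of the precube category. They are finitely
many if `A` is finite, which will bound the number of cells of an automaton. -/
def words (A : Set α) (n : ℕ) : Set (Precube α) :=
  {U | U.word.length ≤ n ∧ ∀ i, U.word.get i ∈ A}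

theorem finite_words {A : Set α} (hA : A.Finite) (n : ℕ) : (words A n).Finite := by
  have := hA.to_subtype
  refine ((List.finite_length_le A n).image fun l => ⟨l.map Subtype.val⟩).subset ?_
  rintro ⟨w⟩ ⟨hn, hget⟩
  have hw : ∀ a ∈ w, a ∈ A := fun a ha => by
    obtain ⟨i, rfl⟩ := List.get_of_mem ha
    exact hget i
  exact ⟨w.attach.map fun a => ⟨a.1, hw a.1 a.2⟩, by simpa using hn,
    by simp [List.map_map, Function.comp_def]⟩

end Precube

namespace Iposet

variable {α : Type u} {P Q R Z : Iposet α}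

/-! ### Operations on sets of iposets -/

/-- The gluing compositions of elements of `A` and `B`. -/
def prod (A B : Set (Iposet α)) : Set (Iposet α) :=
  {P | ∃ a ∈ A, ∃ b ∈ B, ∃ u v, Glued a b P u v}

/-- The interval iposets that are subsumed by an element of `A`. -/
def down (A : Set (Iposet α)) : Set (Iposet α) :=
  {P | P.IsInterval ∧ ∃ Q ∈ A, Subsumed P Q}

theorem prod_mono {A B A' B' : Set (Iposet α)} (hA : A ⊆ A') (hB : B ⊆ B') :
    prod A B ⊆ prod A' B' := by
  rintro P ⟨a, ha, b, hb, h⟩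
  exact ⟨a, hA ha, b, hB hb, h⟩

theorem prod_assoc (A B C : Set (Iposet α)) : prod (prod A B) C = prod A (prod B C) := by
  ext P
  constructor
  · rintro ⟨_, ⟨a, ha, b, hb, _, _, hab⟩, c, hc, _, _, h⟩
    obtain ⟨Y, _, _, _, hY, hP, -⟩ := hab.assoc h
    exact ⟨a, ha, Y, ⟨b, hb, c, hc, _, _, hY⟩, _, _, hP⟩
  · rintro ⟨a, ha, _, ⟨b, hb, c, hc, _, _, hbc⟩, _, _, h⟩
    obtain ⟨Y, _, _, _, hY, hP, -⟩ := hbc.assoc_symm h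
    exact ⟨Y, ⟨a, ha, b, hb, _, _, hY⟩, c, hc, _, _, hP⟩

theorem prod_union (A B C : Set (Iposet α)) : prod A (B ∪ C) = prod A B ∪ prod A C := by
  refine Set.Subset.antisymm ?_ (Set.union_subset (prod_mono subset_rfl Set.subset_union_left)
    (prod_mono subset_rfl Set.subset_union_right))
  rintro P ⟨a, ha, b, hb | hb, h⟩
  exacts [Or.inl ⟨a, ha, b, hb, h⟩, Or.inr ⟨a, ha, b, hb, h⟩]

theorem union_prod (A B C : Set (Iposet α)) : prod (A ∪ B) C = prod A C ∪ prod B C := by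
  refine Set.Subset.antisymm ?_ (Set.union_subset (prod_mono Set.subset_union_left subset_rfl)
    (prod_mono Set.subset_union_right subset_rfl))
  rintro P ⟨a, ha | ha, h⟩
  exacts [Or.inl ⟨a, ha, h⟩, Or.inr ⟨a, ha, h⟩]

/-! ### Iposets of bounded width -/

/-- The elements of `L` have labels in `A` and width at most `n`. -/
structure IsBounded (L : Set (Iposet α)) (A : Set α) (n : ℕ) : Prop where
  label : ∀ P ∈ L, ∀ x, P.label x ∈ A
  width : ∀ P ∈ L, ∀ X : Set P.carrier, (∀ x ∈ X, ∀ y ∈ X, ¬ P.prec x y) → X.ncard ≤ n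

theorem Glued.subset_range_or_subset_range {u : R.carrier → P.carrier} {v : Z.carrier → P.carrier}
    (h : Glued R Z P u v) {X Y : Set P.carrier} (hXY : ∀ y ∈ Y, ∀ x ∈ X, ¬ P.prec y x) :
    X ⊆ Set.range u ∨ Y ⊆ Set.range v := by
  by_contra! hXY'
  obtain ⟨x, hx, hxu⟩ := Set.not_subset.1 hXY'.1
  obtain ⟨y, hy, hyv⟩ := Set.not_subset.1 hXY'.2
  exact hXY y hy x hx (h.prec_of_notMem_range hyv hxu)

namespace IsBounded

variable {L M : Set (Iposet α)} {A : Set α} {n : ℕ}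

theorem mem_words (h : IsBounded L A n) (hP : P ∈ L) {U : Precube α}
    {e : Fin U.word.length → P.carrier} (he : Function.Injective e)
    (hlab : ∀ i, P.label (e i) = U.word.get i) (hanti : ∀ i j, ¬ P.prec (e i) (e j)) :
    U ∈ Precube.words A n := by
  refine ⟨?_, fun i => hlab i ▸ h.label P hP _⟩
  have := h.width P hP (Set.range e) (by rintro _ ⟨i, rfl⟩ _ ⟨j, rfl⟩; exact hanti i j)
  rwa [← Set.image_univ, Set.ncard_image_of_injective _ he, Set.ncard_univ, Nat.card_fin] at this

theorem mem_words_tgt (h : IsBounded L A n) (hP : P ∈ L) {u : R.carrier → P.carrier}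
    (hu : IsEmbedding R P u) {U : Precube α} (e : LoIso U.lo R.tgtLo) :
    U ∈ Precube.words A n := by
  refine h.mem_words (e := fun i => u (e.toEquiv i).1) hP ?_ (fun i => ?_) fun i j k => ?_
  · exact fun i j k => e.toEquiv.injective (Subtype.ext (hu.injective k))
  · rw [hu.label]; exact e.map_label i
  · exact R.tgt_max _ (e.toEquiv i).2 _ (hu.prec _ _ k)

theorem ncard_le (h : IsBounded L A n) (hR : R ∈ L) {u : R.carrier → P.carrier}
    (hu : IsEmbedding R P u) {X : Set P.carrier} (hXu : X ⊆ Set.range u)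
    (hX : ∀ x ∈ X, ∀ y ∈ X, ¬ P.prec x y) : X.ncard ≤ n := by
  rw [← Set.image_preimage_eq_of_subset hXu, Set.ncard_image_of_injective _ hu.injective]
  exact h.width R hR _ fun x hx y hy k => hX _ hx _ hy (hu.map_prec _ _ k)

theorem mono (h : IsBounded L A n) {L' : Set (Iposet α)} {A' : Set α} {n' : ℕ} (hL : L' ⊆ L)
    (hA : A ⊆ A') (hn : n ≤ n') : IsBounded L' A' n' :=
  ⟨fun P hP x => hA (h.label P (hL hP) x), fun P hP X hX => (h.width P (hL hP) X hX).trans hn⟩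

theorem down (h : IsBounded L A n) : IsBounded (down L) A n where
  label := by
    rintro P ⟨-, Q, hQ, f, hf⟩ x
    rw [← hf.label]; exact h.label Q hQ _
  width := by
    rintro P ⟨-, Q, hQ, f, hf⟩ X hX
    rw [← Set.ncard_image_of_injective X hf.bijective.injective]
    refine h.width Q hQ _ ?_
    rintro _ ⟨x, hx, rfl⟩ _ ⟨y, hy, rfl⟩ k
    exact hX x hx y hy (hf.prec _ _ k)

theorem union (hL : IsBounded L A n) (hM : IsBounded M A n) : IsBounded (L ∪ M) A n :=
  ⟨fun P hP => hP.elim (hL.label P) (hM.label P), fun P hP => hP.elim (hL.width P) (hM.width P)⟩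

theorem iUnion {L : ℕ → Set (Iposet α)} (h : ∀ k, IsBounded (L k) A n) :
    IsBounded (⋃ k, L k) A n where
  label P hP := by
    obtain ⟨k, hk⟩ := Set.mem_iUnion.1 hP
    exact (h k).label P hk
  width P hP := by
    obtain ⟨k, hk⟩ := Set.mem_iUnion.1 hP
    exact (h k).width P hk

theorem prod (hL : IsBounded L A n) (hM : IsBounded M A n) : IsBounded (prod L M) A n where
  label := by
    rintro P ⟨a, ha, b, hb, u, v, h⟩ x
    rcases h.cover x with ⟨x, rfl⟩ | ⟨x, rfl⟩
    · rw [h.left.label]; exact hL.label a ha x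
    · rw [h.right.label]; exact hM.label b hb x
  width := by
    rintro P ⟨a, ha, b, hb, u, v, h⟩ X hX
    rcases h.subset_range_or_subset_range hX with hXu | hXv
    · exact hL.ncard_le ha h.left hXu hX
    · exact hM.ncard_le hb h.right hXv hX

end IsBounded

/-! ### Recognizable sets of iposets -/

/-- A family of pairs of sets of prefixes and suffixes that describes all gluing decompositions of
the elements of `L`. -/
structure IsSplitFamily (L : Set (Iposet α)) (F : Set (Set (Iposet α) × Set (Iposet α))) :
    Prop where
  sound : ∀ f ∈ F, prod f.1 f.2 ⊆ L
  complete : ∀ P ∈ L, ∀ (r z : Iposet α) u v, Glued r z P u v → ∃ f ∈ F, r ∈ f.1 ∧ z ∈ f.2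

/-- `L` has finitely many types of gluing decompositions, finitely many labels and bounded width.
The first condition is the analogue of finite index in the Myhill–Nerode theorem; the other two
bound the cells of an automaton for `L`. -/
structure IsRecognizable (L : Set (Iposet α)) : Prop where
  split : ∃ F, F.Finite ∧ IsSplitFamily L F
  bounded : ∃ A n, A.Finite ∧ IsBounded L A n

/-- Every element of `A` can be cut, according to a pair in `F`, such that a prescribed set `X` of
events has been started and a prescribed set `Y` of events has not been terminated. Unlike the
existence of a split family, this passes from `A` to the down-closure of `A`. -/
def Splits (A : Set (Iposet α)) (F : Set (Set (Iposet α) × Set (Iposet α))) : Prop :=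
  ∀ P ∈ A, ∀ X Y : Set P.carrier, P.src ⊆ X → P.tgt ⊆ Y → (∀ y ∈ Y, ∀ x ∈ X, ¬ P.prec y x) →
    ∃ f ∈ F, ∃ p ∈ f.1, ∃ s ∈ f.2, ∃ u v, Glued p s P u v ∧ X ⊆ Set.range u ∧ Y ⊆ Set.range v

theorem IsInterval.exists_isCut_between (hP : P.IsInterval) {X Y : Set P.carrier}
    (hX : P.src ⊆ X) (hXY : ∀ y ∈ Y, ∀ x ∈ X, ¬ P.prec y x) :
    ∃ C T, IsCut P C T ∧ X ⊆ C ∧ Y ⊆ T ∪ Cᶜ := by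
  obtain ⟨C, T, hCT, hXC, hlt⟩ := exists_isCut hP X (Or.inl hX)
  refine ⟨C, T, hCT, hXC, fun y hy => ?_⟩
  by_contra hyT
  obtain ⟨hyT, hyC⟩ := not_or.1 hyT
  obtain ⟨x, hx, hyx⟩ := hlt y (not_not.1 hyC) hyT
  exact hXY y hy x hx hyx

theorem IsSplitFamily.splits {L : Set (Iposet α)} {F : Set (Set (Iposet α) × Set (Iposet α))}
    (h : IsSplitFamily L F) (hL : ∀ P ∈ L, P.IsInterval) : Splits L F := by
  intro P hP X Y hX _ hXY
  obtain ⟨C, T, hCT, hXC, hYT⟩ := (hL P hP).exists_isCut_between hX hXY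
  obtain ⟨f, hf, hp, hs⟩ := h.complete P hP _ _ _ _ hCT.glued
  exact ⟨f, hf, _, hp, _, hs, _, _, hCT.glued, by rwa [range_subVal], by rwa [range_subVal]⟩

namespace Glued

variable {p s : Iposet α} {u : R.carrier → P.carrier} {v : Z.carrier → P.carrier}
  {X Y : Set P.carrier}

theorem exists_split_left (h : Glued R Z P u v) {w₁ : p.carrier → R.carrier}
    {w₂ : s.carrier → R.carrier} (hps : Glued p s R w₁ w₂) (hXu : X ⊆ Set.range u)
    (hX : u ⁻¹' X ⊆ Set.range w₁) (hY : u ⁻¹' Y ⊆ Set.range w₂) :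
    ∃ s', (∃ u v, Glued s Z s' u v) ∧
      ∃ u v, Glued p s' P u v ∧ X ⊆ Set.range u ∧ Y ⊆ Set.range v := by
  obtain ⟨s', _, _, w, hs', hP, hw₁, hw₂⟩ := hps.assoc h
  refine ⟨s', ⟨_, _, hs'⟩, _, w, hP, fun x hx => ?_, fun y hy => ?_⟩
  · obtain ⟨x, rfl⟩ := hXu hx
    obtain ⟨z, rfl⟩ := hX hx
    exact ⟨z, rfl⟩
  · rcases h.cover y with ⟨y, rfl⟩ | ⟨y, rfl⟩
    · obtain ⟨z, rfl⟩ := hY hy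
      exact ⟨_, hw₁ z⟩
    · exact ⟨_, hw₂ y⟩

theorem exists_split_right (h : Glued R Z P u v) {w₁ : p.carrier → Z.carrier}
    {w₂ : s.carrier → Z.carrier} (hps : Glued p s Z w₁ w₂) (hYv : Y ⊆ Set.range v)
    (hX : v ⁻¹' X ⊆ Set.range w₁) (hY : v ⁻¹' Y ⊆ Set.range w₂) :
    ∃ p', (∃ u v, Glued R p p' u v) ∧
      ∃ u v, Glued p' s P u v ∧ X ⊆ Set.range u ∧ Y ⊆ Set.range v := by
  obtain ⟨p', ⟨_, _, hp'⟩, u', v', hP, hY', hX'⟩ := h.rev.exists_split_left hps.rev hYv hY hX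
  exact ⟨p'.rev, ⟨_, _, hp'.rev⟩, v', u', hP.rev, hX', hY'⟩

theorem comp_isomorphism (h : Glued R Z P u v) {f : P.carrier → Q.carrier}
    (hf : IsSubsumption P Q f) (hprec : ∀ x y, P.prec x y → Q.prec (f x) (f y)) :
    Glued R Z Q (f ∘ u) (f ∘ v) where
  left := IsEmbedding.comp ⟨hf.isRefining, hprec⟩ h.left
  right := IsEmbedding.comp ⟨hf.isRefining, hprec⟩ h.right
  src := by rw [Set.image_comp, h.src, hf.src]
  tgt := by rw [Set.image_comp, h.tgt, hf.tgt]
  mid := by rw [Set.image_comp, h.mid, Set.image_comp]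
  mem_tgt x y hxy := h.mem_tgt x y (hf.bijective.injective hxy)
  cover y := by
    obtain ⟨x, rfl⟩ := hf.bijective.surjective y
    rcases h.cover x with ⟨a, rfl⟩ | ⟨b, rfl⟩
    exacts [Or.inl ⟨a, rfl⟩, Or.inr ⟨b, rfl⟩]
  lt x hx y hy := hprec _ _ (h.lt x hx y hy)

end Glued

namespace Splits

variable {A B : Set (Iposet α)} {F G : Set (Set (Iposet α) × Set (Iposet α))}

theorem mono (h : Splits A F) (hF : ∀ f ∈ F, ∃ g ∈ G, f.1 ⊆ g.1 ∧ f.2 ⊆ g.2) : Splits A G := by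
  intro P hP X Y hX hY hXY
  obtain ⟨f, hf, p, hp, s, hs, hps⟩ := h P hP X Y hX hY hXY
  obtain ⟨g, hg, hfg₁, hfg₂⟩ := hF f hf
  exact ⟨g, hg, p, hfg₁ hp, s, hfg₂ hs, hps⟩

theorem iUnion {A : ℕ → Set (Iposet α)} (h : ∀ k, Splits (A k) F) : Splits (⋃ k, A k) F := by
  intro P hP
  obtain ⟨k, hk⟩ := Set.mem_iUnion.1 hP
  exact h k P hk

theorem prod (hA : Splits A F) (hB : Splits B G) : Splits (prod A B)
    ((fun f => (f.1, Iposet.prod f.2 B)) '' F ∪ (fun g => (Iposet.prod A g.1, g.2)) '' G) := by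
  rintro P ⟨a, ha, b, hb, u, v, h⟩ X Y hX hY hXY
  rcases h.subset_range_or_subset_range hXY with hXu | hYv
  · obtain ⟨f, hf, p, hp, s, hs, w₁, w₂, hps, hXw, hYw⟩ := hA a ha (u ⁻¹' X) (u ⁻¹' Y ∪ a.tgt)
      (fun x hx => hX (h.src ▸ Set.mem_image_of_mem u hx)) Set.subset_union_right (by
        rintro y (hy | hy) x hx k
        · exact hXY _ hy _ hx (h.left.map_prec _ _ k)
        · exact a.tgt_max y hy x k)
    obtain ⟨s', hs', hP⟩ := h.exists_split_left hps hXu hXw (Set.subset_union_left.trans hYw)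
    exact ⟨_, Or.inl ⟨f, hf, rfl⟩, p, hp, s', ⟨s, hs, b, hb, hs'⟩, hP⟩
  · obtain ⟨g, hg, p, hp, s, hs, w₁, w₂, hps, hXw, hYw⟩ := hB b hb (v ⁻¹' X ∪ b.src) (v ⁻¹' Y)
      Set.subset_union_right (fun x hx => hY (h.tgt ▸ Set.mem_image_of_mem v hx)) (by
        rintro y hy x (hx | hx) k
        · exact hXY _ hy _ hx (h.right.map_prec _ _ k)
        · exact b.src_min x hx y k)
    obtain ⟨p', hp', hP⟩ := h.exists_split_right hps hYv (Set.subset_union_left.trans hXw) hYw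
    exact ⟨_, Or.inr ⟨g, hg, rfl⟩, p', ⟨a, ha, p, hp, hp'⟩, s, hs, hP⟩

end Splits

/-! ### Gluing decompositions below a subsumption -/

/-- The prefix `r` refines the prefix `p` with target interface `U`, after the events in `F` have
been deleted from `p` and those in `D` have been terminated. -/
def PrefixBelow (U : Precube α) (D F : Set (Fin U.word.length)) (r p : Iposet α) : Prop :=
  ∃ (e : LoIso U.lo p.tgtLo) (φ : r.carrier → p.carrier), IsRefining r p φ ∧
    Set.range φ = ((fun i => (e.toEquiv i).1) '' F)ᶜ ∧ φ '' r.src = p.src ∧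
    φ '' r.tgt = (fun i => (e.toEquiv i).1) '' (D ∪ F)ᶜ

/-- The suffix `z` refines the suffix `s` with source interface `U`, after the events in `D` have
been deleted from `s` and those in `F` have been removed from the source interface. -/
def SuffixBelow (U : Precube α) (D F : Set (Fin U.word.length)) (z s : Iposet α) : Prop :=
  ∃ (e : LoIso U.lo s.srcLo) (ψ : z.carrier → s.carrier), IsRefining z s ψ ∧
    Set.range ψ = ((fun i => (e.toEquiv i).1) '' D)ᶜ ∧ ψ '' z.tgt = s.tgt ∧
    ψ '' z.src = (fun i => (e.toEquiv i).1) '' (D ∪ F)ᶜ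

theorem PrefixBelow.rev {U : Precube α} {D F : Set (Fin U.word.length)} {z s : Iposet α}
    (h : PrefixBelow U F D z.rev s.rev) : SuffixBelow U D F z s := by
  obtain ⟨e, ψ, hψ, hrange, htgt, hsrc⟩ := h
  rw [Set.union_comm] at hsrc
  exact ⟨e, ψ, hψ.rev, hrange, htgt, hsrc⟩

theorem exists_glued_of_below {U : Precube α} {D F : Set (Fin U.word.length)} {r p z s : Iposet α}
    {u : r.carrier → R.carrier} {v : z.carrier → R.carrier} (h : Glued r z R u v)
    (hDF : Disjoint D F) (hr : PrefixBelow U D F r p) (hz : SuffixBelow U D F z s) :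
    ∃ P u' v', Glued p s P u' v' ∧ Subsumed R P := by
  obtain ⟨e, φ, hφ, hφr, hφs, hφt⟩ := hr
  obtain ⟨e', ψ, hψ, hψr, hψt, hψs⟩ := hz
  obtain ⟨P, u', v', h', huv⟩ := exists_glued (P := p) (Q := s) e e'
  have he : Function.Injective fun i => (e.toEquiv i).1 :=
    Subtype.val_injective.comp e.toEquiv.injective
  have he' : Function.Injective fun i => (e'.toEquiv i).1 :=
    Subtype.val_injective.comp e'.toEquiv.injective
  have hmid : (u' ∘ φ) '' r.tgt = (v' ∘ ψ) '' z.src := by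
    rw [Set.image_comp, Set.image_comp, hφt, hψs, Set.image_image, Set.image_image]
    exact Set.image_congr fun i _ => huv i
  have hmeet : ∀ x y, u' (φ x) = v' (ψ y) → x ∈ r.tgt := by
    intro x y hxy
    obtain ⟨i, hi⟩ := e.toEquiv.surjective ⟨φ x, h'.mem_tgt _ _ hxy⟩
    have hix : (e.toEquiv i).1 = φ x := congrArg Subtype.val hi
    have hiy : (e'.toEquiv i).1 = ψ y := h'.right.injective (by rw [← huv, hix, hxy])
    have hiD : i ∉ D := fun k => hψr.subset ⟨y, rfl⟩ ⟨i, k, hiy⟩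
    have hiF : i ∉ F := fun k => hφr.subset ⟨x, rfl⟩ ⟨i, k, hix⟩
    rw [← hφ.injective.mem_set_image, hφt]
    exact ⟨i, not_or.2 ⟨hiD, hiF⟩, hix⟩
  have hcover : ∀ x, x ∈ Set.range (u' ∘ φ) ∨ x ∈ Set.range (v' ∘ ψ) := by
    intro x
    rw [Set.range_comp, Set.range_comp, hφr, hψr]
    rcases h'.cover x with ⟨x, rfl⟩ | ⟨x, rfl⟩
    · refine (em _).symm.imp (fun hx => ⟨x, hx, rfl⟩) ?_
      rintro ⟨i, hi, rfl⟩
      exact ⟨_, mt he'.mem_set_image.1 (hDF.notMem_of_mem_right hi), (huv i).symm⟩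
    · refine (em _).imp ?_ fun hx => ⟨x, hx, rfl⟩
      rintro ⟨i, hi, rfl⟩
      exact ⟨_, mt he.mem_set_image.1 (hDF.notMem_of_mem_left hi), huv i⟩
  exact ⟨P, u', v', h', h.subsumed_of_maps (h'.left.toIsRefining.comp hφ)
    (h'.right.toIsRefining.comp hψ) hmid hmeet (fun x _ y _ => h'.not_prec _ _) hcover
    (by rw [Set.image_comp, hφs, h'.src]) (by rw [Set.image_comp, hψt, h'.tgt])⟩

theorem prefixBelow_of_glued {U : Precube α} {r p z s : Iposet α} {u : r.carrier → R.carrier}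
    {v : z.carrier → R.carrier} (h : Glued r z R u v) {u' : p.carrier → P.carrier}
    {v' : s.carrier → P.carrier} (h' : Glued p s P u' v') {f : R.carrier → P.carrier}
    (hf : IsSubsumption R P f) (hu : ∀ x, f (u x) ∈ Set.range u')
    (hv : ∀ y, f (v y) ∈ Set.range v') (e : LoIso U.lo p.tgtLo) {t : Fin U.word.length → P.carrier}
    (ht : ∀ i, u' (e.toEquiv i).1 = t i) :
    PrefixBelow U {i | t i ∉ Set.range (f ∘ v)} {i | t i ∉ Set.range (f ∘ u)} r p := by
  obtain rfl := funext ht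
  choose φ hφ using hu
  let ι : Fin U.word.length → p.carrier := fun i => (e.toEquiv i).1
  let A : Set p.carrier := u' ⁻¹' Set.range (f ∘ u)
  let B : Set p.carrier := u' ⁻¹' Set.range (f ∘ v)
  have hA : Set.range φ = A := Set.Subset.antisymm
    (by rintro _ ⟨y, rfl⟩; exact ⟨y, (hφ y).symm⟩)
    (by rintro x ⟨y, hy⟩; exact ⟨y, h'.left.injective ((hφ y).trans hy)⟩)
  have hAB : Aᶜ ⊆ B := by
    intro x hx
    obtain ⟨y, hy⟩ := hf.bijective.surjective (u' x)
    rcases h.cover y with ⟨y, rfl⟩ | ⟨y, rfl⟩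
    exacts [absurd ⟨y, hy⟩ hx, ⟨y, hy⟩]
  have hB : B ⊆ Set.range ι := by
    rintro x ⟨y, hy⟩
    obtain ⟨y', hy'⟩ := hv y
    obtain ⟨i, hi⟩ := e.toEquiv.surjective ⟨x, h'.mem_tgt x y' (hy.symm.trans hy'.symm)⟩
    exact ⟨i, congrArg Subtype.val hi⟩
  have htgt : φ '' r.tgt = A ∩ B := by
    refine Set.Subset.antisymm ?_ ?_
    · rintro _ ⟨y, hy, rfl⟩
      obtain ⟨y', -, hy'⟩ := h.exists_right hy
      exact ⟨hA.subset ⟨y, rfl⟩, y', by rw [hφ, ← hy', Function.comp_apply]⟩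
    · rintro x ⟨hxA, y', hy'⟩
      obtain ⟨y, rfl⟩ := hA.superset hxA
      exact ⟨y, h.mem_tgt y y' (hf.bijective.injective (by rw [← hφ, ← hy', Function.comp_apply])),
        rfl⟩
  refine ⟨e, φ, (hf.isRefining.comp h.left.toIsRefining).of_comp h'.left hφ, ?_, ?_, ?_⟩
  · change Set.range φ = (ι '' (ι ⁻¹' Aᶜ))ᶜ
    rw [hA, Set.image_preimage_eq_of_subset (hAB.trans hB), compl_compl]
  · apply Set.image_injective.2 h'.left.injective
    rw [h'.src, ← hf.src, ← h.src, Set.image_image, Set.image_image]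
    simp only [hφ]
  · change φ '' r.tgt = ι '' (ι ⁻¹' (Bᶜ ∪ Aᶜ)ᶜ)
    rw [htgt, ← Set.compl_inter, compl_compl, Set.inter_comm B,
      Set.image_preimage_eq_of_subset (Set.inter_subset_right.trans hB)]

theorem exists_below_of_glued {r p z s : Iposet α} {u : r.carrier → R.carrier}
    {v : z.carrier → R.carrier} (h : Glued r z R u v) {u' : p.carrier → P.carrier}
    {v' : s.carrier → P.carrier} (h' : Glued p s P u' v') {f : R.carrier → P.carrier}
    (hf : IsSubsumption R P f) (hu : ∀ x, f (u x) ∈ Set.range u')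
    (hv : ∀ y, f (v y) ∈ Set.range v') {U : Precube α} (e : LoIso U.lo p.tgtLo) :
    ∃ D F, Disjoint D F ∧ PrefixBelow U D F r p ∧ SuffixBelow U D F z s := by
  obtain ⟨g, hg⟩ := h'.left.exists_loIso h'.right h'.mid
  have hf_rev : IsSubsumption R.rev P.rev f :=
    hf.isRefining.rev.isSubsumption hf.bijective.surjective hf.tgt hf.src
  refine ⟨_, _, ?_, prefixBelow_of_glued h h' hf hu hv e fun _ => rfl,
    (prefixBelow_of_glued h.rev h'.rev hf_rev hv hu (e.trans g) fun i => hg (e.toEquiv i)).rev⟩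
  rw [Set.disjoint_left]
  intro i hi hi'
  obtain ⟨y, hy⟩ := hf.bijective.surjective (u' (e.toEquiv i).1)
  rcases h.cover y with ⟨y, rfl⟩ | ⟨y, rfl⟩
  exacts [hi' ⟨y, hy⟩, hi ⟨y, hy⟩]

/-- The interval iposets that are below a prefix in `f.1` and below a suffix in `f.2`, respectively,
where the events in `D` have been terminated and those in `E` have not been started. -/
def belowPair (f : Set (Iposet α) × Set (Iposet α)) (U : Precube α)
    (D E : Set (Fin U.word.length)) : Set (Iposet α) × Set (Iposet α) :=
  ({r | r.IsInterval ∧ ∃ p ∈ f.1, PrefixBelow U D E r p},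
    {z | z.IsInterval ∧ ∃ s ∈ f.2, SuffixBelow U D E z s})

section Down

variable {A : Set (Iposet α)}

theorem prod_belowPair_subset {f : Set (Iposet α) × Set (Iposet α)} (hf : prod f.1 f.2 ⊆ A)
    {U : Precube α} {D E : Set (Fin U.word.length)} (hDE : Disjoint D E) :
    prod (belowPair f U D E).1 (belowPair f U D E).2 ⊆ down A := by
  rintro R ⟨r, ⟨hr, p, hp, hrp⟩, z, ⟨hz, s, hs, hzs⟩, u, v, h⟩
  obtain ⟨P, _, _, hP, hRP⟩ := exists_glued_of_below h hDE hrp hzs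
  exact ⟨h.isInterval hr hz, P, hf ⟨p, hp, s, hs, _, _, hP⟩, hRP⟩

variable {F : Set (Set (Iposet α) × Set (Iposet α))} {B : Set α} {n : ℕ}

theorem Splits.exists_mem_belowPair (hF : Splits A F) (hA : IsBounded A B n) (hR : R ∈ down A)
    {r z : Iposet α} {u : r.carrier → R.carrier} {v : z.carrier → R.carrier}
    (h : Glued r z R u v) :
    ∃ U ∈ Precube.words B n, ∃ f ∈ F, ∃ D E, Disjoint D E ∧ r ∈ (belowPair f U D E).1 ∧
      z ∈ (belowPair f U D E).2 := by
  obtain ⟨hR, P, hP, φ, hφ⟩ := hR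
  obtain ⟨f, hf, p, hp, s, hs, u', v', h', hu, hv⟩ := hF P hP (Set.range (φ ∘ u))
    (Set.range (φ ∘ v))
    (by rw [← hφ.src, ← h.src, ← Set.image_comp]; exact Set.image_subset_range _ _)
    (by rw [← hφ.tgt, ← h.tgt, ← Set.image_comp]; exact Set.image_subset_range _ _)
    (by rintro _ ⟨y, rfl⟩ _ ⟨x, rfl⟩ k; exact h.not_prec x y (hφ.prec _ _ k))
  obtain ⟨U, ⟨e⟩⟩ := p.tgtLo.exists_word
  obtain ⟨D, E, hDE, hr, hz⟩ := exists_below_of_glued h h' hφ (fun x => hu ⟨x, rfl⟩)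
    (fun y => hv ⟨y, rfl⟩) e
  exact ⟨U, hA.mem_words_tgt hP h'.left e, f, hf, D, E, hDE,
    ⟨h.left.isInterval hR, p, hp, hr⟩, h.right.isInterval hR, s, hs, hz⟩

theorem isRecognizable_down (hF : F.Finite) (hs : Splits A F)
    (sound : ∀ f ∈ F, prod f.1 f.2 ⊆ A) (hB : B.Finite) (hA : IsBounded A B n) :
    IsRecognizable (down A) := by
  let G (U : Precube α) : Set (Set (Iposet α) × Set (Iposet α)) :=
    Set.image2 (fun f (c : Set (Fin U.word.length) × Set (Fin U.word.length)) =>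
      belowPair f U c.1 c.2) F {c | Disjoint c.1 c.2}
  have hG : ∀ U, (G U).Finite := fun U => hF.image2 _ (Set.toFinite _)
  refine ⟨⟨⋃ U ∈ Precube.words B n, G U, (Precube.finite_words hB n).biUnion fun U _ => hG U,
    ?_, ?_⟩, B, n, hB, hA.down⟩
  · intro g hg
    obtain ⟨U, -, f, hf, c, hc, rfl⟩ := Set.mem_iUnion₂.1 hg
    exact prod_belowPair_subset (sound f hf) hc
  · intro R hR r z u v h
    obtain ⟨U, hU, f, hf, D, E, hDE, hr, hz⟩ := hs.exists_mem_belowPair hA hR h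
    exact ⟨_, Set.mem_iUnion₂.2 ⟨U, hU, f, hf, (D, E), hDE, rfl⟩, hr, hz⟩

end Down

/-! ### Closure properties of recognizable sets -/

theorem isRecognizable_empty : IsRecognizable (∅ : Set (Iposet α)) :=
  ⟨⟨∅, Set.finite_empty, by simp, by simp⟩, ∅, 0, Set.finite_empty, by simp, by simp⟩

theorem IsRecognizable.exists_isBounded {L M : Set (Iposet α)} (hL : IsRecognizable L)
    (hM : IsRecognizable M) : ∃ A n, A.Finite ∧ IsBounded L A n ∧ IsBounded M A n := by
  obtain ⟨A, n, hA, hLA⟩ := hL.bounded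
  obtain ⟨B, m, hB, hMB⟩ := hM.bounded
  exact ⟨A ∪ B, max n m, hA.union hB, hLA.mono subset_rfl Set.subset_union_left (le_max_left n m),
    hMB.mono subset_rfl Set.subset_union_right (le_max_right n m)⟩

theorem IsSplitFamily.union {L M : Set (Iposet α)}
    {F G : Set (Set (Iposet α) × Set (Iposet α))} (hF : IsSplitFamily L F)
    (hG : IsSplitFamily M G) : IsSplitFamily (L ∪ M) (F ∪ G) where
  sound := by
    rintro f (hf | hf)
    exacts [(hF.sound f hf).trans Set.subset_union_left,
      (hG.sound f hf).trans Set.subset_union_right]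
  complete := by
    rintro R (hR | hR) r z u v h
    · obtain ⟨f, hf, hrz⟩ := hF.complete R hR r z u v h
      exact ⟨f, Or.inl hf, hrz⟩
    · obtain ⟨f, hf, hrz⟩ := hG.complete R hR r z u v h
      exact ⟨f, Or.inr hf, hrz⟩

theorem IsRecognizable.union {L M : Set (Iposet α)} (hL : IsRecognizable L)
    (hM : IsRecognizable M) : IsRecognizable (L ∪ M) := by
  obtain ⟨A, n, hA, hLA, hMA⟩ := hL.exists_isBounded hM
  obtain ⟨F, hF, hLF⟩ := hL.split
  obtain ⟨G, hG, hMG⟩ := hM.split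
  exact ⟨⟨F ∪ G, hF.union hG, hLF.union hMG⟩, A, n, hA, hLA.union hMA⟩

theorem IsRecognizable.glue {L M : Set (Iposet α)} (hL : IsRecognizable L)
    (hM : IsRecognizable M) (hLi : ∀ P ∈ L, P.IsInterval) (hMi : ∀ P ∈ M, P.IsInterval) :
    IsRecognizable (down (prod L M)) := by
  obtain ⟨A, n, hA, hLA, hMA⟩ := hL.exists_isBounded hM
  obtain ⟨F, hF, hLF⟩ := hL.split
  obtain ⟨G, hG, hMG⟩ := hM.split
  refine isRecognizable_down ((hF.image _).union (hG.image _))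
    ((hLF.splits hLi).prod (hMG.splits hMi)) ?_ hA (hLA.prod hMA)
  rintro _ (⟨f, hf, rfl⟩ | ⟨f, hf, rfl⟩)
  · rw [← prod_assoc]
    exact prod_mono (hLF.sound f hf) subset_rfl
  · rw [prod_assoc]
    exact prod_mono subset_rfl (hMG.sound f hf)

/-- The gluing compositions of `n + 1` elements of `L`. -/
def powProd (L : Set (Iposet α)) : ℕ → Set (Iposet α)
  | 0 => L
  | n + 1 => prod L (powProd L n)

section Plus

variable {L M : Set (Iposet α)} {F : Set (Set (Iposet α) × Set (Iposet α))}

theorem prod_powProd_subset (L : Set (Iposet α)) (m n : ℕ) :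
    prod (powProd L m) (powProd L n) ⊆ powProd L (m + n + 1) := by
  induction m with
  | zero => rw [Nat.zero_add]; exact subset_rfl
  | succ m ih =>
    rw [powProd, prod_assoc, Nat.succ_add m n, Nat.succ_add]
    exact prod_mono subset_rfl ih

theorem prod_iUnion_powProd_subset (L : Set (Iposet α)) :
    prod (⋃ n, powProd L n) (⋃ n, powProd L n) ⊆ ⋃ n, powProd L n := by
  rintro P ⟨a, ha, b, hb, h⟩
  obtain ⟨m, hm⟩ := Set.mem_iUnion.1 ha
  obtain ⟨n, hn⟩ := Set.mem_iUnion.1 hb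
  exact Set.mem_iUnion.2 ⟨_, prod_powProd_subset L m n ⟨a, hm, b, hn, h⟩⟩

theorem powProd_isInterval (hL : ∀ P ∈ L, P.IsInterval) (n : ℕ) :
    ∀ P ∈ powProd L n, P.IsInterval := by
  induction n with
  | zero => exact hL
  | succ n ih =>
    rintro P ⟨a, ha, b, hb, u, v, h⟩
    exact h.isInterval (hL a ha) (ih b hb)

theorem IsBounded.powProd {A : Set α} {n : ℕ} (hL : IsBounded L A n) (k : ℕ) :
    IsBounded (powProd L k) A n := by
  induction k with
  | zero => exact hL
  | succ k ih => exact hL.prod ih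

/-- The prefixes and suffixes obtained from those in `f` by gluing elements of `M` to their outer
ends; if `f` describes a cut of a factor, these describe the cuts of a product of factors. -/
def extendBy (M : Set (Iposet α)) (f : Set (Iposet α) × Set (Iposet α)) :
    Set (Iposet α) × Set (Iposet α) :=
  (f.1 ∪ prod M f.1, f.2 ∪ prod f.2 M)

theorem prod_extendBy_subset (hM : prod M M ⊆ M) {f : Set (Iposet α) × Set (Iposet α)}
    (hf : prod f.1 f.2 ⊆ M) : prod (extendBy M f).1 (extendBy M f).2 ⊆ M := by
  have hleft : prod (extendBy M f).1 f.2 ⊆ M := by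
    rw [extendBy, union_prod, prod_assoc]
    exact Set.union_subset hf ((prod_mono subset_rfl hf).trans hM)
  rw [extendBy, prod_union, ← prod_assoc]
  exact Set.union_subset hleft ((prod_mono hleft subset_rfl).trans hM)

theorem Splits.powProd (hL : Splits L F) (hM : Iposet.prod M M ⊆ M)
    (hLM : ∀ k, powProd L k ⊆ M) (k : ℕ) : Splits (powProd L k) (extendBy M '' F) := by
  induction k with
  | zero =>
    exact hL.mono fun f hf =>
      ⟨_, ⟨f, hf, rfl⟩, Set.subset_union_left, Set.subset_union_left⟩
  | succ k ih =>
    refine (hL.prod ih).mono ?_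
    rintro _ (⟨f, hf, rfl⟩ | ⟨_, ⟨f, hf, rfl⟩, rfl⟩)
    · exact ⟨_, ⟨f, hf, rfl⟩, Set.subset_union_left,
        (prod_mono subset_rfl (hLM k)).trans Set.subset_union_right⟩
    · refine ⟨_, ⟨f, hf, rfl⟩, ?_, subset_rfl⟩
      change Iposet.prod L (f.1 ∪ Iposet.prod M f.1) ⊆ f.1 ∪ Iposet.prod M f.1
      rw [prod_union, ← prod_assoc]
      refine (Set.union_subset ?_ ?_).trans Set.subset_union_right
      · exact prod_mono (hLM 0) subset_rfl
      · exact prod_mono ((prod_mono (hLM 0) subset_rfl).trans hM) subset_rfl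

theorem IsRecognizable.plus (hL : IsRecognizable L) (hLi : ∀ P ∈ L, P.IsInterval) :
    IsRecognizable (down (⋃ n, powProd L n)) := by
  obtain ⟨⟨F, hF, hLF⟩, A, n, hA, hLA⟩ := hL
  have hsub : ∀ k, powProd L k ⊆ ⋃ n, powProd L n := Set.subset_iUnion _
  have hmul := prod_iUnion_powProd_subset L
  refine isRecognizable_down (hF.image (extendBy (⋃ n, powProd L n)))
    (Splits.iUnion ((hLF.splits hLi).powProd hmul hsub)) ?_ hA
    (IsBounded.iUnion hLA.powProd)
  rintro _ ⟨f, hf, rfl⟩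
  exact prod_extendBy_subset hmul ((hLF.sound f hf).trans (hsub 0))

end Plus

/-- The prefix and the suffix of `R` at the cut `c`. There is no prefix if `c` is not a cut, which
keeps the gluing compositions of the two sets isomorphic to `R`. -/
def cutPair (R : Iposet α) (c : Set R.carrier × Set R.carrier) :
    Set (Iposet α) × Set (Iposet α) :=
  ({p | IsCut R c.1 c.2 ∧ p = R.sub c.1 R.src c.2}, {s | s = R.sub (c.2 ∪ c.1ᶜ) c.2 R.tgt})

theorem splits_isomorphic (hR : R.IsInterval) :
    Splits {P | Isomorphic P R} (Set.range (cutPair R)) := by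
  intro P hP X Y hX _ hXY
  obtain ⟨f, hf, hprec⟩ := hP.symm
  obtain ⟨C, T, hCT, hXC, hYT⟩ := hR.exists_isCut_between (X := f ⁻¹' X) (Y := f ⁻¹' Y)
    (fun x hx => hX (hf.src ▸ Set.mem_image_of_mem f hx))
    (fun y hy x hx k => hXY _ hy _ hx (hprec _ _ k))
  refine ⟨_, ⟨(C, T), rfl⟩, _, ⟨hCT, rfl⟩, _, rfl, _, _,
    hCT.glued.comp_isomorphism hf hprec, ?_, ?_⟩
  all_goals
    rw [Set.range_comp, range_subVal]
    intro x hx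
    obtain ⟨x, rfl⟩ := hf.bijective.surjective x
  exacts [⟨x, hXC hx, rfl⟩, ⟨x, hYT hx, rfl⟩]

theorem isRecognizable_singleton (hR : R.IsInterval) :
    IsRecognizable (down {P | Isomorphic P R}) := by
  have := R.finite
  have hbound : IsBounded {R} (Set.range R.label) (Nat.card R.carrier) :=
    ⟨by rintro _ rfl x; exact ⟨x, rfl⟩, by rintro _ rfl X -; exact Set.ncard_le_card X⟩
  have hbound' : IsBounded {P | Isomorphic P R} (Set.range R.label) (Nat.card R.carrier) :=
    hbound.down.mono (fun P hP => ⟨hR.of_isomorphic hP, R, rfl, hP.subsumed⟩) subset_rfl le_rfl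
  refine isRecognizable_down (Set.finite_range _) (splits_isomorphic hR) ?_
    (Set.finite_range R.label) hbound'
  rintro _ ⟨⟨C, T⟩, rfl⟩ P ⟨_, ⟨hCT, rfl⟩, _, rfl, u, v, h⟩
  exact h.isomorphic hCT.glued

end Iposet

/-! ### Parallel composition -/

namespace Iposet

variable {α : Type u} {P Q R Z P' Q' : Iposet α}

/-- The first structural inclusion of a parallel composition. -/
def parInl (P Q : Iposet α) : P.carrier → (P.par Q).carrier := Sum.inl

/-- The second structural inclusion of a parallel composition. -/
def parInr (P Q : Iposet α) : Q.carrier → (P.par Q).carrier := Sum.inr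

/-- The parallel composition of two maps. -/
def parMap (u : P.carrier → P'.carrier) (v : Q.carrier → Q'.carrier) :
    (P.par Q).carrier → (P'.par Q').carrier :=
  Sum.map u v

theorem isEmbedding_parInl (P Q : Iposet α) : IsEmbedding P (P.par Q) (parInl P Q) where
  injective := Sum.inl_injective
  label _ := rfl
  prec _ _ h := by cases h with | inl h => exact h
  evord _ _ h _ _ := .inl h
  map_prec _ _ h := .inl h

theorem isEmbedding_parInr (P Q : Iposet α) : IsEmbedding Q (P.par Q) (parInr P Q) where
  injective := Sum.inr_injective
  label _ := rfl
  prec _ _ h := by cases h with | inr h => exact h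
  evord _ _ h _ _ := .inr h
  map_prec _ _ h := .inr h

theorem compl_range_parInl (P Q : Iposet α) :
    (Set.range (parInl P Q))ᶜ = Set.range (parInr P Q) :=
  Set.compl_range_inl

theorem preimage_parInl (A : Set P.carrier) (B : Set Q.carrier) :
    parInl P Q ⁻¹' (parInl P Q '' A ∪ parInr P Q '' B) = A := by
  rw [Set.preimage_union, Set.preimage_image_eq _ (isEmbedding_parInl P Q).injective]
  exact (congrArg (A ∪ ·) (Set.preimage_inl_image_inr B)).trans (Set.union_empty A)

theorem preimage_parInr (A : Set P.carrier) (B : Set Q.carrier) :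
    parInr P Q ⁻¹' (parInl P Q '' A ∪ parInr P Q '' B) = B := by
  rw [Set.preimage_union, Set.preimage_image_eq _ (isEmbedding_parInr P Q).injective]
  exact (congrArg (· ∪ B) (Set.preimage_inr_image_inl A)).trans (Set.empty_union B)

theorem image_preimage_parInl_union_parInr (S : Set (P.par Q).carrier) :
    parInl P Q '' (parInl P Q ⁻¹' S) ∪ parInr P Q '' (parInr P Q ⁻¹' S) = S :=
  Set.image_preimage_inl_union_image_preimage_inr S

theorem not_evord_parInr_parInl (x : Q.carrier) (y : P.carrier) :
    ¬ (P.par Q).evord (parInr P Q x) (parInl P Q y) :=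
  Sum.lex_inr_inl

section ParMap

variable {u : P.carrier → P'.carrier} {v : Q.carrier → Q'.carrier}

theorem parMap_image (A : Set P.carrier) (B : Set Q.carrier) :
    parMap u v '' (parInl P Q '' A ∪ parInr P Q '' B) =
      (parInl P' Q') '' (u '' A) ∪ (parInr P' Q') '' (v '' B) := by
  rw [Set.image_union, Set.image_image, Set.image_image, Set.image_image, Set.image_image]
  rfl

theorem parMap_image_src (A : Set P'.carrier) (B : Set Q'.carrier) (hu : u '' P.src = A)
    (hv : v '' Q.src = B) :
    parMap u v '' (P.par Q).src = parInl P' Q' '' A ∪ parInr P' Q' '' B :=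
  hu ▸ hv ▸ parMap_image _ _

theorem parMap_image_tgt (A : Set P'.carrier) (B : Set Q'.carrier) (hu : u '' P.tgt = A)
    (hv : v '' Q.tgt = B) :
    parMap u v '' (P.par Q).tgt = parInl P' Q' '' A ∪ parInr P' Q' '' B :=
  hu ▸ hv ▸ parMap_image _ _

theorem IsRefining.par (hu : IsRefining P P' u) (hv : IsRefining Q Q' v) :
    IsRefining (P.par Q) (P'.par Q') (parMap u v) where
  injective := hu.injective.sumMap hv.injective
  label := by
    rintro (x | x)
    exacts [hu.label x, hv.label x]
  prec := by
    rintro (x | x) (y | y) h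
    · exact .inl (hu.prec x y (Sum.liftRel_inl_inl.1 h))
    · exact (Sum.not_liftRel_inl_inr h).elim
    · exact (Sum.not_liftRel_inr_inl h).elim
    · exact .inr (hv.prec x y (Sum.liftRel_inr_inr.1 h))
  evord := by
    rintro _ _ (h | h | _) h₁ h₂
    · exact .inl (hu.evord _ _ h (fun k => h₁ (.inl k)) fun k => h₂ (.inl k))
    · exact .inr (hv.evord _ _ h (fun k => h₁ (.inr k)) fun k => h₂ (.inr k))
    · exact .sep _ _

end ParMap

section Glued

variable {p q s t : Iposet α} {u : p.carrier → P.carrier} {v : s.carrier → P.carrier}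
  {u' : q.carrier → Q.carrier} {v' : t.carrier → Q.carrier}

theorem Glued.not_prec_parMap (h : Glued p s P u v) (h' : Glued q t Q u' v')
    (x : (p.par q).carrier) (y : (s.par t).carrier) :
    ¬ (P.par Q).prec (parMap v v' y) (parMap u u' x) := by
  rcases x with x | x <;> rcases y with y | y
  · exact fun k => h.not_prec x y (Sum.liftRel_inl_inl.1 k)
  · exact Sum.not_liftRel_inr_inl
  · exact Sum.not_liftRel_inl_inr
  · exact fun k => h'.not_prec x y (Sum.liftRel_inr_inr.1 k)

theorem Glued.mem_tgt_of_parMap_eq (h : Glued p s P u v) (h' : Glued q t Q u' v')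
    {x : (p.par q).carrier} {y : (s.par t).carrier} (hxy : parMap u u' x = parMap v v' y) :
    x ∈ (p.par q).tgt := by
  rcases x with x | x <;> rcases y with y | y
  · exact Or.inl ⟨x, h.mem_tgt x y (Sum.inl_injective hxy), rfl⟩
  · exact absurd hxy Sum.inl_ne_inr
  · exact absurd hxy Sum.inr_ne_inl
  · exact Or.inr ⟨x, h'.mem_tgt x y (Sum.inr_injective hxy), rfl⟩

theorem Glued.mem_range_parMap (h : Glued p s P u v) (h' : Glued q t Q u' v')
    (x : (P.par Q).carrier) :
    x ∈ Set.range (parMap u u') ∨ x ∈ Set.range (parMap v v') := by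
  rcases x with x | x
  · rcases h.cover x with ⟨y, rfl⟩ | ⟨y, rfl⟩
    exacts [Or.inl ⟨parInl _ _ y, rfl⟩, Or.inr ⟨parInl _ _ y, rfl⟩]
  · rcases h'.cover x with ⟨y, rfl⟩ | ⟨y, rfl⟩
    exacts [Or.inl ⟨parInr _ _ y, rfl⟩, Or.inr ⟨parInr _ _ y, rfl⟩]

/-- Only a subsumption: the interchanged composite also orders `p ∖ T_p` before `t ∖ S_t` and
`q ∖ T_q` before `s ∖ S_s`. -/
theorem Glued.subsumed_par (h : Glued p s P u v) (h' : Glued q t Q u' v') {r z : Iposet α}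
    {w : r.carrier → R.carrier} {w' : z.carrier → R.carrier} (hR : Glued r z R w w')
    (hr : Subsumed r (p.par q)) (hz : Subsumed z (s.par t)) : Subsumed R (P.par Q) := by
  obtain ⟨φ, hφ⟩ := hr
  obtain ⟨ψ, hψ⟩ := hz
  have hmid : parMap u u' '' (p.par q).tgt = parMap v v' '' (s.par t).src :=
    (parMap_image_tgt _ _ h.mid h'.mid).trans (parMap_image_src _ _ rfl rfl).symm
  refine hR.subsumed_of_maps
    ((h.left.toIsRefining.par h'.left.toIsRefining).comp hφ.isRefining)
    ((h.right.toIsRefining.par h'.right.toIsRefining).comp hψ.isRefining)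
    (by rw [Set.image_comp, Set.image_comp, hφ.tgt, hψ.src, hmid])
    (fun x y hxy => ?_)
    (fun x _ y _ => h.not_prec_parMap h' _ _) (fun x => ?_) ?_ ?_
  · rw [← hφ.bijective.injective.mem_set_image, hφ.tgt]
    exact h.mem_tgt_of_parMap_eq h' hxy
  · rw [hφ.bijective.surjective.range_comp, hψ.bijective.surjective.range_comp]
    exact h.mem_range_parMap h' x
  · rw [Set.image_comp, hφ.src]
    exact parMap_image_src _ _ h.src h'.src
  · rw [Set.image_comp, hψ.tgt]
    exact parMap_image_tgt _ _ h.tgt h'.tgt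

end Glued

/-! ### Splitting off a parallel component -/

/-- The restriction of an iposet to a set of events. -/
abbrev restrict (P : Iposet α) (C : Set P.carrier) : Iposet α := P.sub C P.src P.tgt

theorem src_restrict (P : Iposet α) (C : Set P.carrier) :
    (P.restrict C).src = subVal ⁻¹' P.src :=
  Set.ext fun _ => ⟨fun h => h.1, fun h => ⟨h, fun y _ => P.src_min _ h y⟩⟩

theorem tgt_restrict (P : Iposet α) (C : Set P.carrier) :
    (P.restrict C).tgt = subVal ⁻¹' P.tgt :=
  Set.ext fun _ => ⟨fun h => h.1, fun h => ⟨h, fun y _ => P.tgt_max _ h y⟩⟩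

theorem isEmbedding_restrict (P : Iposet α) (C : Set P.carrier) :
    IsEmbedding (P.restrict C) P subVal :=
  isEmbedding_subVal P C P.src P.tgt

/-- The map between restrictions induced by a map of iposets. -/
def restrictMap (u : R.carrier → P.carrier) (C : Set P.carrier) :
    (R.restrict (u ⁻¹' C)).carrier → (P.restrict C).carrier :=
  C.restrictPreimage u

theorem restrictMap_image (u : R.carrier → P.carrier) (C : Set P.carrier) (S : Set R.carrier) :
    restrictMap u C '' (subVal ⁻¹' S) = subVal ⁻¹' (u '' S) :=
  Set.image_restrictPreimage S C u

theorem range_restrictMap (u : R.carrier → P.carrier) (C : Set P.carrier) :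
    Set.range (restrictMap u C) = subVal ⁻¹' Set.range u :=
  Set.range_restrictPreimage C u

theorem IsEmbedding.restrictMap {u : R.carrier → P.carrier} (h : IsEmbedding R P u)
    (C : Set P.carrier) : IsEmbedding (R.restrict (u ⁻¹' C)) (P.restrict C) (restrictMap u C) :=
  (h.comp (R.isEmbedding_restrict _)).of_comp (P.isEmbedding_restrict C) fun _ => rfl

theorem Glued.restrict {u : R.carrier → P.carrier} {v : Z.carrier → P.carrier}
    (h : Glued R Z P u v) (C : Set P.carrier) :
    Glued (R.restrict (u ⁻¹' C)) (Z.restrict (v ⁻¹' C)) (P.restrict C) (restrictMap u C)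
      (restrictMap v C) where
  left := h.left.restrictMap C
  right := h.right.restrictMap C
  src := by rw [src_restrict, src_restrict, restrictMap_image, h.src]
  tgt := by rw [tgt_restrict, tgt_restrict, restrictMap_image, h.tgt]
  mid := by rw [tgt_restrict, src_restrict, restrictMap_image, restrictMap_image, h.mid]
  mem_tgt x y hxy := by
    rw [tgt_restrict]
    exact h.mem_tgt _ _ (congrArg subVal hxy)
  cover x := by
    rw [range_restrictMap, range_restrictMap]
    exact h.cover (subVal x)
  lt x hx y hy := by
    rw [tgt_restrict] at hx
    rw [src_restrict] at hy
    exact h.lt _ hx _ hy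

theorem IsSubsumption.restrict {f : R.carrier → P.carrier} (hf : IsSubsumption R P f)
    {g : Q.carrier → P.carrier} (hg : IsEmbedding Q P g) (hs : g ⁻¹' P.src = Q.src)
    (ht : g ⁻¹' P.tgt = Q.tgt) : Subsumed (R.restrict (f ⁻¹' Set.range g)) Q := by
  choose h hh using fun x : (R.restrict (f ⁻¹' Set.range g)).carrier =>
    (subVal_mem x : subVal x ∈ f ⁻¹' Set.range g)
  have himage (S : Set R.carrier) : h '' (subVal ⁻¹' S) = g ⁻¹' (f '' S) := by
    ext y
    constructor
    · rintro ⟨x, hx, rfl⟩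
      exact ⟨subVal x, hx, (hh x).symm⟩
    · rintro ⟨x, hx, e⟩
      exact ⟨⟨x, y, e.symm⟩, hx, hg.injective ((hh _).trans e)⟩
  refine ⟨h, ((hf.isRefining.comp (R.isEmbedding_restrict _).toIsRefining).of_comp hg
    hh).isSubsumption (Set.range_eq_univ.1 ?_) ?_ ?_⟩
  · rw [← Set.image_univ, ← Set.preimage_univ (f := subVal), himage, Set.image_univ,
      hf.bijective.surjective.range_eq, Set.preimage_univ]
  · rw [src_restrict, himage, hf.src, hs]
  · rw [tgt_restrict, himage, hf.tgt, ht]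

theorem subsumed_of_bijective {g : Q.carrier → P.carrier} (hg : Function.Bijective g)
    (label : ∀ x, P.label (g x) = Q.label x) (src : g ⁻¹' P.src = Q.src)
    (tgt : g ⁻¹' P.tgt = Q.tgt) (prec : ∀ x y, Q.prec x y → P.prec (g x) (g y))
    (evord : ∀ x y, P.evord (g x) (g y) → ¬ P.prec (g x) (g y) → ¬ P.prec (g y) (g x) →
      Q.evord x y) : Subsumed P Q := by
  obtain ⟨e, rfl⟩ : ∃ e : Q.carrier ≃ P.carrier, e = g := ⟨Equiv.ofBijective g hg, rfl⟩
  refine ⟨e.symm, e.symm.bijective, fun x => ?_, ?_, ?_, fun x y h => ?_, fun x y h h₁ h₂ => ?_⟩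
  · rw [← label, e.apply_symm_apply]
  · rw [← src, e.image_symm_eq_preimage]
  · rw [← tgt, e.image_symm_eq_preimage]
  · simpa only [e.apply_symm_apply] using prec _ _ h
  · refine evord _ _ ?_ ?_ ?_ <;> simpa only [e.apply_symm_apply]

/-- The events in `C` come before the concurrent events outside of `C` in the event order, as for
the left factor of a parallel composition. -/
def IsEventInitial (P : Iposet α) (C : Set P.carrier) : Prop :=
  ∀ x ∉ C, ∀ y ∈ C, P.evord x y → P.prec x y ∨ P.prec y x

theorem IsEventInitial.preimage {C : Set P.carrier} (hC : P.IsEventInitial C)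
    {u : R.carrier → P.carrier} (hu : IsEmbedding R P u) : R.IsEventInitial (u ⁻¹' C) := by
  intro x hx y hy hxy
  by_contra! h
  rcases hC _ hx _ hy (hu.evord x y hxy h.1 h.2) with k | k
  exacts [h.1 (hu.prec x y k), h.2 (hu.prec y x k)]

theorem IsSubsumption.isEventInitial {f : R.carrier → (P.par Q).carrier}
    (hf : IsSubsumption R (P.par Q) f) : R.IsEventInitial (f ⁻¹' Set.range (parInl P Q)) := by
  intro x hx y hy hxy
  by_contra! h
  obtain ⟨a, ha⟩ : f x ∈ Set.range (parInr P Q) := compl_range_parInl P Q ▸ hx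
  obtain ⟨b, hb⟩ : f y ∈ Set.range (parInl P Q) := hy
  exact not_evord_parInr_parInl a b (ha ▸ hb ▸ hf.evord x y hxy h.1 h.2)

theorem IsEventInitial.subsumed_par {C : Set P.carrier} (hC : P.IsEventInitial C) :
    Subsumed P ((P.restrict C).par (P.restrict Cᶜ)) := by
  classical
  refine subsumed_of_bijective (g := Sum.elim subVal subVal) (Equiv.Set.sumCompl C).bijective
    ?_ ?_ ?_ ?_ ?_
  · rintro (x | x) <;> rfl
  · change _ = parInl _ _ '' (P.restrict C).src ∪ parInr _ _ '' (P.restrict Cᶜ).src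
    rw [src_restrict, src_restrict]
    exact (image_preimage_parInl_union_parInr _).symm
  · change _ = parInl _ _ '' (P.restrict C).tgt ∪ parInr _ _ '' (P.restrict Cᶜ).tgt
    rw [tgt_restrict, tgt_restrict]
    exact (image_preimage_parInl_union_parInr _).symm
  · rintro _ _ (h | h) <;> exact h
  · rintro (x | x) (y | y) h h₁ h₂
    · exact .inl h
    · exact .sep _ _
    · exact ((hC _ (subVal_mem x) _ (subVal_mem y) h).elim h₁ h₂).elim
    · exact .inr h

/-- The parallel compositions of elements of `L` and `M`. -/
def parProd (L M : Set (Iposet α)) : Set (Iposet α) :=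
  {P | ∃ a ∈ L, ∃ b ∈ M, P = a.par b}

theorem exists_isEventInitial_of_mem_down_parProd {L M : Set (Iposet α)}
    (hR : R ∈ down (parProd L M)) :
    ∃ C, R.IsEventInitial C ∧ R.restrict C ∈ down L ∧ R.restrict Cᶜ ∈ down M := by
  obtain ⟨hR, _, ⟨P, hP, Q, hQ, rfl⟩, φ, hφ⟩ := hR
  refine ⟨_, hφ.isEventInitial, ⟨(R.isEmbedding_restrict _).isInterval hR, P, hP,
    hφ.restrict (isEmbedding_parInl P Q) (preimage_parInl _ _) (preimage_parInl _ _)⟩,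
    (R.isEmbedding_restrict _).isInterval hR, Q, hQ, ?_⟩
  rw [← Set.preimage_compl, compl_range_parInl]
  exact hφ.restrict (isEmbedding_parInr P Q) (preimage_parInr _ _) (preimage_parInr _ _)

theorem IsBounded.par {L M : Set (Iposet α)} {A B : Set α} {n m : ℕ} (hL : IsBounded L A n)
    (hM : IsBounded M B m) : IsBounded (parProd L M) (A ∪ B) (n + m) where
  label := by
    rintro _ ⟨a, ha, b, hb, rfl⟩ (x | x)
    · exact Or.inl (hL.label a ha x)
    · exact Or.inr (hM.label b hb x)
  width := by
    rintro _ ⟨a, ha, b, hb, rfl⟩ X hX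
    rw [← image_preimage_parInl_union_parInr X]
    refine (Set.ncard_union_le _ _).trans (add_le_add ?_ ?_)
    · rw [Set.ncard_image_of_injective _ (isEmbedding_parInl a b).injective]
      exact hL.width a ha _ fun x hx y hy k => hX _ hx _ hy (.inl k)
    · rw [Set.ncard_image_of_injective _ (isEmbedding_parInr a b).injective]
      exact hM.width b hb _ fun x hx y hy k => hX _ hx _ hy (.inr k)

/-- The interval iposets subsumed by a parallel composition of elements of `f.1` and `g.1`, and of
`f.2` and `g.2`. The words `U` and `V` describe the interfaces of the factors, to ensure that these
can be glued separately. -/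
def parPair (f g : Set (Iposet α) × Set (Iposet α)) (U V : Precube α) :
    Set (Iposet α) × Set (Iposet α) :=
  ({r | r.IsInterval ∧ ∃ p ∈ f.1, ∃ q ∈ g.1, Nonempty (LoIso U.lo p.tgtLo) ∧
      Nonempty (LoIso V.lo q.tgtLo) ∧ Subsumed r (p.par q)},
    {z | z.IsInterval ∧ ∃ s ∈ f.2, ∃ t ∈ g.2, Nonempty (LoIso U.lo s.srcLo) ∧
      Nonempty (LoIso V.lo t.srcLo) ∧ Subsumed z (s.par t)})

section ParPair

variable {L M : Set (Iposet α)} {A B : Set α} {n m : ℕ}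

theorem prod_parPair_subset {f g : Set (Iposet α) × Set (Iposet α)} (hf : prod f.1 f.2 ⊆ L)
    (hg : prod g.1 g.2 ⊆ M) (U V : Precube α) :
    prod (parPair f g U V).1 (parPair f g U V).2 ⊆ down (parProd L M) := by
  rintro R ⟨r, ⟨hr, p, hp, q, hq, ⟨ep⟩, ⟨eq⟩, hrpq⟩, z, ⟨hz, s, hs, t, ht, ⟨es⟩, ⟨et⟩, hzst⟩,
    u, v, h⟩
  obtain ⟨P, _, _, hP, -⟩ := exists_glued ep es
  obtain ⟨Q, _, _, hQ, -⟩ := exists_glued eq et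
  exact ⟨h.isInterval hr hz, _, ⟨P, hf ⟨p, hp, s, hs, _, _, hP⟩, Q, hg ⟨q, hq, t, ht, _, _, hQ⟩,
    rfl⟩, hP.subsumed_par hQ h hrpq hzst⟩

theorem IsSplitFamily.exists_mem_parPair {F G : Set (Set (Iposet α) × Set (Iposet α))}
    (hF : IsSplitFamily L F) (hG : IsSplitFamily M G) (hL : IsBounded L A n)
    (hM : IsBounded M B m) {C : Set R.carrier} (hR : R.IsInterval) (hC : R.IsEventInitial C)
    (hCL : R.restrict C ∈ L) (hCM : R.restrict Cᶜ ∈ M) {r z : Iposet α}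
    {u : r.carrier → R.carrier} {v : z.carrier → R.carrier} (h : Glued r z R u v) :
    ∃ f ∈ F, ∃ g ∈ G, ∃ U ∈ Precube.words A n, ∃ V ∈ Precube.words B m,
      r ∈ (parPair f g U V).1 ∧ z ∈ (parPair f g U V).2 := by
  have hl := h.restrict C
  have hr := h.restrict Cᶜ
  obtain ⟨f, hf, hf₁, hf₂⟩ := hF.complete _ hCL _ _ _ _ hl
  obtain ⟨g, hg, hg₁, hg₂⟩ := hG.complete _ hCM _ _ _ _ hr
  obtain ⟨U, ⟨eU⟩⟩ := (r.restrict (u ⁻¹' C)).tgtLo.exists_word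
  obtain ⟨V, ⟨eV⟩⟩ := (r.restrict (u ⁻¹' Cᶜ)).tgtLo.exists_word
  obtain ⟨il, -⟩ := hl.left.exists_loIso hl.right hl.mid
  obtain ⟨ir, -⟩ := hr.left.exists_loIso hr.right hr.mid
  exact ⟨f, hf, g, hg, U, hL.mem_words_tgt hCL hl.left eU, V, hM.mem_words_tgt hCM hr.left eV,
    ⟨h.left.isInterval hR, _, hf₁, _, hg₁, ⟨eU⟩, ⟨eV⟩, (hC.preimage h.left).subsumed_par⟩,
    h.right.isInterval hR, _, hf₂, _, hg₂, ⟨eU.trans il⟩, ⟨eV.trans ir⟩,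
    (hC.preimage h.right).subsumed_par⟩

theorem IsRecognizable.par (hL : IsRecognizable L) (hM : IsRecognizable M) (hLd : down L ⊆ L)
    (hMd : down M ⊆ M) : IsRecognizable (down (parProd L M)) := by
  obtain ⟨⟨F, hF, hLF⟩, A, n, hA, hLA⟩ := hL
  obtain ⟨⟨G, hG, hMG⟩, B, m, hB, hMB⟩ := hM
  let W := Precube.words A n ×ˢ Precube.words B m
  have hW : W.Finite := (Precube.finite_words hA n).prod (Precube.finite_words hB m)
  refine ⟨⟨Set.image2 (fun f c => parPair f.1 f.2 c.1 c.2) (F ×ˢ G) W, (hF.prod hG).image2 _ hW,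
    ?_, ?_⟩, A ∪ B, n + m, hA.union hB, (hLA.par hMB).down⟩
  · rintro _ ⟨f, hf, c, -, rfl⟩
    exact prod_parPair_subset (hLF.sound f.1 hf.1) (hMG.sound f.2 hf.2) c.1 c.2
  · intro R hR r z u v h
    obtain ⟨C, hC, hCL, hCM⟩ := exists_isEventInitial_of_mem_down_parProd hR
    obtain ⟨f, hf, g, hg, U, hU, V, hV, hr, hz⟩ :=
      hLF.exists_mem_parPair hMG hLA hMB hR.1 hC (hLd hCL) (hMd hCM) h
    exact ⟨_, ⟨(f, g), ⟨hf, hg⟩, (U, V), ⟨hU, hV⟩, rfl⟩, hr, hz⟩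

end ParPair

end Iposet

/-! ### Rational languages are recognizable -/

namespace Iposet

variable {α : Type u} {P Q : Iposet α}

theorem IsSubsumption.nonempty_loIso_srcLo {f : P.carrier → Q.carrier}
    (hf : IsSubsumption P Q f) : Nonempty (LoIso P.srcLo Q.srcLo) := by
  have mem : ∀ x : P.src, f x.1 ∈ Q.src := fun x => hf.src ▸ Set.mem_image_of_mem f x.2
  refine ⟨LoIso.ofBijective (U := P.srcLo) (V := Q.srcLo) (fun x => ⟨f x.1, mem x⟩)
    ⟨fun x y hxy => ?_, fun y => ?_⟩ (fun x y hxy => ?_) fun x => hf.label x.1⟩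
  · exact Subtype.ext (hf.bijective.injective (congrArg Subtype.val hxy))
  · obtain ⟨x, hx, hxy⟩ := hf.src.ge y.2
    exact ⟨⟨x, hx⟩, Subtype.ext hxy⟩
  · exact hf.evord _ _ hxy (P.src_min _ y.2 _) (P.src_min _ x.2 _)

theorem down_prod_down {L M : Set (Iposet α)} (hM : ∀ P ∈ M, P.IsInterval) :
    down (prod L (down M)) = down (prod L M) := by
  ext P
  constructor
  · rintro ⟨hP, Q, ⟨a, ha, b, ⟨-, c, hc, f, hf⟩, u, v, h⟩, hPQ⟩
    obtain ⟨i, -⟩ := h.left.exists_loIso h.right h.mid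
    obtain ⟨j⟩ := hf.nonempty_loIso_srcLo
    obtain ⟨G, u', v', hG, -⟩ := exists_glued i.symm j
    exact ⟨hP, G, ⟨a, ha, c, hc, u', v', hG⟩,
      hPQ.trans (h.subsumed hG ⟨_, IsSubsumption.id a⟩ ⟨f, hf⟩)⟩
  · rintro ⟨hP, Q, ⟨a, ha, b, hb, h⟩, hPQ⟩
    exact ⟨hP, Q, ⟨a, ha, b, ⟨hM b hb, b, hb, _, IsSubsumption.id b⟩, h⟩, hPQ⟩

theorem down_iUnion {κ : Sort*} (A : κ → Set (Iposet α)) :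
    down (⋃ i, A i) = ⋃ i, down (A i) := by
  ext P
  constructor
  · rintro ⟨hP, Q, hQ, hPQ⟩
    obtain ⟨i, hi⟩ := Set.mem_iUnion.1 hQ
    exact Set.mem_iUnion.2 ⟨i, hP, Q, hi, hPQ⟩
  · intro hP
    obtain ⟨i, hP, Q, hQ, hPQ⟩ := Set.mem_iUnion.1 hP
    exact ⟨hP, Q, Set.mem_iUnion.2 ⟨i, hQ⟩, hPQ⟩

theorem Subsumed.isomorphic_of_subsingleton [Subsingleton Q.carrier] (h : Subsumed P Q) :
    Isomorphic P Q := by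
  obtain ⟨f, hf⟩ := h
  refine ⟨f, hf, fun x y hxy => ?_⟩
  rw [hf.bijective.injective (Subsingleton.elim (f x) (f y))] at hxy
  exact absurd hxy (P.prec_irrefl y)

theorem subsingleton_discrete {w : List α} (hw : w.length ≤ 1) (S T : Set (Fin w.length)) :
    Subsingleton (discrete w S T).carrier :=
  Fin.subsingleton_iff_le_one.2 hw

end Iposet

namespace Ipomset

variable {α : Type u} {L : Set (Ipomset α)}

/-- The representatives of a set of ipomsets. -/
def reps (L : Set (Ipomset α)) : Set (Iposet α) := mk ⁻¹' L

theorem mk_surjective : Function.Surjective (mk : Iposet α → Ipomset α) := Quotient.exists_rep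

theorem mk_eq_mk {P Q : Iposet α} : mk P = mk Q ↔ Iposet.Isomorphic P Q :=
  ⟨fun h => Quotient.exact h, fun h => Quotient.sound h⟩

theorem Subsumed.trans {P Q R : Ipomset α} (h : P.Subsumed Q) (h' : Q.Subsumed R) :
    P.Subsumed R := by
  obtain ⟨P, rfl⟩ := mk_surjective P
  obtain ⟨Q, rfl⟩ := mk_surjective Q
  obtain ⟨R, rfl⟩ := mk_surjective R
  exact Iposet.Subsumed.trans h h'

namespace IsLanguage

theorem isInterval_of_mem_reps (hL : IsLanguage L) : ∀ P ∈ reps L, P.IsInterval :=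
  fun P hP => hL.interval (Ipomset.mk P) hP

theorem down_reps (hL : IsLanguage L) : Iposet.down (reps L) = reps L := by
  ext P
  constructor
  · rintro ⟨hP, Q, hQ, hPQ⟩
    exact hL.down_closed (Ipomset.mk P) (Ipomset.mk Q) hP hPQ hQ
  · exact fun hP => ⟨hL.isInterval_of_mem_reps P hP, P, hP, _, Iposet.IsSubsumption.id P⟩

protected theorem down (A : Set (Ipomset α)) : IsLanguage (Ipomset.down A) where
  interval _ hP := hP.1
  down_closed := by
    rintro P Q hP hPQ ⟨-, R, hR, hQR⟩
    exact ⟨hP, R, hR, hPQ.trans hQR⟩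

protected theorem iUnion {κ : Sort*} {L : κ → Set (Ipomset α)} (hL : ∀ i, IsLanguage (L i)) :
    IsLanguage (⋃ i, L i) where
  interval P hP := by
    obtain ⟨i, hi⟩ := Set.mem_iUnion.1 hP
    exact (hL i).interval P hi
  down_closed P Q hP hPQ hQ := by
    obtain ⟨i, hi⟩ := Set.mem_iUnion.1 hQ
    exact Set.mem_iUnion.2 ⟨i, (hL i).down_closed P Q hP hPQ hi⟩

protected theorem union {M : Set (Ipomset α)} (hL : IsLanguage L) (hM : IsLanguage M) :
    IsLanguage (L ∪ M) := by
  rw [Set.union_eq_iUnion]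
  exact .iUnion (Bool.forall_bool.2 ⟨hM, hL⟩)

protected theorem langPow (hL : IsLanguage L) : ∀ n, IsLanguage (Ipomset.langPow L n)
  | 0 => hL
  | _ + 1 => .down _

theorem singleton_mk {P : Iposet α} [Subsingleton P.carrier] (hP : P.IsInterval) :
    IsLanguage {Ipomset.mk P} where
  interval := by rintro _ rfl; exact hP
  down_closed := by
    rintro Q _ - hQ rfl
    obtain ⟨Q, rfl⟩ := mk_surjective Q
    exact mk_eq_mk.2 (Iposet.Subsumed.isomorphic_of_subsingleton hQ)

end IsLanguage

theorem reps_singleton_mk (P : Iposet α) : reps {mk P} = {Q | Q.Isomorphic P} :=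
  Set.ext fun _ => mk_eq_mk

theorem reps_langGlue (L M : Set (Ipomset α)) :
    reps (langGlue L M) = Iposet.down (Iposet.prod (reps L) (reps M)) := by
  ext R
  constructor
  · rintro ⟨hR, _, ⟨P, Q, f, hP, hQ, rfl⟩, hRQ⟩
    exact ⟨hR, _, ⟨P, hP, Q, hQ, _, _, Iposet.glued_glue f⟩, hRQ⟩
  · rintro ⟨hR, G, ⟨P, hP, Q, hQ, u, v, h⟩, hRG⟩
    obtain ⟨f, -⟩ := h.left.exists_loIso h.right h.mid
    exact ⟨hR, _, ⟨P, Q, f, hP, hQ, rfl⟩,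
      Iposet.Subsumed.trans hRG (h.isomorphic (Iposet.glued_glue f)).subsumed⟩

theorem reps_langPar (L M : Set (Ipomset α)) :
    reps (langPar L M) = Iposet.down (Iposet.parProd (reps L) (reps M)) := by
  ext R
  constructor
  · rintro ⟨hR, _, ⟨P, Q, hP, hQ, rfl⟩, hRQ⟩
    exact ⟨hR, _, ⟨P, hP, Q, hQ, rfl⟩, hRQ⟩
  · rintro ⟨hR, _, ⟨P, hP, Q, hQ, rfl⟩, hRQ⟩
    exact ⟨hR, _, ⟨P, Q, hP, hQ, rfl⟩, hRQ⟩

theorem reps_langPow (hL : IsLanguage L) (n : ℕ) :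
    reps (langPow L n) = Iposet.down (Iposet.powProd (reps L) n) := by
  induction n with
  | zero => exact hL.down_reps.symm
  | succ n ih =>
    rw [langPow, reps_langGlue, ih,
      Iposet.down_prod_down (Iposet.powProd_isInterval hL.isInterval_of_mem_reps n)]
    rfl

theorem reps_langPlus (hL : IsLanguage L) :
    reps (langPlus L) = Iposet.down (⋃ n, Iposet.powProd (reps L) n) := by
  rw [Iposet.down_iUnion]
  exact Set.preimage_iUnion.trans (Set.iUnion_congr (reps_langPow hL))

theorem isRecognizable_reps_singleton_mk {P : Iposet α} [Subsingleton P.carrier]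
    (hP : P.IsInterval) : Iposet.IsRecognizable (reps {mk P}) := by
  rw [← (IsLanguage.singleton_mk hP).down_reps, reps_singleton_mk]
  exact Iposet.isRecognizable_singleton hP

theorem IsRational.isLanguage (h : IsRational L) : IsLanguage L := by
  induction h with
  | empty => exact ⟨by simp, by simp⟩
  | epsilon =>
    have := Iposet.subsingleton_discrete (w := ([] : List α)) (by simp) ∅ ∅
    exact .singleton_mk (Iposet.isInterval_discrete _ _ _)
  | letter a | letterSrc a | letterTgt a | letterSrcTgt a =>
    have := Iposet.subsingleton_discrete (w := [a]) le_rfl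
    exact .singleton_mk (Iposet.isInterval_discrete _ _ _)
  | union _ _ hL hM => exact hL.union hM
  | glue | par => exact .down _
  | plus _ hL => exact .iUnion hL.langPow

theorem IsRational.isRecognizable (h : IsRational L) : Iposet.IsRecognizable (reps L) := by
  induction h with
  | empty => exact Iposet.isRecognizable_empty
  | epsilon =>
    have := Iposet.subsingleton_discrete (w := ([] : List α)) (by simp) ∅ ∅
    exact isRecognizable_reps_singleton_mk (Iposet.isInterval_discrete _ _ _)
  | letter a | letterSrc a | letterTgt a | letterSrcTgt a =>
    have := Iposet.subsingleton_discrete (w := [a]) le_rfl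
    exact isRecognizable_reps_singleton_mk (Iposet.isInterval_discrete _ _ _)
  | union _ _ ihL ihM => exact ihL.union ihM
  | glue hL hM ihL ihM =>
    rw [reps_langGlue]
    exact ihL.glue ihM hL.isLanguage.isInterval_of_mem_reps hM.isLanguage.isInterval_of_mem_reps
  | par hL hM ihL ihM =>
    rw [reps_langPar]
    exact ihL.par ihM hL.isLanguage.down_reps.le hM.isLanguage.down_reps.le
  | plus hL ihL =>
    rw [reps_langPlus hL.isLanguage]
    exact ihL.plus hL.isLanguage.isInterval_of_mem_reps

end Ipomset

/-! ### Cells with suffixes attached to their faces -/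

namespace Precube

variable {α : Type u} {U V : Precube α}

theorem mem_words_of_hom {A : Set α} {n : ℕ} (d : U ⟶ V) (hV : V ∈ words A n) :
    U ∈ words A n := by
  refine ⟨?_, fun i => d.label i ▸ hV.2 _⟩
  have hcard := Fintype.card_le_of_injective d.emb d.strictMono.injective
  rw [Fintype.card_fin, Fintype.card_fin] at hcard
  exact hcard.trans hV.1

end Precube

namespace HDA

variable {α : Type u} {ι : Type} {U V W : Precube α}

/-- A state for each face of a cell over `U`, where the face is given by the sets of unstarted and
of terminated events. A state is a set of indices of sets of suffixes, or `none` if it puts no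
condition on suffixes. -/
abbrev FaceStates (ι : Type) (U : Precube α) : Type :=
  Set (Fin U.word.length) → Set (Fin U.word.length) → Option (Set ι)

/-- The suffixes allowed by a state. -/
def stateSuffixes (suf : ι → Set (Iposet α)) : Option (Set ι) → Set (Iposet α)
  | none => Set.univ
  | some I => {Z | ∃ i ∈ I, Z ∈ suf i}

/-- The states of the faces of a cell over `U`, for the face along a coface map `d : V ⟶ U`. -/
def cellFace (d : V ⟶ U) (q : FaceStates ι U) : FaceStates ι V :=
  fun A B => q (d.emb '' A ∪ d.A) (d.emb '' B ∪ d.B)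

theorem cellFace_empty (d : V ⟶ U) (q : FaceStates ι U) : cellFace d q ∅ ∅ = q d.A d.B := by
  simp only [cellFace, Set.image_empty, Set.empty_union]

theorem cellFace_id (q : FaceStates ι U) : cellFace (𝟙 U) q = q := by
  funext A B
  have image_id_union (X) : Precube.Coface.emb (𝟙 U) '' X ∪ ∅ = X := by
    rw [Set.union_empty]
    exact Set.image_id X
  exact congrArg₂ q (image_id_union A) (image_id_union B)

theorem cellFace_comp (d : W ⟶ V) (g : V ⟶ U) (q : FaceStates ι U) :
    cellFace (d ≫ g) q = cellFace d (cellFace g q) := by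
  funext A B
  have image_comp_union (X) {Y : Set (Fin V.word.length)} {Y' : Set (Fin U.word.length)} :
      (g.emb ∘ d.emb) '' X ∪ (g.emb '' Y ∪ Y') = g.emb '' (d.emb '' X ∪ Y) ∪ Y' := by
    rw [Set.image_union, Set.image_comp, Set.union_assoc]
  exact congrArg₂ q (image_comp_union A) (image_comp_union B)

/-- Prepending a step to a suffix allowed at its end yields a suffix allowed at its start, for all
up-steps and down-steps between faces. -/
structure IsCell (suf : ι → Set (Iposet α)) (U : Precube α) (q : FaceStates ι U) : Prop where
  up : ∀ {W V : Precube α} (g : V ⟶ U) (d : W ⟶ V) (hd : d.B = ∅) {T : LoSet α}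
    (Z : IposetHom V.lo T), Z.iposet ∈ stateSuffixes suf (q g.A g.B) →
      ((IposetHom.upStep d hd).comp Z).iposet ∈ stateSuffixes suf (q (d ≫ g).A (d ≫ g).B)
  down : ∀ {W V : Precube α} (g : V ⟶ U) (d : W ⟶ V) (hd : d.A = ∅) {T : LoSet α}
    (Z : IposetHom W.lo T), Z.iposet ∈ stateSuffixes suf (q (d ≫ g).A (d ≫ g).B) →
      ((IposetHom.downStep d hd).comp Z).iposet ∈ stateSuffixes suf (q g.A g.B)

section Cells

variable {suf : ι → Set (Iposet α)}

theorem IsCell.face {q : FaceStates ι U} (h : IsCell suf U q) (d : V ⟶ U) :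
    IsCell suf V (cellFace d q) := by
  refine ⟨fun g c hc T Z hZ => ?_, fun g c hc T Z hZ => h.down (g ≫ d) c hc Z ?_⟩
  · have hup := h.up (g ≫ d) c hc Z hZ
    rwa [← Category.assoc] at hup
  · rwa [← Category.assoc]

variable (suf)

/-- The precubical set of cells over words of length at most `n` over `A`. -/
def cellFunctor (A : Set α) (n : ℕ) : (Precube α)ᵒᵖ ⥤ Type where
  obj U := {q : FaceStates ι U.unop // IsCell suf U.unop q ∧ U.unop ∈ Precube.words A n}
  map d := ↾ fun q => ⟨cellFace d.unop q.1, q.2.1.face d.unop,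
    Precube.mem_words_of_hom d.unop q.2.2⟩
  map_id _ := ConcreteCategory.hom_ext _ _ fun q => Subtype.ext (cellFace_id q.1)
  map_comp d e := ConcreteCategory.hom_ext _ _ fun q =>
    Subtype.ext (cellFace_comp e.unop d.unop q.1)

/-- The cells over a fixed word. -/
abbrev Cell (A : Set α) (n : ℕ) (U : Precube α) : Type := (cellFunctor suf A n).obj (op U)

theorem finite_cellFunctor [Finite ι] {A : Set α} (hA : A.Finite) (n : ℕ) :
    Finite (Σ U : Precube α, Cell suf A n U) := by
  have : Finite (Precube.words A n) := (Precube.finite_words hA n).to_subtype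
  have (U : Precube α) : Finite (Cell suf A n U) :=
    inferInstanceAs (Finite {q : FaceStates ι U // IsCell suf U q ∧ U ∈ Precube.words A n})
  refine Finite.of_injective (β := Σ U : Precube.words A n, Cell suf A n U.1)
    (fun x => ⟨⟨x.1, x.2.2.2⟩, x.2⟩) ?_
  rintro ⟨U, x⟩ ⟨V, y⟩ h
  simp only [Sigma.mk.injEq, Subtype.mk.injEq] at h
  obtain ⟨rfl, h⟩ := h
  rw [eq_of_heq h]

/-- The automaton in which a start cell only allows suffixes in `L`, and an accept cell allows the
identity as a suffix. -/
def cellHDA [Finite ι] (L : Set (Iposet α)) {A : Set α} (hA : A.Finite) (n : ℕ) : HDA α where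
  cells := cellFunctor suf A n
  finite := finite_cellFunctor suf hA n
  start U := {x | ∀ (V : Precube α) (Z : IposetHom U.lo V.lo),
    Z.iposet ∈ stateSuffixes suf (x.1 ∅ ∅) → Z.iposet ∈ L}
  accept U := {x | (IposetHom.identity U).iposet ∈ stateSuffixes suf (x.1 ∅ ∅)}

variable {suf}

theorem ev_mem_stateSuffixes {A : Set α} {n : ℕ} {x : Cell suf A n U} {y : Cell suf A n V}
    (p : Path (cellFunctor suf A n) x y)
    (hy : (IposetHom.identity V).iposet ∈ stateSuffixes suf (y.1 ∅ ∅)) :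
    p.ev.iposet ∈ stateSuffixes suf (x.1 ∅ ∅) := by
  induction p with
  | nil x => exact hy
  | @up U V W d hd y z p ih =>
    have hup := y.2.1.up (𝟙 V) d hd p.ev (ih hy)
    rw [Category.comp_id] at hup
    change _ ∈ stateSuffixes suf (cellFace d y.1 ∅ ∅)
    rwa [cellFace_empty]
  | @down U V W d hd x z p ih =>
    have hface : p.ev.iposet ∈ stateSuffixes suf (cellFace d x.1 ∅ ∅) := ih hy
    rw [cellFace_empty] at hface
    refine x.2.1.down (𝟙 U) d hd p.ev ?_
    rwa [Category.comp_id]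

end Cells

end HDA

/-! ### Enumerations of antichains -/

namespace Iposet

variable {α : Type u} {P Q R : Iposet α}

/-- `e` enumerates `T` along the event order, with labels given by the word `U`. This is how the
active events of an iposet become the object over which a cell lives. -/
structure Enumerates (P : Iposet α) (U : Precube α) (T : Set P.carrier)
    (e : Fin U.word.length → P.carrier) : Prop where
  mono : ∀ i j, i < j → P.evord (e i) (e j)
  label : ∀ i, P.label (e i) = U.word.get i
  range : Set.range e = T

theorem exists_enumerates {T : Set P.carrier} (hT : ∀ x ∈ T, ∀ y ∈ T, ¬ P.prec x y) :
    ∃ U e, Enumerates P U T e := by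
  obtain ⟨U, ⟨f⟩⟩ := (P.sub T T T).srcLo.exists_word
  refine ⟨U, fun i => subVal (f.toEquiv i).1, fun i j h => (f.map_ord i j).1 h, f.map_label, ?_⟩
  have himage := subVal_image_src (P := P) (T := T) (subset_refl T) fun x hx y hy => hT y hy x hx
  refine Eq.trans ?_ himage
  rw [Set.image_eq_range]
  exact f.toEquiv.surjective.range_comp fun x => subVal x.1

namespace Enumerates

variable {U V : Precube α} {T T' : Set P.carrier} {e : Fin U.word.length → P.carrier}
  {e' : Fin V.word.length → P.carrier}

theorem injective (h : Enumerates P U T e) : Function.Injective e := by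
  let := partialOrderOfSO P.evord
  have hmono : StrictMono e := fun i j hij => h.mono i j hij
  exact hmono.injective

theorem mem (h : Enumerates P U T e) (i) : e i ∈ T := h.range ▸ Set.mem_range_self i

theorem image_univ (h : Enumerates P U T e) : e '' Set.univ = T := by
  rw [Set.image_univ, h.range]

theorem image_compl (h : Enumerates P U T e) (A : Set (Fin U.word.length)) :
    e '' Aᶜ = T \ e '' A := by
  rw [Set.image_compl_eq_range_sdiff_image h.injective, h.range]

theorem comp (h : Enumerates P U T e) (g : V ⟶ U) :
    Enumerates P V (T \ (e '' g.A ∪ e '' g.B)) (e ∘ g.emb) where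
  mono i j hij := h.mono _ _ (g.strictMono hij)
  label i := (h.label _).trans (g.label i)
  range := by rw [Set.range_comp, g.range, h.image_compl, Set.image_union]

theorem isEmbedding (h : Enumerates P U T e) (hT : ∀ x ∈ T, ∀ y ∈ T, ¬ P.prec x y)
    (S S' : Set (Fin U.word.length)) : IsEmbedding (discrete U.word S S') P e where
  injective := h.injective
  label := h.label
  prec i j hij := hT _ (h.mem i) _ (h.mem j) hij
  evord i j hij _ _ := h.mono i j hij
  map_prec _ _ hij := hij.elim

theorem nonempty_loIso_tgtLo (h : Enumerates P U T e) {w : R.carrier → P.carrier}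
    (hw : IsEmbedding R P w) (hT : w '' R.tgt = T) : Nonempty (LoIso U.lo R.tgtLo) := by
  have antichain : ∀ x ∈ T, ∀ y ∈ T, ¬ P.prec x y := by
    rw [← hT]
    rintro _ ⟨x, hx, rfl⟩ _ ⟨y, -, rfl⟩
    rw [hw.prec_iff]
    exact R.tgt_max x hx y
  obtain ⟨f, -⟩ := hw.exists_loIso (h.isEmbedding antichain Set.univ Set.univ)
    (hT.trans h.image_univ.symm)
  exact ⟨(IposetHom.identity U).srcIso.trans f.symm⟩

theorem exists_strictMono (h : Enumerates P U T e) (h' : Enumerates P V T' e') (hT : T ⊆ T') :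
    ∃ f : Fin U.word.length → Fin V.word.length, StrictMono f ∧
      (∀ i, V.word.get (f i) = U.word.get i) ∧ e' ∘ f = e ∧ e' '' (Set.range f)ᶜ = T' \ T := by
  have mem_range : ∀ i, e i ∈ Set.range e' := fun i => h'.range ▸ hT (h.mem i)
  choose f hf using mem_range
  refine ⟨f, fun i j hij => ?_, fun i => by rw [← h'.label, hf, h.label], funext hf, ?_⟩
  · have hevord := h.mono i j hij
    rw [← hf, ← hf] at hevord
    rcases lt_trichotomy (f i) (f j) with hlt | heq | hgt
    · exact hlt
    · exact absurd (heq ▸ hevord) (P.evord_irrefl _)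
    · exact absurd (P.evord_trans _ _ _ hevord (h'.mono _ _ hgt)) (P.evord_irrefl _)
  · rw [h'.image_compl, ← Set.range_comp, ← h.range]
    exact congrArg (T' \ Set.range ·) (funext hf)

theorem exists_up (h : Enumerates P U T e) (h' : Enumerates P V T' e') (hT : T ⊆ T') :
    ∃ d : U ⟶ V, d.B = ∅ ∧ e' ∘ d.emb = e ∧ e' '' d.A = T' \ T := by
  obtain ⟨f, hf, hlabel, he, hcompl⟩ := h.exists_strictMono h' hT
  let d : Precube.Coface U V := ⟨f, (Set.range f)ᶜ, ∅, hf, hlabel, disjoint_bot_right,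
    by rw [Set.union_empty, compl_compl]⟩
  exact ⟨d, rfl, he, hcompl⟩

theorem exists_down (h : Enumerates P U T e) (h' : Enumerates P V T' e') (hT : T ⊆ T') :
    ∃ d : U ⟶ V, d.A = ∅ ∧ e' ∘ d.emb = e ∧ e' '' d.B = T' \ T := by
  obtain ⟨f, hf, hlabel, he, hcompl⟩ := h.exists_strictMono h' hT
  let d : Precube.Coface U V := ⟨f, ∅, (Set.range f)ᶜ, hf, hlabel, disjoint_bot_left,
    by rw [Set.empty_union, compl_compl]⟩
  exact ⟨d, rfl, he, hcompl⟩

end Enumerates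

/-! ### Prefixes -/

theorem Glued.subsumed_sub {C C' S S' : Set P.carrier} {φ : R.carrier → P.carrier}
    {u : (P.sub C P.src S).carrier → Q.carrier} {v : R.carrier → Q.carrier}
    (h : Glued (P.sub C P.src S) R Q u v) (hφ : IsEmbedding R P φ) (hsrc : P.src ⊆ C) (hS : S ⊆ C)
    (hφsrc : φ '' R.src = S) (hφtgt : φ '' R.tgt = S') (hC' : C' = C ∪ Set.range φ)
    (hmeet : ∀ i, φ i ∈ C → i ∈ R.src) (hmax : ∀ i, ∀ y ∈ C', ¬ P.prec (φ i) y) :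
    Subsumed Q (P.sub C' P.src S') := by
  have hCC' : C ⊆ C' := hC' ▸ Set.subset_union_left
  have hφC' : ∀ i, φ i ∈ C' := fun i => hC' ▸ Or.inr ⟨i, rfl⟩
  have hS'max : ∀ x ∈ S', ∀ y ∈ C', ¬ P.prec x y := by
    rw [← hφtgt]
    rintro _ ⟨i, -, rfl⟩
    exact hmax i
  have hSmax : ∀ x ∈ S, ∀ y ∈ C, ¬ P.prec x y := by
    rw [← hφsrc]
    rintro _ ⟨i, -, rfl⟩ y hy
    exact hmax i y (hCC' hy)
  have hS'C' : S' ⊆ C' := by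
    rw [← hφtgt]
    rintro _ ⟨i, -, rfl⟩
    exact hφC' i
  have src_min (D : Set P.carrier) : ∀ x ∈ P.src, ∀ y ∈ D, ¬ P.prec y x :=
    fun x hx y _ => P.src_min x hx y
  have hval := isEmbedding_subVal P C' P.src S'
  have image_injective := Set.image_injective.2 hval.injective
  obtain ⟨incl, hincl⟩ : ∃ incl : (P.sub C P.src S).carrier → (P.sub C' P.src S').carrier,
    ∀ x, subVal (incl x) = subVal x := ⟨fun x => ⟨subVal x, hCC' (subVal_mem x)⟩, fun _ => rfl⟩
  obtain ⟨φ', hφ'⟩ : ∃ φ' : R.carrier → (P.sub C' P.src S').carrier, ∀ i, subVal (φ' i) = φ i :=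
    ⟨fun i => ⟨φ i, hφC' i⟩, fun _ => rfl⟩
  refine h.subsumed_of_maps ((isEmbedding_subVal P C P.src S).toIsRefining.of_comp hval hincl)
    (hφ.toIsRefining.of_comp hval hφ') (image_injective ?_) (fun x i hxi => ?_)
    (fun x _ i _ => ?_) (fun x => ?_) (image_injective ?_) (image_injective ?_)
  · simp only [Set.image_image, hincl, hφ']
    exact (subVal_image_tgt hS hSmax).trans hφsrc.symm
  · replace hxi : subVal x = φ i := by rw [← hincl, hxi, hφ']
    have hxS : subVal x ∈ S :=
      hφsrc ▸ hxi ▸ Set.mem_image_of_mem φ (hmeet i (hxi ▸ subVal_mem x))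
    exact ⟨hxS, hSmax _ hxS⟩
  · rw [← hval.prec_iff, hincl, hφ']
    exact hmax i _ (hCC' (subVal_mem x))
  · rcases hC'.le (subVal_mem x) with hxC | ⟨i, hi⟩
    · exact Or.inl ⟨⟨subVal x, hxC⟩, hval.injective (hincl _)⟩
    · exact Or.inr ⟨i, hval.injective ((hφ' i).trans hi)⟩
  · simp only [Set.image_image, hincl]
    rw [subVal_image_src (hsrc.trans hCC') (src_min C'), subVal_image_src hsrc (src_min C)]
  · simp only [Set.image_image, hφ']
    exact hφtgt.trans (subVal_image_tgt hS'C' hS'max).symm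

section Steps

variable {C T : Set P.carrier} {U V : Precube α} {e : Fin V.word.length → P.carrier}

theorem Enumerates.subsumed_up (he : Enumerates P V T e) (hTC : T ⊆ C)
    (hmax : ∀ x ∈ T, ∀ y ∈ C, ¬ P.prec x y) (d : U ⟶ V) (hd : d.B = ∅)
    (hsrc : P.src ⊆ C \ e '' d.A) {u v}
    (h : Glued (P.sub (C \ e '' d.A) P.src (T \ e '' d.A)) (IposetHom.upStep d hd).iposet Q u v) :
    Subsumed Q (P.sub C P.src T) := by
  have hC : C = C \ e '' d.A ∪ Set.range e := by
    have hrange : Set.range e ⊆ C := he.range.trans_subset hTC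
    refine (Set.union_subset Set.sdiff_subset hrange).antisymm' fun x hx => ?_
    exact (em (x ∈ e '' d.A)).elim (fun h => Or.inr (Set.image_subset_range _ _ h))
      fun h => Or.inl ⟨hx, h⟩
  exact h.subsumed_sub (he.isEmbedding (fun x hx y hy => hmax x hx y (hTC hy)) _ _) hsrc
    (Set.sdiff_subset_sdiff_left hTC) (he.image_compl d.A) he.image_univ hC
    (fun i hi hA => hi.2 ⟨i, hA, rfl⟩) fun i => hmax _ (he.mem i)

theorem Enumerates.subsumed_down (he : Enumerates P V T e) (hTC : T ⊆ C)
    (hmax : ∀ x ∈ T, ∀ y ∈ C, ¬ P.prec x y) (d : U ⟶ V) (hd : d.A = ∅) (hsrc : P.src ⊆ C) {u v}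
    (h : Glued (P.sub C P.src T) (IposetHom.downStep d hd).iposet Q u v) :
    Subsumed Q (P.sub C P.src (T \ e '' d.B)) := by
  have hC : C = C ∪ Set.range e := by rw [he.range, Set.union_eq_self_of_subset_right hTC]
  exact h.subsumed_sub (he.isEmbedding (fun x hx y hy => hmax x hx y (hTC hy)) _ _) hsrc hTC
    he.image_univ (he.image_compl d.B) hC (fun _ _ => trivial) fun i => hmax _ (he.mem i)

end Steps

end Iposet

/-! ### States of cuts -/

namespace Iposet

variable {α : Type u} {P Q R Z : Iposet α} {ι : Type} {L : Set (Iposet α)}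
  {pre suf : ι → Set (Iposet α)}

/-- A split family of a down-closed set of interval iposets, indexed by a type in `Type` because
this is where the cells of an automaton live. -/
structure IsPresentation (L : Set (Iposet α)) (pre suf : ι → Set (Iposet α)) : Prop where
  interval : ∀ P ∈ L, P.IsInterval
  down : Iposet.down L ⊆ L
  sound : ∀ i, prod (pre i) (suf i) ⊆ L
  complete : ∀ P ∈ L, ∀ (r z : Iposet α) u v, Glued r z P u v → ∃ i, r ∈ pre i ∧ z ∈ suf i

theorem IsRecognizable.exists_isPresentation (h : IsRecognizable L)
    (hinterval : ∀ P ∈ L, P.IsInterval) (hdown : Iposet.down L ⊆ L) :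
    ∃ (ι : Type) (_ : Finite ι) (pre suf : ι → Set (Iposet α)), IsPresentation L pre suf := by
  obtain ⟨F, hF, hsplit⟩ := h.split
  have := hF.to_subtype
  obtain ⟨k, ⟨σ⟩⟩ := Finite.exists_equiv_fin F
  refine ⟨Fin k, inferInstance, fun i => (σ.symm i).1.1, fun i => (σ.symm i).1.2, hinterval, hdown,
    fun i => hsplit.sound _ (σ.symm i).2, fun P hP r z u v hG => ?_⟩
  obtain ⟨f, hf, hr, hz⟩ := hsplit.complete P hP r z u v hG
  refine ⟨σ ⟨f, hf⟩, ?_⟩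
  simp only [Equiv.symm_apply_apply]
  exact ⟨hr, hz⟩

theorem Glued.isomorphic_right {u : R.carrier → P.carrier} {v : Z.carrier → P.carrier}
    (h : Glued R Z P u v) (hsrc : R.src = Set.univ) (htgt : R.tgt = Set.univ) : Isomorphic Z P := by
  refine h.right.isomorphic (fun x => ?_) (by rw [← h.mid, htgt, ← hsrc, h.src]) h.tgt
  rcases h.cover x with ⟨a, rfl⟩ | hx
  · obtain ⟨b, -, hb⟩ := h.exists_right (htgt ▸ Set.mem_univ a)
    exact ⟨b, hb⟩
  · exact hx

theorem IsPresentation.step (h : IsPresentation L pre suf) {R₁ R₂ E Z Z' : Iposet α}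
    {V W : LoSet α} (hR₁ : R₁.IsInterval) (hE : E.IsInterval) {a b} (hZ' : Glued E Z Z' a b)
    (f₁ : LoIso V R₁.tgtLo) (g₁ : LoIso V Z'.srcLo) (f₂ : LoIso W R₂.tgtLo) (g₂ : LoIso W Z.srcLo)
    (hsub : ∀ (Y : Iposet α) u v, Glued R₁ E Y u v → Subsumed Y R₂) {i : ι} (hR₂ : R₂ ∈ pre i)
    (hZ : Z ∈ suf i) : ∃ j, R₁ ∈ pre j ∧ Z' ∈ suf j := by
  obtain ⟨G, u, v, hG, -⟩ := exists_glued f₁ g₁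
  obtain ⟨K, u', v', hK, -⟩ := exists_glued f₂ g₂
  have hKL : K ∈ L := h.sound i ⟨R₂, hR₂, Z, hZ, _, _, hK⟩
  obtain ⟨Y, w₁, w₂, w, hY, hYG, -⟩ := hZ'.assoc_symm hG
  have hGinterval : G.IsInterval :=
    hYG.isInterval (hY.isInterval hR₁ hE) (hK.right.isInterval (h.interval _ hKL))
  have hGK : Subsumed G K := hYG.subsumed hK (hsub _ _ _ hY) ⟨_, IsSubsumption.id Z⟩
  exact h.complete G (h.down ⟨hGinterval, K, hKL, hGK⟩) _ _ _ _ hG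

theorem Enumerates.nonempty_loIso_sub {C S T : Set P.carrier} {U : Precube α}
    {e : Fin U.word.length → P.carrier} (he : Enumerates P U T e) (hTC : T ⊆ C)
    (hmax : ∀ x ∈ T, ∀ y ∈ C, ¬ P.prec x y) : Nonempty (LoIso U.lo (P.sub C S T).tgtLo) :=
  he.nonempty_loIso_tgtLo (isEmbedding_subVal P C S T) (subVal_image_tgt hTC hmax)

theorem IsPresentation.mem_of_sub_src_mem (h : IsPresentation L pre suf) {U : Precube α}
    {e : Fin U.word.length → P.carrier} (he : Enumerates P U P.src e) {i : ι}
    (hi : P.sub P.src P.src P.src ∈ pre i) {W : LoSet α} (Z : IposetHom U.lo W)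
    (hZ : Z.iposet ∈ suf i) : Z.iposet ∈ L := by
  have antichain : ∀ x ∈ P.src, ∀ y ∈ P.src, ¬ P.prec x y := fun x _ y hy => P.src_min y hy x
  obtain ⟨f⟩ := he.nonempty_loIso_sub (S := P.src) (subset_refl P.src) antichain
  obtain ⟨G, u, v, hG, -⟩ := exists_glued f Z.srcIso
  have hGL : G ∈ L := h.sound i ⟨_, hi, _, hZ, _, _, hG⟩
  obtain ⟨φ, hφ⟩ := hG.isomorphic_right
    (Set.eq_univ_of_forall fun x => ⟨subVal_mem x, fun y hy => antichain y hy _ (subVal_mem x)⟩)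
    (Set.eq_univ_of_forall fun x => ⟨subVal_mem x, fun y hy => antichain _ (subVal_mem x) y hy⟩)
  exact h.down ⟨hG.right.isInterval (h.interval G hGL), G, hGL, φ, hφ.1⟩

open Classical in
/-- The state of the face of a cell at which the events in `C` have been started and those in `T`
are active: the matching sets of prefixes of `P`. If an event of the source interface has not been
started, then the face is not reached by `P` and puts no condition on suffixes. -/
noncomputable def cutState (pre : ι → Set (Iposet α)) (P : Iposet α) (C T : Set P.carrier) :
    Option (Set ι) :=
  if P.src ⊆ C then some {i | P.sub C P.src T ∈ pre i} else none

theorem mem_stateSuffixes_cutState {C T : Set P.carrier} :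
    Z ∈ HDA.stateSuffixes suf (cutState pre P C T) ↔
      (P.src ⊆ C → ∃ i, P.sub C P.src T ∈ pre i ∧ Z ∈ suf i) := by
  by_cases hsrc : P.src ⊆ C
  · rw [cutState, if_pos hsrc, forall_prop_of_true hsrc]
    rfl
  · rw [cutState, if_neg hsrc]
    exact iff_of_true trivial fun h => absurd h hsrc

/-- The states of the faces of the cell at a cut `(C, T)` with active events enumerated by `e`. -/
noncomputable def cutStates (pre : ι → Set (Iposet α)) (P : Iposet α) (C T : Set P.carrier)
    {U : Precube α} (e : Fin U.word.length → P.carrier) : HDA.FaceStates ι U :=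
  fun A B => cutState pre P (C \ e '' A) (T \ (e '' A ∪ e '' B))

section Steps

variable {C T : Set P.carrier} {U V : Precube α} {e : Fin V.word.length → P.carrier}

theorem cutStates_empty_right (A : Set (Fin V.word.length)) :
    cutStates pre P C T e A ∅ = cutState pre P (C \ e '' A) (T \ e '' A) := by
  rw [cutStates, Set.image_empty, Set.union_empty]

theorem cutStates_empty_left (B : Set (Fin V.word.length)) :
    cutStates pre P C T e ∅ B = cutState pre P C (T \ e '' B) := by
  rw [cutStates, Set.image_empty, Set.empty_union, Set.sdiff_empty]

theorem cellFace_cutStates (d : U ⟶ V) : HDA.cellFace d (cutStates pre P C T e) =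
    cutStates pre P (C \ e '' d.A) (T \ (e '' d.A ∪ e '' d.B)) (e ∘ d.emb) := by
  funext A B
  have hC : C \ e '' (d.emb '' A ∪ d.A) = (C \ e '' d.A) \ (e ∘ d.emb) '' A := by
    rw [Set.image_union, Set.image_comp, Set.sdiff_sdiff, Set.union_comm]
  have hT : T \ (e '' (d.emb '' A ∪ d.A) ∪ e '' (d.emb '' B ∪ d.B)) =
      (T \ (e '' d.A ∪ e '' d.B)) \ ((e ∘ d.emb) '' A ∪ (e ∘ d.emb) '' B) := by
    rw [Set.image_union, Set.image_union, Set.image_comp, Set.image_comp, Set.sdiff_sdiff,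
      Set.union_union_union_comm, Set.union_comm]
  exact congrArg₂ (cutState pre P) hC hT

variable (h : IsPresentation L pre suf) (hP : P.IsInterval) (he : Enumerates P V T e) (hTC : T ⊆ C)
  (hmax : ∀ x ∈ T, ∀ y ∈ C, ¬ P.prec x y)

include h hP he hTC hmax

theorem upStep_comp_mem_stateSuffixes (d : U ⟶ V) (hd : d.B = ∅) {W : LoSet α}
    (Z : IposetHom V.lo W) (hZ : Z.iposet ∈ HDA.stateSuffixes suf (cutStates pre P C T e ∅ ∅)) :
    ((IposetHom.upStep d hd).comp Z).iposet ∈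
      HDA.stateSuffixes suf (cutStates pre P C T e d.A d.B) := by
  rw [cutStates_empty_left, Set.image_empty, Set.sdiff_empty, mem_stateSuffixes_cutState] at hZ
  rw [hd, cutStates_empty_right, mem_stateSuffixes_cutState]
  intro hsrc
  obtain ⟨i, hi, hZi⟩ := hZ (hsrc.trans Set.sdiff_subset)
  have hed := he.comp d
  rw [hd, Set.image_empty, Set.union_empty] at hed
  obtain ⟨f⟩ := he.nonempty_loIso_sub (S := P.src) hTC hmax
  obtain ⟨f'⟩ := hed.nonempty_loIso_sub (S := P.src) (Set.sdiff_subset_sdiff_left hTC)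
    fun x hx y hy => hmax x hx.1 y hy.1
  exact h.step ((isEmbedding_subVal _ _ _ _).isInterval hP) (isInterval_discrete _ _ _)
    (glued_glue _) f' ((IposetHom.upStep d hd).comp Z).srcIso f Z.srcIso
    (fun _ _ _ hY => he.subsumed_up hTC hmax d hd hsrc hY) hi hZi

theorem downStep_comp_mem_stateSuffixes (d : U ⟶ V) (hd : d.A = ∅) {W : LoSet α}
    (Z : IposetHom U.lo W)
    (hZ : Z.iposet ∈ HDA.stateSuffixes suf (cutStates pre P C T e d.A d.B)) :
    ((IposetHom.downStep d hd).comp Z).iposet ∈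
      HDA.stateSuffixes suf (cutStates pre P C T e ∅ ∅) := by
  rw [hd, cutStates_empty_left, mem_stateSuffixes_cutState] at hZ
  rw [cutStates_empty_left, Set.image_empty, Set.sdiff_empty, mem_stateSuffixes_cutState]
  intro hsrc
  obtain ⟨i, hi, hZi⟩ := hZ hsrc
  have hed := he.comp d
  rw [hd, Set.image_empty, Set.empty_union] at hed
  obtain ⟨f⟩ := he.nonempty_loIso_sub (S := P.src) hTC hmax
  obtain ⟨f'⟩ := hed.nonempty_loIso_sub (S := P.src) (Set.sdiff_subset.trans hTC)
    fun x hx y hy => hmax x hx.1 y hy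
  exact h.step ((isEmbedding_subVal _ _ _ _).isInterval hP) (isInterval_discrete _ _ _)
    (glued_glue _) f ((IposetHom.downStep d hd).comp Z).srcIso f' Z.srcIso
    (fun _ _ _ hY => he.subsumed_down hTC hmax d hd hsrc hY) hi hZi

theorem isCell_cutStates : HDA.IsCell suf V (cutStates pre P C T e) := by
  have hTC' {X Y : Set P.carrier} : T \ (X ∪ Y) ⊆ C \ X :=
    Set.sdiff_subset_sdiff hTC Set.subset_union_left
  have hmax' {X Y : Set P.carrier} : ∀ x ∈ T \ (X ∪ Y), ∀ y ∈ C \ X, ¬ P.prec x y :=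
    fun x hx y hy => hmax x hx.1 y hy.1
  refine ⟨fun g d hd _ Z hZ => ?_, fun g d hd _ Z hZ => ?_⟩
  · change _ ∈ HDA.stateSuffixes suf (HDA.cellFace g (cutStates pre P C T e) d.A d.B)
    rw [← HDA.cellFace_empty g (cutStates pre P C T e), cellFace_cutStates] at hZ
    rw [cellFace_cutStates]
    exact upStep_comp_mem_stateSuffixes h hP (he.comp g) hTC' hmax' d hd Z hZ
  · change _ ∈ HDA.stateSuffixes suf (HDA.cellFace g (cutStates pre P C T e) d.A d.B) at hZ
    rw [cellFace_cutStates] at hZ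
    rw [← HDA.cellFace_empty g (cutStates pre P C T e), cellFace_cutStates]
    exact downStep_comp_mem_stateSuffixes h hP (he.comp g) hTC' hmax' d hd Z hZ

end Steps

end Iposet

/-! ### Accepting paths -/

namespace Iposet

variable {α : Type u} {P Q R Z : Iposet α} {ι : Type} {L : Set (Iposet α)}
  {pre suf : ι → Set (Iposet α)} {A : Set α} {n : ℕ} {C T T' : Set P.carrier}

theorem IsInterval.exists_preds_subset (hP : P.IsInterval) {X : Set P.carrier} (hX : X.Nonempty) :
    ∃ y ∈ X, ∀ z ∈ X, P.preds y ⊆ P.preds z := by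
  have := P.finite
  obtain ⟨y, hy, hmin⟩ := X.exists_min_image (fun x => (P.preds x).ncard) X.toFinite hX
  exact ⟨y, hy, fun z hz => preds_subset_preds (isInterval_iff.1 hP) (hmin z hz)⟩

theorem isCut_univ (P : Iposet α) : IsCut P Set.univ P.tgt where
  subset := Set.subset_univ _
  src := Set.subset_univ _
  tgt _ hx _ := hx
  max x hx y _ := P.tgt_max x hx y
  min _ _ y hy := absurd (Set.mem_univ y) hy
  lt _ _ _ y hy := absurd (Set.mem_univ y) hy

theorem isCut_src (P : Iposet α) : IsCut P P.src P.src where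
  subset := subset_rfl
  src := subset_rfl
  tgt _ _ hx := hx
  max x _ y hy := P.src_min y hy x
  min x hx y _ := P.src_min x hx y
  lt _ hx hx' := absurd hx hx'

namespace IsCut

theorem antichain (hc : IsCut P C T) : ∀ x ∈ T, ∀ y ∈ T, ¬ P.prec x y :=
  fun x hx y hy => hc.max x hx y (hc.subset hy)

theorem terminate (hc : IsCut P C T) {y : P.carrier} (hmin : ∀ z ∉ C, P.preds y ⊆ P.preds z) :
    IsCut P C {x ∈ T | ¬ P.prec x y} where
  subset x hx := hc.subset hx.1
  src := hc.src
  tgt x hx hC := ⟨hc.tgt x hx hC, P.tgt_max x hx y⟩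
  max x hx := hc.max x hx.1
  min x hx := hc.min x hx.1
  lt x hx hxT z hz := by
    by_cases hT : x ∈ T
    · exact hmin z hz (of_not_not fun hxy => hxT ⟨hT, hxy⟩)
    · exact hc.lt x hx hT z hz

theorem start (hc : IsCut P C T) {y : P.carrier} (hy : y ∉ C)
    (hmin : ∀ z ∉ C, P.preds y ⊆ P.preds z) (hT : ∀ x ∈ T, ¬ P.prec x y) :
    IsCut P (insert y C) (insert y T) where
  subset := Set.insert_subset_insert hc.subset
  src := hc.src.trans (Set.subset_insert _ _)
  tgt := by
    rintro x hx (rfl | hC)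
    · exact Or.inl rfl
    · exact Or.inr (hc.tgt x hx hC)
  max := by
    rintro x (rfl | hx) z (rfl | hz)
    · exact P.prec_irrefl _
    · by_cases hzT : z ∈ T
      · exact hc.min z hzT x hy
      · exact fun hxz => P.prec_irrefl _ (P.prec_trans _ _ _ hxz (hc.lt z hz hzT x hy))
    · exact hT x hx
    · exact hc.max x hx z hz
  min := by
    rintro x (rfl | hx) z hz hzx
    · exact P.prec_irrefl z (hmin z (fun hzC => hz (Or.inr hzC)) hzx)
    · exact hc.min x hx z (fun hzC => hz (Or.inr hzC)) hzx
  lt := by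
    rintro x (rfl | hx) hxT z hz
    · exact absurd (Or.inl rfl) hxT
    · exact hc.lt x hx (fun h => hxT (Or.inr h)) z fun h => hz (Or.inr h)

end IsCut

theorem IsSuffix.of_glued {G : Iposet α} {u : R.carrier → G.carrier} {v : Z.carrier → G.carrier}
    {j : Z.carrier → P.carrier} {φ : R.carrier → P.carrier} {C' : Set P.carrier}
    (hj : IsSuffix P C T Z j) (hc : IsCut P C T) (hG : Glued R Z G u v) (hφ : IsEmbedding R P φ)
    (hφC : Set.range φ ⊆ C) (hsrc : φ '' R.src = T') (htgt : φ '' R.tgt = T)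
    (hrange : Set.range φ ∪ Cᶜ = T' ∪ C'ᶜ) : ∃ f, IsSuffix P C' T' G f := by
  have mem_T_or_notMem (y) : j y ∈ T ∪ Cᶜ := hj.range ▸ Set.mem_range_self y
  have mem_T_iff (x) : φ x ∈ T ↔ x ∈ R.tgt := by rw [← htgt, hφ.injective.mem_set_image]
  have hmeet (x y) (hxy : φ x = j y) : x ∈ R.tgt := by
    have hxC : φ x ∈ C := hφC ⟨x, rfl⟩
    exact (mem_T_iff x).1 (hxy ▸ (mem_T_or_notMem y).resolve_right fun hy => hy (hxy ▸ hxC))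
  have hlt (x) (hx : x ∉ R.tgt) (y) (hy : y ∉ Z.src) : P.prec (φ x) (j y) := by
    have hyT : j y ∉ T := by rwa [← hj.src, hj.isEmbedding.injective.mem_set_image]
    exact hc.lt _ (hφC ⟨x, rfl⟩) (fun h => hx ((mem_T_iff x).1 h)) _
      ((mem_T_or_notMem y).resolve_left hyT)
  obtain ⟨f, hf, hu, hv⟩ :=
    hG.exists_isEmbedding hφ hj.isEmbedding (htgt.trans hj.src.symm) hmeet hlt
  have hcover : Set.range u ∪ Set.range v = Set.univ := Set.eq_univ_of_forall hG.cover
  have hTφ : T ⊆ Set.range φ := htgt ▸ Set.image_subset_range φ R.tgt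
  refine ⟨f, hf, ?_, ?_, ?_⟩
  · rw [← Set.image_univ, ← hcover, Set.image_union, ← Set.range_comp, ← Set.range_comp,
      show f ∘ u = φ from funext hu, show f ∘ v = j from funext hv, hj.range, ← Set.union_assoc,
      Set.union_eq_self_of_subset_right hTφ, hrange]
  · simp only [← hG.src, Set.image_image, hu, hsrc]
  · simp only [← hG.tgt, Set.image_image, hv, hj.tgt]

/-- From each cell at the cut `(C, T)`, there is a path to an accept cell whose ipomset is the
suffix of `P` at this cut. -/
def AcceptsCut (pre suf : ι → Set (Iposet α)) (A : Set α) (n : ℕ) (P : Iposet α)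
    (C T : Set P.carrier) : Prop :=
  ∀ (U : Precube α) (e : Fin U.word.length → P.carrier), Enumerates P U T e →
    ∀ x : HDA.Cell suf A n U, x.1 = cutStates pre P C T e →
      ∃ (V : Precube α) (y : HDA.Cell suf A n V) (p : HDA.Path (HDA.cellFunctor suf A n) x y),
        (IposetHom.identity V).iposet ∈ HDA.stateSuffixes suf (y.1 ∅ ∅) ∧
          ∃ j, IsSuffix P C T p.ev.iposet j

theorem IsPresentation.exists_cell (h : IsPresentation L pre suf) (hb : IsBounded L A n)
    (hP : P ∈ L) (hc : IsCut P C T) {U : Precube α} {e : Fin U.word.length → P.carrier}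
    (he : Enumerates P U T e) : ∃ x : HDA.Cell suf A n U, x.1 = cutStates pre P C T e :=
  ⟨⟨_, isCell_cutStates h (h.interval P hP) he hc.subset hc.max,
    hb.mem_words hP he.injective he.label fun i j => hc.antichain _ (he.mem i) _ (he.mem j)⟩, rfl⟩

theorem acceptsCut_univ (h : IsPresentation L pre suf) (hP : P ∈ L) :
    AcceptsCut pre suf A n P Set.univ P.tgt := by
  intro U e he x hx
  have hc := isCut_univ P
  have hsuffix : IsSuffix P Set.univ P.tgt (IposetHom.identity U).iposet e :=
    ⟨he.isEmbedding hc.antichain _ _, he.range.trans (by rw [Set.compl_univ, Set.union_empty]),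
      he.image_univ, he.image_univ⟩
  refine ⟨U, x, .nil x, ?_, e, hsuffix⟩
  rw [hx, cutStates_empty_left, Set.image_empty, Set.sdiff_empty, mem_stateSuffixes_cutState]
  exact fun _ => h.complete P hP _ _ _ _ (hc.glued_of_isSuffix hsuffix)

theorem AcceptsCut.terminate (hacc : AcceptsCut pre suf A n P C T') (hc : IsCut P C T)
    (hc' : IsCut P C T') (hT : T' ⊆ T) : AcceptsCut pre suf A n P C T := by
  intro U e he x hx
  obtain ⟨V, e', he'⟩ := exists_enumerates hc'.antichain
  obtain ⟨d, hd, hde, hdB⟩ := he'.exists_down he hT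
  have htgt : T \ e '' d.B = T' := by rw [hdB, Set.sdiff_sdiff_cancel_left hT]
  have hface : ((HDA.cellFunctor suf A n).map d.op x).1 = cutStates pre P C T' e' := by
    change HDA.cellFace d x.1 = _
    rw [hx, cellFace_cutStates, hd, Set.image_empty, Set.empty_union, Set.sdiff_empty, htgt, hde]
  obtain ⟨W, y, p, hy, j, hj⟩ := hacc V e' he' _ hface
  exact ⟨W, y, .down d hd x p, hy, hj.of_glued hc' (glued_glue _) (he.isEmbedding hc.antichain _ _)
    (he.range.trans_subset hc.subset) he.image_univ ((he.image_compl d.B).trans htgt)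
    (congrArg (· ∪ Cᶜ) he.range)⟩

theorem AcceptsCut.start (hacc : AcceptsCut pre suf A n P C T) (h : IsPresentation L pre suf)
    (hb : IsBounded L A n) (hP : P ∈ L) (hc : IsCut P C T) {D : Set P.carrier} (hD : D ⊆ T) :
    AcceptsCut pre suf A n P (C \ D) (T \ D) := by
  intro U e he x hx
  obtain ⟨V, e', he'⟩ := exists_enumerates hc.antichain
  obtain ⟨d, hd, hde, hdA⟩ := he.exists_up he' Set.sdiff_subset
  rw [Set.sdiff_sdiff_cancel_left hD] at hdA
  obtain ⟨z, hz⟩ := h.exists_cell hb hP hc he'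
  have hface : (HDA.cellFunctor suf A n).map d.op z = x := by
    refine Subtype.ext ?_
    change HDA.cellFace d z.1 = _
    rw [hz, hx, cellFace_cutStates, hd, Set.image_empty, Set.union_empty, hdA, hde]
  obtain ⟨W, y, p, hy, j, hj⟩ := hacc V e' he' z hz
  have hrange : Set.range e' ∪ Cᶜ = T \ D ∪ (C \ D)ᶜ := by
    rw [he'.range, Set.compl_sdiff, ← Set.union_assoc, Set.sdiff_union_of_subset hD]
  subst hface
  exact ⟨W, y, .up d hd z p, hy, hj.of_glued hc (glued_glue _) (he'.isEmbedding hc.antichain _ _)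
    (he'.range.trans_subset hc.subset) ((he'.image_compl d.A).trans (by rw [hdA])) he'.image_univ
    hrange⟩

theorem IsPresentation.acceptsCut (h : IsPresentation L pre suf) (hb : IsBounded L A n)
    (hP : P ∈ L) (hc : IsCut P C T) : AcceptsCut pre suf A n P C T := by
  have := P.finite
  induction hm : Cᶜ.ncard generalizing C T with
  | zero =>
    obtain rfl : C = Set.univ := by rwa [Set.ncard_eq_zero, Set.compl_empty_iff] at hm
    exact (acceptsCut_univ h hP).terminate hc (isCut_univ P) fun x hx => hc.tgt x hx trivial
  | succ m ih =>
    obtain ⟨y, hy, hmin⟩ := (h.interval P hP).exists_preds_subset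
      (Set.nonempty_of_ncard_ne_zero (hm.trans_ne m.succ_ne_zero))
    have hterminate := hc.terminate hmin
    have hstart := hterminate.start hy hmin fun x hx => hx.2
    have hcard : (insert y C)ᶜ.ncard = m := by
      rw [← Set.union_singleton, Set.compl_union, ← Set.sdiff_eq,
        Set.ncard_sdiff_singleton_of_mem hy, hm, Nat.add_sub_cancel]
    have hacc := (ih hstart hcard).start h hb hP hstart
      (Set.singleton_subset_iff.2 (Set.mem_insert y _))
    rw [Set.insert_sdiff_self_of_notMem hy,
      Set.insert_sdiff_self_of_notMem fun hyT => hy (hc.subset hyT.1)] at hacc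
    exact hacc.terminate hc hterminate (Set.sep_subset _ _)

theorem lang_cellHDA [Finite ι] {M : Set (Ipomset α)} (h : IsPresentation (Ipomset.reps M) pre suf)
    (hA : A.Finite) (hb : IsBounded (Ipomset.reps M) A n) :
    (HDA.cellHDA suf (Ipomset.reps M) hA n).lang = M := by
  ext q
  constructor
  · rintro ⟨U, V, x, y, p, hx, hy, rfl⟩
    exact hx V p.ev (HDA.ev_mem_stateSuffixes p hy)
  · intro hq
    obtain ⟨P, rfl⟩ := Ipomset.mk_surjective q
    have hc := isCut_src P
    obtain ⟨U, e, he⟩ := exists_enumerates hc.antichain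
    obtain ⟨x, hx⟩ := h.exists_cell hb hq hc he
    obtain ⟨V, y, p, hy, j, hj⟩ := h.acceptsCut hb hq hc U e he x hx
    refine ⟨U, V, x, y, p, fun W Z hZ => ?_, hy, ?_⟩
    · rw [hx, cutStates_empty_left, Set.image_empty, Set.sdiff_empty,
        mem_stateSuffixes_cutState] at hZ
      obtain ⟨i, hi, hZi⟩ := hZ subset_rfl
      exact h.mem_of_sub_src_mem he hi Z hZi
    · have hsurj : Function.Surjective j := by
        rw [← Set.range_eq_univ, hj.range, Set.union_compl_self]
      exact Ipomset.mk_eq_mk.2 (hj.isEmbedding.isomorphic hsurj hj.src hj.tgt).symm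

end Iposet

theorem mainTheorem2 {α : Type u} (L : Set (Ipomset α)) (hL : Ipomset.IsRational L) :
    Ipomset.IsRegular L := by
  have hlanguage := hL.isLanguage
  obtain ⟨A, n, hA, hbounded⟩ := hL.isRecognizable.bounded
  obtain ⟨ι, _, pre, suf, hpresentation⟩ := hL.isRecognizable.exists_isPresentation
    hlanguage.isInterval_of_mem_reps hlanguage.down_reps.le
  exact ⟨hlanguage, _, Iposet.lang_cellHDA hpresentation hA hbounded⟩
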